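/- All tensor products of C*-algebras are spatial (minimal). Let $(\mathcal Q,\Delta)$ be a compact quantum group with $\mathcal Q\neq 0$, i.e. a unital C*-algebra $\mathcal Q$ with a unital $*$-homomorphism $\Delta:\mathcal Q\to\mathcal Q\otimes\mathcal Q$ such that $(\Delta\otimes\mathrm{id})\Delta=(\mathrm{id}\otimes\Delta)\Delta$ and the linear spans of $\Delta(\mathcal Q)(\mathcal Q\otimes 1)$ and of $\Delta(\mathcal Q)(1\otimes\mathcal Q)$ are norm-dense in $\mathcal Q\otimes\mathcal Q$. Let $h$ be its Haar state, i.e. the unique state with $(\mathrm{id}\otimes h)\Delta(a)=h(a)1=(h\otimes\mathrm{id})\Delta(a)$ for all $a\in\mathcal Q$, let $\pi_r$ be the GNS representation of $h$ and $\mathcal Q_r=\pi_r(\mathcal Q)$. Let $\mathcal C$ be a unital separable C*-algebra and $\alpha$ an action of $\mathcal Q$ on $\mathcal C$, i.e. a unital $*$-homomorphism $\alpha:\mathcal C\to\mathcal C\otimes\mathcal Q$ such that $(\alpha\otimes\mathrm{id})\alpha=(\mathrm{id}\otimes\Delta)\alpha$ and the linear span of $\alpha(\mathcal C)(1\otimes\mathcal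 Q)$ is norm-dense in $\mathcal C\otimes\mathcal Q$. Then the following are equivalent. (a) There is a faithful positive linear functional $\phi$ on $\mathcal C$ (that is, $\phi(x^*x)=0$ implies $x=0$) which is invariant under $\alpha$: $(\phi\otimes\mathrm{id})(\alpha(x))=\phi(x)1_{\mathcal Q}$ for all $x\in\mathcal C$. (b) The action $\alpha$ is implemented by a unitary representation of $\mathcal Q$: there are a Hilbert space $\mathcal H$, a unitary $U$ in the algebra $\mathcal L(\mathcal H\otimes\mathcal Q)$ of adjointable operators on the Hilbert $\mathcal Q$-module $\mathcal H\otimes\mathcal Q$ such that $V:\mathcal H\to\mathcal H\otimes\mathcal Q$, $V\xi=U(\xi\otimes 1)$, satisfies $(V\otimes\mathrm{id})V=(\mathrm{id}\otimes\Delta)V$, and a faithful unital $*$-representation $\pi:\mathcal C\to\mathcal B(\mathcal H)$ such that $U(\pi(x)\otimes 1)U^*=(\pi\otimes\mathrm{id})(\alpha(x))$ for all $x\in\mathcal C$. (c) The reduced action $\alpha_r=(\mathrm{id}\otimes\pi_r)\circ\alpha:\mathcal C\to\mathcal C\otimes\mathcal Q_r$ is injective. -/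

import Mathlib

open scoped TensorProduct ComplexOrder InnerProductSpace

universe u

noncomputable section

namespace CQG

open UniformSpace

/-! ### Representations and the spatial norm -/

/-- The Hilbert space tensor product: the completion of the algebraic one. -/
def HilbTensor (H K : Type u) [NormedAddCommGroup H] [InnerProductSpace ℂ H]
    [NormedAddCommGroup K] [InnerProductSpace ℂ K] : Type u := Completion (H ⊗[ℂ] K)

namespace HilbTensor
variable {H K : Type u}
  [NormedAddCommGroup H] [InnerProductSpace ℂ H] [NormedAddCommGroup K] [InnerProductSpace ℂ K]

instance : NormedAddCommGroup (HilbTensor H K) :=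
  inferInstanceAs (NormedAddCommGroup (Completion (H ⊗[ℂ] K)))
instance : InnerProductSpace ℂ (HilbTensor H K) :=
  inferInstanceAs (InnerProductSpace ℂ (Completion (H ⊗[ℂ] K)))
instance : CompleteSpace (HilbTensor H K) :=
  inferInstanceAs (CompleteSpace (Completion (H ⊗[ℂ] K)))

/-- The canonical map of the algebraic tensor product into the Hilbert space tensor product. -/
def of : H ⊗[ℂ] K →ₗ[ℂ] HilbTensor H K := (Completion.toComplₗᵢ (𝕜 := ℂ)).toLinearMap

theorem inner_of (x y : H ⊗[ℂ] K) : ⟪of x, of y⟫_ℂ = ⟪x, y⟫_ℂ := Completion.inner_coe x y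

theorem norm_of (x : H ⊗[ℂ] K) : ‖of x‖ = ‖x‖ := Completion.norm_coe x

theorem induction_of {p : HilbTensor H K → Prop} (x : HilbTensor H K)
    (hp : IsClosed {x | p x}) (h : ∀ t, p (of t)) : p x := Completion.induction_on x hp h

/-- The operator `S ⊗ T`. -/
def op (S : H →L[ℂ] H) (T : K →L[ℂ] K) : HilbTensor H K →L[ℂ] HilbTensor H K :=
  (TensorProduct.mapL S T).completion

theorem op_of (S : H →L[ℂ] H) (T : K →L[ℂ] K) (t : H ⊗[ℂ] K) :
    op S T (of t) = of (TensorProduct.map S.toLinearMap T.toLinearMap t) := by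
  refine (ContinuousLinearMap.completion_apply_coe _ _).trans ?_
  rw [TensorProduct.mapL_apply]; rfl

theorem ext_of {S T : HilbTensor H K →L[ℂ] HilbTensor H K}
    (h : ∀ x y, S (of (x ⊗ₜ y)) = T (of (x ⊗ₜ y))) : S = T := by
  ext x
  refine induction_of (p := fun x => S x = T x) x (isClosed_eq S.continuous T.continuous) fun t => ?_
  induction t with
  | zero => simp
  | add s t hs ht => rw [map_add, map_add, map_add, hs, ht]
  | tmul x y => exact h x y

theorem op_of_tmul (S : H →L[ℂ] H) (T : K →L[ℂ] K) (x : H) (y : K) :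
    op S T (of (x ⊗ₜ y)) = of (S x ⊗ₜ T y) := op_of S T _

theorem norm_op_le (S : H →L[ℂ] H) (T : K →L[ℂ] K) : ‖op S T‖ ≤ ‖S‖ * ‖T‖ := by
  refine ContinuousLinearMap.opNorm_le_bound _ (by positivity) fun x => ?_
  refine induction_of (p := fun x => ‖op S T x‖ ≤ ‖S‖ * ‖T‖ * ‖x‖) x
    (isClosed_le (by fun_prop) (by fun_prop)) fun t => ?_
  rw [op_of, norm_of, norm_of, ← TensorProduct.mapL_apply]
  refine (ContinuousLinearMap.le_opNorm _ t).trans ?_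
  gcongr
  exact TensorProduct.norm_mapL_le _ _

theorem op_adjoint [CompleteSpace H] [CompleteSpace K] (S : H →L[ℂ] H) (T : K →L[ℂ] K) :
    op (star S) (star T) = star (op S T) := by
  rw [ContinuousLinearMap.star_eq_adjoint (op S T), ContinuousLinearMap.eq_adjoint_iff]
  intro x y
  refine induction_of (p := fun x => ⟪op (star S) (star T) x, y⟫_ℂ = ⟪x, op S T y⟫_ℂ) x
    (isClosed_eq (by fun_prop) (by fun_prop)) fun s => ?_
  refine induction_of (p := fun y => ⟪op (star S) (star T) (of s), y⟫_ℂ = ⟪of s, op S T y⟫_ℂ) y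
    (isClosed_eq (by fun_prop) (by fun_prop)) fun t => ?_
  rw [op_of, op_of, inner_of, inner_of]
  induction s with
  | zero => simp
  | add x x' hx hx' => simp only [map_add, inner_add_left, hx, hx']
  | tmul x x' =>
    induction t with
    | zero => simp
    | add y y' hy hy' => simp only [map_add, inner_add_right, hy, hy']
    | tmul y y' =>
      simp [ContinuousLinearMap.star_eq_adjoint, ContinuousLinearMap.adjoint_inner_left]
end HilbTensor


/-- A (unital) `*`-representation of a unital C*-algebra on a Hilbert space. Hilbert spaces in the
universe of the algebra suffice, because they include all GNS spaces (see `exists_rep_norm`). -/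
structure Rep (A : Type u) [CStarAlgebra A] where
  H : Type u
  [normedAddCommGroup : NormedAddCommGroup H]
  [innerProductSpace : InnerProductSpace ℂ H]
  [completeSpace : CompleteSpace H]
  hom : A →⋆ₐ[ℂ] (H →L[ℂ] H)

attribute [instance] Rep.normedAddCommGroup Rep.innerProductSpace Rep.completeSpace

section tensorOp

variable {A B H K : Type u} [CStarAlgebra A] [CStarAlgebra B]
  [NormedAddCommGroup H] [InnerProductSpace ℂ H] [CompleteSpace H]
  [NormedAddCommGroup K] [InnerProductSpace ℂ K] [CompleteSpace K]

/-- The linear map `a ⊗ b ↦ π a ⊗ ρ b`. -/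
def tensorOpLin (π : A →⋆ₐ[ℂ] (H →L[ℂ] H)) (ρ : B →⋆ₐ[ℂ] (K →L[ℂ] K)) :
    A ⊗[ℂ] B →ₗ[ℂ] (HilbTensor H K →L[ℂ] HilbTensor H K) :=
  TensorProduct.lift (LinearMap.mk₂ ℂ (fun a b => HilbTensor.op (π a) (ρ b))
    (fun a a' b => HilbTensor.ext_of fun x y => by
      simp [HilbTensor.op_of_tmul, TensorProduct.add_tmul])
    (fun c a b => HilbTensor.ext_of fun x y => by
      simp [HilbTensor.op_of_tmul, ← TensorProduct.smul_tmul'])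
    (fun a b b' => HilbTensor.ext_of fun x y => by
      simp [HilbTensor.op_of_tmul, TensorProduct.tmul_add])
    (fun c a b => HilbTensor.ext_of fun x y => by
      simp [HilbTensor.op_of_tmul]))

/-- The tensor product `π ⊗ ρ` of two representations, on the algebraic tensor product:
`a ⊗ b` acts on the Hilbert space tensor product as `π a ⊗ ρ b`. -/
def tensorOp (π : A →⋆ₐ[ℂ] (H →L[ℂ] H)) (ρ : B →⋆ₐ[ℂ] (K →L[ℂ] K)) :
    A ⊗[ℂ] B →⋆ₐ[ℂ] (HilbTensor H K →L[ℂ] HilbTensor H K) where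
  __ := Algebra.TensorProduct.algHomOfLinearMapTensorProduct (tensorOpLin π ρ)
    (fun a a' b b' => HilbTensor.ext_of fun x y => by simp [tensorOpLin, HilbTensor.op_of_tmul])
    (HilbTensor.ext_of fun x y => by simp [tensorOpLin, HilbTensor.op_of_tmul])
  map_star' t := by
    change tensorOpLin π ρ (star t) = star (tensorOpLin π ρ t)
    induction t with
    | zero => simp
    | add s t hs ht => simp only [star_add, map_add, hs, ht]
    | tmul a b =>
      simp only [TensorProduct.star_tmul, tensorOpLin, TensorProduct.lift.tmul,
        LinearMap.mk₂_apply, map_star, HilbTensor.op_adjoint]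

theorem tensorOp_tmul (π : A →⋆ₐ[ℂ] (H →L[ℂ] H)) (ρ : B →⋆ₐ[ℂ] (K →L[ℂ] K)) (a : A) (b : B) :
    tensorOp π ρ (a ⊗ₜ b) = HilbTensor.op (π a) (ρ b) := rfl

theorem norm_tensorOp_tmul_le (π : A →⋆ₐ[ℂ] (H →L[ℂ] H)) (ρ : B →⋆ₐ[ℂ] (K →L[ℂ] K)) (a : A)
    (b : B) : ‖tensorOp π ρ (a ⊗ₜ b)‖ ≤ ‖a‖ * ‖b‖ := by
  rw [tensorOp_tmul]
  refine (HilbTensor.norm_op_le _ _).trans ?_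
  gcongr
  · exact NonUnitalStarAlgHom.norm_apply_le π a
  · exact NonUnitalStarAlgHom.norm_apply_le ρ b

end tensorOp

section MinTensor

variable {A B : Type u} [CStarAlgebra A] [CStarAlgebra B]

theorem exists_bound_tensorOp (t : A ⊗[ℂ] B) :
    ∃ M : ℝ, ∀ p : Rep A × Rep B, ‖tensorOp p.1.hom p.2.hom t‖ ≤ M := by
  induction t with
  | zero => exact ⟨0, fun p => by simp⟩
  | add t s ht hs =>
    obtain ⟨M, hM⟩ := ht
    obtain ⟨N, hN⟩ := hs
    exact ⟨M + N, fun p => by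
      rw [map_add]; exact (norm_add_le _ _).trans (add_le_add (hM p) (hN p))⟩
  | tmul a b =>
    exact ⟨‖a‖ * ‖b‖, fun p => norm_tensorOp_tmul_le _ _ a b⟩

/-- The spatial (minimal) C*-norm on the algebraic tensor product: the supremum of the operator norms
`‖(π ⊗ ρ)(t)‖` over all representations `π` of `A` and `ρ` of `B`. -/
def minNorm (t : A ⊗[ℂ] B) : ℝ := ⨆ p : Rep A × Rep B, ‖tensorOp p.1.hom p.2.hom t‖

theorem le_minNorm (p : Rep A) (q : Rep B) (t : A ⊗[ℂ] B) :
    ‖tensorOp p.hom q.hom t‖ ≤ minNorm t := by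
  obtain ⟨M, hM⟩ := exists_bound_tensorOp t
  exact le_ciSup (f := fun p : Rep A × Rep B => ‖tensorOp p.1.hom p.2.hom t‖)
    ⟨M, by rintro _ ⟨p, rfl⟩; exact hM p⟩ (p, q)

theorem minNorm_nonneg (t : A ⊗[ℂ] B) : 0 ≤ minNorm t := Real.iSup_nonneg fun _ => norm_nonneg _

theorem minNorm_le {t : A ⊗[ℂ] B} {M : ℝ} (hM : 0 ≤ M)
    (h : ∀ (p : Rep A) (q : Rep B), ‖tensorOp p.hom q.hom t‖ ≤ M) : minNorm t ≤ M :=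
  Real.iSup_le (fun p => h p.1 p.2) hM

theorem minNorm_tmul_le (a : A) (b : B) : minNorm (a ⊗ₜ[ℂ] b) ≤ ‖a‖ * ‖b‖ :=
  minNorm_le (by positivity) fun p q => norm_tensorOp_tmul_le _ _ a b

theorem minNorm_star_le (t : A ⊗[ℂ] B) : minNorm (star t) ≤ minNorm t :=
  minNorm_le (minNorm_nonneg t) fun p q => by
    rw [map_star, norm_star]; exact le_minNorm p q t

theorem minNorm_sq_le (t : A ⊗[ℂ] B) : minNorm t * minNorm t ≤ minNorm (star t * t) := by
  rw [← sq, ← Real.le_sqrt (minNorm_nonneg _) (minNorm_nonneg _)]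
  refine minNorm_le (Real.sqrt_nonneg _) fun p q => ?_
  rw [Real.le_sqrt (norm_nonneg _) (minNorm_nonneg _), sq, ← CStarRing.norm_star_mul_self,
    ← map_star, ← map_mul]
  exact le_minNorm p q _

variable (A B) in
/-- The algebraic tensor product, to be equipped with the spatial norm. -/
def AlgMin : Type u := A ⊗[ℂ] B

instance : Ring (AlgMin A B) := inferInstanceAs (Ring (A ⊗[ℂ] B))
instance : Algebra ℂ (AlgMin A B) := inferInstanceAs (Algebra ℂ (A ⊗[ℂ] B))
instance : StarRing (AlgMin A B) := inferInstanceAs (StarRing (A ⊗[ℂ] B))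
instance : StarModule ℂ (AlgMin A B) := inferInstanceAs (StarModule ℂ (A ⊗[ℂ] B))

variable (A B) in
/-- The identity map from the algebraic tensor product to its normed copy. -/
def toAlgMin : A ⊗[ℂ] B →⋆ₐ[ℂ] AlgMin A B := StarAlgHom.id ℂ (A ⊗[ℂ] B)

instance : SeminormedRing (AlgMin A B) :=
  { (inferInstance : Ring (AlgMin A B)),
    (AddGroupSeminorm.toSeminormedAddCommGroup
      { toFun := fun t : AlgMin A B => minNorm (A := A) (B := B) t
        map_zero' := le_antisymm (minNorm_le le_rfl fun p q => by
            rw [show (tensorOp p.hom q.hom) (0 : AlgMin A B) = 0 from map_zero _, norm_zero])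
          (minNorm_nonneg _)
        add_le' := fun s t => minNorm_le (add_nonneg (minNorm_nonneg _) (minNorm_nonneg _))
          fun p q => by
            rw [show (tensorOp p.hom q.hom) (s + t : AlgMin A B)
              = tensorOp p.hom q.hom s + tensorOp p.hom q.hom t from map_add _ _ _]
            exact (norm_add_le _ _).trans (add_le_add (le_minNorm p q s) (le_minNorm p q t))
        neg' := fun t => congrArg (fun f : Rep A × Rep B → ℝ => ⨆ p, f p) (funext fun p => by
            rw [show (tensorOp p.1.hom p.2.hom) (-t : AlgMin A B)
              = - tensorOp p.1.hom p.2.hom t from map_neg _ _, norm_neg]) } :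
      SeminormedAddCommGroup (AlgMin A B)) with
    norm_mul_le := fun s t => minNorm_le (mul_nonneg (minNorm_nonneg _) (minNorm_nonneg _))
      fun p q => by
        rw [show (tensorOp p.hom q.hom) (s * t : AlgMin A B)
          = tensorOp p.hom q.hom s * tensorOp p.hom q.hom t from map_mul _ _ _]
        exact (norm_mul_le _ _).trans (mul_le_mul (le_minNorm p q s) (le_minNorm p q t)
          (norm_nonneg _) (minNorm_nonneg _)) }

theorem norm_toAlgMin (t : A ⊗[ℂ] B) : ‖toAlgMin A B t‖ = minNorm t := rfl

instance : NormedAlgebra ℂ (AlgMin A B) where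
  norm_smul_le c t := minNorm_le (mul_nonneg (norm_nonneg _) (minNorm_nonneg _)) fun p q => by
    rw [show (tensorOp p.hom q.hom) (c • t : AlgMin A B)
      = c • tensorOp p.hom q.hom t from map_smul _ _ _, norm_smul]
    exact mul_le_mul_of_nonneg_left (le_minNorm p q t) (norm_nonneg _)

instance : NormedStarGroup (AlgMin A B) where
  norm_star_le t := minNorm_star_le (A := A) (B := B) t

variable (A B) in
/-- The spatial (minimal) tensor product `A ⊗ B` of C*-algebras: the completion of the algebraic
tensor product in the spatial norm. -/
def MinTensor : Type u := Completion (AlgMin A B)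

instance : NormedRing (MinTensor A B) := inferInstanceAs (NormedRing (Completion (AlgMin A B)))
instance : CompleteSpace (MinTensor A B) :=
  inferInstanceAs (CompleteSpace (Completion (AlgMin A B)))
instance : Algebra ℂ (MinTensor A B) := inferInstanceAs (Algebra ℂ (Completion (AlgMin A B)))

instance : NormedAlgebra ℂ (MinTensor A B) where
  norm_smul_le c x := by
    refine Completion.induction_on (α := AlgMin A B) x ?_ fun t => ?_
    · exact isClosed_le (continuous_norm.comp (continuous_const_smul (T := Completion (AlgMin A B)) c))
        (continuous_const.mul continuous_norm)
    · exact ((congrArg norm (Completion.coe_smul c t)).symm.trans (Completion.norm_coe _)).trans_le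
        ((norm_smul_le c t).trans_eq (congrArg (‖c‖ * ·) (Completion.norm_coe t).symm))

/-- The canonical map of the normed algebraic tensor product into its completion. -/
def MinTensor.coe (t : AlgMin A B) : MinTensor A B := (t : Completion (AlgMin A B))

theorem MinTensor.norm_coe (t : AlgMin A B) : ‖MinTensor.coe t‖ = ‖t‖ := Completion.norm_coe t

theorem MinTensor.continuous_coe : Continuous (MinTensor.coe (A := A) (B := B)) :=
  Completion.continuous_coe _

theorem MinTensor.denseRange_coe : DenseRange (MinTensor.coe (A := A) (B := B)) :=
  Completion.denseRange_coe

theorem MinTensor.coe_mul (s t : AlgMin A B) :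
    MinTensor.coe (s * t) = MinTensor.coe s * MinTensor.coe t := Completion.coe_mul s t

theorem MinTensor.coe_add (s t : AlgMin A B) :
    MinTensor.coe (s + t) = MinTensor.coe s + MinTensor.coe t := Completion.coe_add s t

theorem MinTensor.coe_smul (c : ℂ) (t : AlgMin A B) :
    MinTensor.coe (c • t) = c • MinTensor.coe t := Completion.coe_smul c t

instance : Star (MinTensor A B) where
  star := Completion.map (star : AlgMin A B → AlgMin A B)

theorem MinTensor.uniformContinuous_star :
    UniformContinuous (star : AlgMin A B → AlgMin A B) := by
  have h : Isometry (star : AlgMin A B → AlgMin A B) := star_isometry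
  exact h.uniformContinuous

theorem MinTensor.continuous_star : Continuous (star : MinTensor A B → MinTensor A B) :=
  Completion.continuous_map

theorem MinTensor.coe_star (t : AlgMin A B) : star (MinTensor.coe t) = MinTensor.coe (star t) :=
  Completion.map_coe MinTensor.uniformContinuous_star t

theorem MinTensor.induction {p : MinTensor A B → Prop} (x : MinTensor A B)
    (hp : IsClosed {x | p x}) (h : ∀ t : AlgMin A B, p (MinTensor.coe t)) : p x :=
  Completion.induction_on x hp h

theorem MinTensor.induction₂ {p : MinTensor A B → MinTensor A B → Prop} (x y : MinTensor A B)
    (hp : IsClosed {x : MinTensor A B × MinTensor A B | p x.1 x.2})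
    (h : ∀ s t : AlgMin A B, p (MinTensor.coe s) (MinTensor.coe t)) : p x y :=
  Completion.induction_on₂ x y hp h

instance : StarRing (MinTensor A B) where
  star_involutive x := by
    refine MinTensor.induction (p := fun x => star (star x) = x) x (isClosed_eq
      (MinTensor.continuous_star.comp MinTensor.continuous_star) continuous_id) fun t => ?_
    rw [MinTensor.coe_star, MinTensor.coe_star, star_star]
  star_mul x y := by
    have := MinTensor.continuous_star (A := A) (B := B)
    refine MinTensor.induction₂ (p := fun x y => star (x * y) = star y * star x) x y (isClosed_eq (by fun_prop) (by fun_prop)) fun s t => ?_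
    rw [← MinTensor.coe_mul, MinTensor.coe_star, star_mul, MinTensor.coe_star,
      MinTensor.coe_star, MinTensor.coe_mul]
  star_add x y := by
    have := MinTensor.continuous_star (A := A) (B := B)
    refine MinTensor.induction₂ (p := fun x y => star (x + y) = star x + star y) x y (isClosed_eq (by fun_prop) (by fun_prop)) fun s t => ?_
    rw [← MinTensor.coe_add, MinTensor.coe_star, star_add, MinTensor.coe_star,
      MinTensor.coe_star, MinTensor.coe_add]

instance : StarModule ℂ (MinTensor A B) where
  star_smul c x := by
    have h1 : Continuous fun x : MinTensor A B => star (c • x) :=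
      MinTensor.continuous_star.comp (continuous_const_smul c)
    have h2 : Continuous fun x : MinTensor A B => star c • star x :=
      (continuous_const_smul (star c)).comp MinTensor.continuous_star
    refine MinTensor.induction (p := fun x => star (c • x) = star c • star x) x
      (isClosed_eq h1 h2) fun t => ?_
    rw [← MinTensor.coe_smul, MinTensor.coe_star, star_smul, MinTensor.coe_star,
      MinTensor.coe_smul]

instance : CStarRing (MinTensor A B) where
  norm_mul_self_le x := by
    have := MinTensor.continuous_star (A := A) (B := B)
    refine MinTensor.induction (p := fun x => ‖x‖ * ‖x‖ ≤ ‖star x * x‖) x (isClosed_le (by fun_prop) (by fun_prop)) fun t => ?_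
    rw [MinTensor.coe_star, ← MinTensor.coe_mul, MinTensor.norm_coe, MinTensor.norm_coe]
    exact minNorm_sq_le (A := A) (B := B) t

instance : CStarAlgebra (MinTensor A B) where

variable (A B) in
/-- The canonical `*`-homomorphism of the algebraic tensor product into `MinTensor A B`. -/
def MinTensor.of : A ⊗[ℂ] B →⋆ₐ[ℂ] MinTensor A B where
  toFun t := MinTensor.coe (toAlgMin A B t)
  map_one' := rfl
  map_mul' s t := by rw [map_mul, MinTensor.coe_mul]
  map_zero' := rfl
  map_add' s t := by rw [map_add, MinTensor.coe_add]
  commutes' c := by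
    rw [Algebra.algebraMap_eq_smul_one, map_smul, MinTensor.coe_smul,
      Algebra.algebraMap_eq_smul_one]
    rfl
  map_star' t := by rw [map_star, MinTensor.coe_star]

/-- The elementary tensor `a ⊗ b`. -/
def MinTensor.tmul (a : A) (b : B) : MinTensor A B := MinTensor.of A B (a ⊗ₜ b)

theorem MinTensor.norm_of (t : A ⊗[ℂ] B) : ‖MinTensor.of A B t‖ = minNorm t :=
  MinTensor.norm_coe _

theorem MinTensor.denseRange_of : DenseRange (MinTensor.of A B) := MinTensor.denseRange_coe

/-- A linear map on the algebraic tensor product that is bounded for the spatial norm extends to the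
completion. -/
def MinTensor.liftL {E : Type*} [NormedAddCommGroup E] [NormedSpace ℂ E] [CompleteSpace E]
    (f : A ⊗[ℂ] B →ₗ[ℂ] E) (C : ℝ) (hf : ∀ t, ‖f t‖ ≤ C * minNorm t) : MinTensor A B →L[ℂ] E :=
  ContinuousLinearMap.fromCompletion (LinearMap.mkContinuous (E := AlgMin A B) f C hf)

theorem MinTensor.liftL_of {E : Type*} [NormedAddCommGroup E] [NormedSpace ℂ E] [CompleteSpace E]
    (f : A ⊗[ℂ] B →ₗ[ℂ] E) (C : ℝ) (hf : ∀ t, ‖f t‖ ≤ C * minNorm t) (t : A ⊗[ℂ] B) :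
    MinTensor.liftL f C hf (MinTensor.of A B t) = f t :=
  ContinuousLinearMap.fromCompletion_apply_coe _ _

theorem MinTensor.induction_of {p : MinTensor A B → Prop} (x : MinTensor A B)
    (hp : IsClosed {x | p x}) (h : ∀ t, p (MinTensor.of A B t)) : p x :=
  MinTensor.induction x hp h

theorem MinTensor.induction_of₂ {p : MinTensor A B → MinTensor A B → Prop} (x y : MinTensor A B)
    (hp : IsClosed {x : MinTensor A B × MinTensor A B | p x.1 x.2})
    (h : ∀ s t, p (MinTensor.of A B s) (MinTensor.of A B t)) : p x y :=
  MinTensor.induction₂ x y hp h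

variable {A' B' : Type u} [CStarAlgebra A'] [CStarAlgebra B']

theorem minNorm_map_le (f : A →⋆ₐ[ℂ] A') (g : B →⋆ₐ[ℂ] B') (t : A ⊗[ℂ] B) :
    minNorm (TensorProduct.map f.toAlgHom.toLinearMap g.toAlgHom.toLinearMap t) ≤ minNorm t := by
  refine minNorm_le (minNorm_nonneg _) fun p q => ?_
  have h : tensorOp p.hom q.hom (TensorProduct.map f.toAlgHom.toLinearMap g.toAlgHom.toLinearMap t)
      = tensorOp (p.hom.comp f) (q.hom.comp g) t := by
    induction t with
    | zero => simp
    | add s t hs ht => simp only [map_add, hs, ht]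
    | tmul a b => rfl
  rw [h]
  exact le_minNorm ⟨p.H, p.hom.comp f⟩ ⟨q.H, q.hom.comp g⟩ t

/-- The underlying continuous linear map of `f ⊗ g`. -/
def MinTensor.mapL (f : A →⋆ₐ[ℂ] A') (g : B →⋆ₐ[ℂ] B') : MinTensor A B →L[ℂ] MinTensor A' B' :=
  MinTensor.liftL ((MinTensor.of A' B').toAlgHom.toLinearMap ∘ₗ
    TensorProduct.map f.toAlgHom.toLinearMap g.toAlgHom.toLinearMap) 1 fun t => by
      rw [one_mul]
      exact (MinTensor.norm_of _).le.trans (minNorm_map_le f g t)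

theorem MinTensor.mapL_of (f : A →⋆ₐ[ℂ] A') (g : B →⋆ₐ[ℂ] B') (t : A ⊗[ℂ] B) :
    MinTensor.mapL f g (MinTensor.of A B t) = MinTensor.of A' B'
      (TensorProduct.map f.toAlgHom.toLinearMap g.toAlgHom.toLinearMap t) :=
  MinTensor.liftL_of _ _ _ _

/-- The tensor product `f ⊗ g` of `*`-homomorphisms, `a ⊗ b ↦ f a ⊗ g b`. -/
def MinTensor.map (f : A →⋆ₐ[ℂ] A') (g : B →⋆ₐ[ℂ] B') : MinTensor A B →⋆ₐ[ℂ] MinTensor A' B' where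
  toFun := MinTensor.mapL f g
  map_one' := by
    rw [← map_one (MinTensor.of A B), MinTensor.mapL_of, Algebra.TensorProduct.one_def,
      TensorProduct.map_tmul, ← map_one (MinTensor.of A' B'), Algebra.TensorProduct.one_def]
    simp
  map_mul' x y := by
    refine MinTensor.induction_of₂
      (p := fun x y => MinTensor.mapL f g (x * y) = MinTensor.mapL f g x * MinTensor.mapL f g y)
      x y (isClosed_eq (by fun_prop) (by fun_prop)) fun s t => ?_
    rw [← map_mul, MinTensor.mapL_of, MinTensor.mapL_of, MinTensor.mapL_of, ← map_mul]
    congr 1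
    exact map_mul (Algebra.TensorProduct.map f.toAlgHom g.toAlgHom) s t
  map_zero' := map_zero _
  map_add' := map_add _
  commutes' c := by
    rw [Algebra.algebraMap_eq_smul_one, map_smul, Algebra.algebraMap_eq_smul_one,
      ← map_one (MinTensor.of A B), MinTensor.mapL_of, Algebra.TensorProduct.one_def,
      TensorProduct.map_tmul, ← map_one (MinTensor.of A' B'), Algebra.TensorProduct.one_def]
    simp
  map_star' x := by
    refine MinTensor.induction_of
      (p := fun x => MinTensor.mapL f g (star x) = star (MinTensor.mapL f g x)) x (isClosed_eq (by fun_prop) (by fun_prop)) fun t => ?_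
    rw [← map_star, MinTensor.mapL_of, MinTensor.mapL_of, ← map_star]
    congr 1
    induction t with
    | zero => simp
    | add s t hs ht => simp only [map_add, star_add, hs, ht]
    | tmul a b =>
      exact congrArg₂ (· ⊗ₜ[ℂ] ·) (map_star f a) (map_star g b)

theorem MinTensor.continuous_map (f : A →⋆ₐ[ℂ] A') (g : B →⋆ₐ[ℂ] B') :
    Continuous (MinTensor.map f g) := (MinTensor.mapL f g).continuous

theorem MinTensor.map_of (f : A →⋆ₐ[ℂ] A') (g : B →⋆ₐ[ℂ] B') (t : A ⊗[ℂ] B) :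
    MinTensor.map f g (MinTensor.of A B t) = MinTensor.of A' B'
      (TensorProduct.map f.toAlgHom.toLinearMap g.toAlgHom.toLinearMap t) :=
  MinTensor.mapL_of f g t

theorem MinTensor.map_tmul (f : A →⋆ₐ[ℂ] A') (g : B →⋆ₐ[ℂ] B') (a : A) (b : B) :
    MinTensor.map f g (MinTensor.tmul a b) = MinTensor.tmul (f a) (g b) :=
  MinTensor.map_of f g _

end MinTensor


/-! ### Every C*-algebra has enough representations -/

section GelfandNaimark

variable {A : Type u} [CStarAlgebra A]

theorem im_eq_zero_of_norm_le_one (g : A →L[ℂ] ℂ) (hg : ‖g‖ ≤ 1) (h1 : g 1 = 1) (a : A)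
    (ha : IsSelfAdjoint a) : (g a).im = 0 := by
  cases subsingleton_or_nontrivial A with
  | inl h => rw [Subsingleton.elim a 0, map_zero, Complex.zero_im]
  | inr h =>
  have key : ∀ t : ℝ, (g a).re ^ 2 + ((g a).im + t) ^ 2 ≤ ‖a‖ ^ 2 + t ^ 2 := by
    intro t
    set c : A := a + ((t : ℂ) * Complex.I) • (1 : A) with hc
    have hgc : g c = g a + t * Complex.I := by simp [hc, h1]
    have h2 : ‖g c‖ ^ 2 = (g a).re ^ 2 + ((g a).im + t) ^ 2 := by
      rw [hgc, ← Complex.normSq_eq_norm_sq, Complex.normSq_apply]; simp; ring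
    have h3 : star c * c = a * a + ((t : ℂ) ^ 2) • (1 : A) := by
      simp only [hc, star_add, star_smul, ha.star_eq, star_one, mul_add, add_mul, smul_mul_assoc,
        mul_smul_comm, one_mul, mul_one, star_mul, Complex.star_def, Complex.conj_I,
        Complex.conj_ofReal]
      have h4 : (t : ℂ) ^ 2 = (t * Complex.I) * (-Complex.I * t) := by
        ring_nf; simp
      rw [h4]
      module
    have h5 : ‖c‖ ^ 2 ≤ ‖a‖ ^ 2 + t ^ 2 := by
      rw [sq, ← CStarRing.norm_star_mul_self, h3]
      refine (norm_add_le _ _).trans (add_le_add ((norm_mul_le _ _).trans_eq (sq _).symm) ?_)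
      rw [norm_smul, norm_one, mul_one, norm_pow, Complex.norm_real, Real.norm_eq_abs, sq_abs]
    rw [← h2]
    refine le_trans ?_ h5
    gcongr
    exact (g.le_of_opNorm_le hg c).trans_eq (one_mul _)
  by_contra h0
  have h := key ((‖a‖ ^ 2 + 1) / (2 * (g a).im))
  have h6 : 2 * ((g a).im * ((‖a‖ ^ 2 + 1) / (2 * (g a).im))) = ‖a‖ ^ 2 + 1 := by
    field_simp
  nlinarith [sq_nonneg (g a).re, sq_nonneg (g a).im]

theorem nonneg_of_norm_le_one [PartialOrder A] [StarOrderedRing A] (g : A →L[ℂ] ℂ) (hg : ‖g‖ ≤ 1)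
    (h1 : g 1 = 1) (a : A) (ha : 0 ≤ a) : 0 ≤ g a := by
  have him := im_eq_zero_of_norm_le_one g hg h1 a (IsSelfAdjoint.of_nonneg ha)
  have h2 : a ≤ algebraMap ℝ A ‖a‖ := (IsSelfAdjoint.of_nonneg ha).le_algebraMap_norm_self
  have h3 : ‖algebraMap ℝ A ‖a‖ - a‖ ≤ ‖a‖ := by
    rw [CStarAlgebra.norm_le_iff_le_algebraMap _ (norm_nonneg _) (sub_nonneg.2 h2)]
    exact sub_le_self _ ha
  have h4 : g (algebraMap ℝ A ‖a‖) = ‖a‖ := by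
    rw [Algebra.algebraMap_eq_smul_one, ← Complex.coe_smul, map_smul, h1]; simp
  have h5 := (g.le_of_opNorm_le hg (algebraMap ℝ A ‖a‖ - a)).trans ((one_mul _).trans_le h3)
  rw [map_sub, h4] at h5
  have h6 := (Complex.abs_re_le_norm _).trans h5
  rw [Complex.sub_re, Complex.ofReal_re] at h6
  rw [Complex.nonneg_iff]
  exact ⟨by linarith [(abs_le.1 h6).2], him.symm⟩

/-- The cyclic vector of the GNS representation. -/
def cyclic [PartialOrder A] [StarOrderedRing A] (φ : A →ₚ[ℂ] ℂ) : φ.GNS :=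
  ((φ.toPreGNS 1 : φ.PreGNS) : Completion φ.PreGNS)

theorem inner_cyclic [PartialOrder A] [StarOrderedRing A] (φ : A →ₚ[ℂ] ℂ) (a : A) :
    ⟪cyclic φ, φ.gnsStarAlgHom a (cyclic φ)⟫_ℂ = φ a := by
  have h : φ.gnsStarAlgHom a (cyclic φ) = ((φ.leftMulMapPreGNS a (φ.toPreGNS 1) : φ.PreGNS) :
      Completion φ.PreGNS) := φ.gnsNonUnitalStarAlgHom_apply_coe
  rw [h, cyclic, Completion.inner_coe, φ.preGNS_inner_def]
  simp

theorem norm_cyclic_sq [PartialOrder A] [StarOrderedRing A] (φ : A →ₚ[ℂ] ℂ) :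
    ((‖cyclic φ‖ ^ 2 : ℝ) : ℂ) = φ 1 := by
  have h := inner_cyclic φ 1
  rw [map_one, one_apply_eq_self, inner_self_eq_norm_sq_to_K] at h
  simpa using h

/-- The norm of an element is attained in some representation. -/
theorem exists_rep_norm (a : A) : ∃ p : Rep A, ‖a‖ ≤ ‖p.hom a‖ := by
  let _ := CStarAlgebra.spectralOrder A
  have _ := CStarAlgebra.spectralOrderedRing A
  cases subsingleton_or_nontrivial A with
  | inl h =>
    refine ⟨⟨(0 : A →ₚ[ℂ] ℂ).GNS, (0 : A →ₚ[ℂ] ℂ).gnsStarAlgHom⟩, ?_⟩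
    rw [Subsingleton.elim a 0, norm_zero]; exact norm_nonneg _
  | inr h =>
    have hb : IsSelfAdjoint (star a * a) := IsSelfAdjoint.star_mul_self a
    have : IsStarNormal (star a * a) := hb.isStarNormal
    let S := StarAlgebra.elemental ℂ (star a * a)
    let b : S := ⟨star a * a, StarAlgebra.elemental.self_mem ℂ (star a * a)⟩
    have hbS : IsSelfAdjoint b := Subtype.ext hb
    obtain ⟨z, hz, hzn⟩ := spectrum.exists_nnnorm_eq_spectralRadius b
    rw [hbS.spectralRadius_eq_nnnorm] at hzn
    obtain ⟨χ, hχ⟩ := WeakDual.CharacterSpace.mem_spectrum_iff_exists.1 hz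
    let χL : S →L[ℂ] ℂ := WeakDual.toStrongDual (χ : WeakDual ℂ S)
    have hχn : ‖χL‖ ≤ 1 :=
      (WeakDual.CharacterSpace.norm_le_norm_one χ).trans (by rw [norm_one])
    obtain ⟨g, hgχ, hgn⟩ := exists_extension_norm_eq (𝕜 := ℂ) S.toSubalgebra.toSubmodule χL
    have hg1 : g 1 = 1 := (hgχ (1 : S)).trans (map_one χ)
    have hgb : g (star a * a) = z := (hgχ b).trans hχ
    have hgn1 : ‖g‖ ≤ 1 := hgn.trans_le hχn
    let φ : A →ₚ[ℂ] ℂ := PositiveLinearMap.mk₀ g.toLinearMap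
      fun x hx => nonneg_of_norm_le_one g hgn1 hg1 x hx
    refine ⟨⟨φ.GNS, φ.gnsStarAlgHom⟩, ?_⟩
    change ‖a‖ ≤ ‖φ.gnsStarAlgHom a‖
    have hξ : ‖cyclic φ‖ = 1 := by
      have h2 : ((‖cyclic φ‖ ^ 2 : ℝ) : ℂ) = 1 := (norm_cyclic_sq φ).trans hg1
      have h3 : ‖cyclic φ‖ ^ 2 = 1 := by exact_mod_cast h2
      nlinarith [norm_nonneg (cyclic φ)]
    have hz2 : ‖z‖ = ‖a‖ ^ 2 := by
      have h2 : ‖z‖ = ‖b‖ := congrArg NNReal.toReal (ENNReal.coe_inj.1 hzn)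
      rw [h2, sq, ← CStarRing.norm_star_mul_self]; rfl
    have h4 : ‖z‖ ≤ ‖φ.gnsStarAlgHom (star a * a)‖ := by
      have h5 : ⟪cyclic φ, φ.gnsStarAlgHom (star a * a) (cyclic φ)⟫_ℂ = z :=
        (inner_cyclic φ _).trans hgb
      rw [← h5]
      refine (norm_inner_le_norm _ _).trans ?_
      rw [hξ, one_mul]
      exact (ContinuousLinearMap.le_opNorm _ _).trans (by rw [hξ, mul_one])
    rw [map_mul, map_star, hz2] at h4
    replace h4 := h4.trans_eq (CStarRing.norm_star_mul_self (x := φ.gnsStarAlgHom a))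
    rw [← sq] at h4
    exact le_of_sq_le_sq h4 (norm_nonneg _)

end GelfandNaimark

/-! ### Slice maps -/

section Slice

variable {A B : Type u} [CStarAlgebra A] [CStarAlgebra B]

/-- The algebraic slice map `a ⊗ b ↦ φ a • b`. -/
def algSliceLeft (φ : A →ₗ[ℂ] ℂ) : A ⊗[ℂ] B →ₗ[ℂ] B :=
  (TensorProduct.lid ℂ B).toLinearMap ∘ₗ TensorProduct.map φ LinearMap.id

/-- The algebraic slice map `a ⊗ b ↦ ψ b • a`. -/
def algSliceRight (ψ : B →ₗ[ℂ] ℂ) : A ⊗[ℂ] B →ₗ[ℂ] A :=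
  (TensorProduct.rid ℂ A).toLinearMap ∘ₗ TensorProduct.map LinearMap.id ψ

/-- An operator is bounded by its matrix coefficients. -/
theorem opNorm_le_of_inner {K : Type*} [NormedAddCommGroup K] [InnerProductSpace ℂ K]
    (T : K →L[ℂ] K) (M : ℝ) (hM : 0 ≤ M) (h : ∀ x y, ‖⟪x, T y⟫_ℂ‖ ≤ M * (‖x‖ * ‖y‖)) :
    ‖T‖ ≤ M := by
  refine ContinuousLinearMap.opNorm_le_bound _ hM fun y => ?_
  have h1 := h (T y) y
  rw [inner_self_eq_norm_sq_to_K, norm_pow, RCLike.norm_ofReal, abs_norm] at h1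
  rcases (norm_nonneg (T y)).eq_or_lt with h0 | h0
  · rw [← h0]; positivity
  · nlinarith

theorem norm_algSliceLeft_le [PartialOrder A] [StarOrderedRing A] (φ : A →ₚ[ℂ] ℂ) (t : A ⊗[ℂ] B) :
    ‖algSliceLeft φ.toLinearMap t‖ ≤ ‖cyclic φ‖ ^ 2 * minNorm t := by
  obtain ⟨q, hq⟩ := exists_rep_norm (algSliceLeft φ.toLinearMap t)
  refine hq.trans (opNorm_le_of_inner _ _ (mul_nonneg (by positivity) (minNorm_nonneg t))
    fun x y => ?_)
  have h : ⟪x, q.hom (algSliceLeft φ.toLinearMap t) y⟫_ℂ =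
      ⟪HilbTensor.of (cyclic φ ⊗ₜ x),
        tensorOp φ.gnsStarAlgHom q.hom t (HilbTensor.of (cyclic φ ⊗ₜ y))⟫_ℂ := by
    clear hq
    induction t with
    | zero => simp
    | add s t hs ht => simp only [map_add, add_apply, inner_add_right, hs, ht]
    | tmul a b =>
      rw [tensorOp_tmul, HilbTensor.op_of_tmul, HilbTensor.inner_of, TensorProduct.inner_tmul,
        inner_cyclic]
      simp [algSliceLeft]
  rw [h]
  refine (norm_inner_le_norm _ _).trans ?_
  have h1 := (ContinuousLinearMap.le_opNorm (tensorOp φ.gnsStarAlgHom q.hom t)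
    (HilbTensor.of (cyclic φ ⊗ₜ y))).trans (mul_le_mul_of_nonneg_right
      (le_minNorm ⟨φ.GNS, φ.gnsStarAlgHom⟩ q t) (norm_nonneg _))
  refine (mul_le_mul_of_nonneg_left h1 (norm_nonneg _)).trans_eq ?_
  rw [HilbTensor.norm_of, HilbTensor.norm_of, TensorProduct.norm_tmul, TensorProduct.norm_tmul]
  ring

theorem norm_algSliceRight_le [PartialOrder B] [StarOrderedRing B] (ψ : B →ₚ[ℂ] ℂ)
    (t : A ⊗[ℂ] B) : ‖algSliceRight ψ.toLinearMap t‖ ≤ ‖cyclic ψ‖ ^ 2 * minNorm t := by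
  obtain ⟨q, hq⟩ := exists_rep_norm (algSliceRight ψ.toLinearMap t)
  refine hq.trans (opNorm_le_of_inner _ _ (mul_nonneg (by positivity) (minNorm_nonneg t))
    fun x y => ?_)
  have h : ⟪x, q.hom (algSliceRight ψ.toLinearMap t) y⟫_ℂ =
      ⟪HilbTensor.of (x ⊗ₜ cyclic ψ),
        tensorOp q.hom ψ.gnsStarAlgHom t (HilbTensor.of (y ⊗ₜ cyclic ψ))⟫_ℂ := by
    clear hq
    induction t with
    | zero => simp
    | add s t hs ht => simp only [map_add, add_apply, inner_add_right, hs, ht]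
    | tmul a b =>
      rw [tensorOp_tmul, HilbTensor.op_of_tmul, HilbTensor.inner_of, TensorProduct.inner_tmul,
        inner_cyclic]
      simp [algSliceRight, mul_comm]
  rw [h]
  refine (norm_inner_le_norm _ _).trans ?_
  have h1 := (ContinuousLinearMap.le_opNorm (tensorOp q.hom ψ.gnsStarAlgHom t)
    (HilbTensor.of (y ⊗ₜ cyclic ψ))).trans (mul_le_mul_of_nonneg_right
      (le_minNorm q ⟨ψ.GNS, ψ.gnsStarAlgHom⟩ t) (norm_nonneg _))
  refine (mul_le_mul_of_nonneg_left h1 (norm_nonneg _)).trans_eq ?_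
  rw [HilbTensor.norm_of, HilbTensor.norm_of, TensorProduct.norm_tmul, TensorProduct.norm_tmul]
  ring

/-- The slice map `φ ⊗ id : A ⊗ B → B` of a positive functional `φ` on `A`. -/
def sliceLeft [PartialOrder A] [StarOrderedRing A] (φ : A →ₚ[ℂ] ℂ) : MinTensor A B →L[ℂ] B :=
  MinTensor.liftL (algSliceLeft φ.toLinearMap) _ (norm_algSliceLeft_le φ)

/-- The slice map `id ⊗ ψ : A ⊗ B → A` of a positive functional `ψ` on `B`. -/
def sliceRight [PartialOrder B] [StarOrderedRing B] (ψ : B →ₚ[ℂ] ℂ) : MinTensor A B →L[ℂ] A :=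
  MinTensor.liftL (algSliceRight ψ.toLinearMap) _ (norm_algSliceRight_le ψ)

theorem sliceLeft_tmul [PartialOrder A] [StarOrderedRing A] (φ : A →ₚ[ℂ] ℂ) (a : A) (b : B) :
    sliceLeft φ (MinTensor.tmul a b) = φ a • b :=
  MinTensor.liftL_of _ _ (norm_algSliceLeft_le φ) (a ⊗ₜ b)

theorem sliceRight_tmul [PartialOrder B] [StarOrderedRing B] (ψ : B →ₚ[ℂ] ℂ) (a : A) (b : B) :
    sliceRight ψ (MinTensor.tmul a b) = ψ b • a :=
  MinTensor.liftL_of _ _ (norm_algSliceRight_le ψ) (a ⊗ₜ b)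

end Slice

/-! ### The Hilbert module `H ⊗ A` -/

section HilbertModule

variable {H A : Type u} [NormedAddCommGroup H] [InnerProductSpace ℂ H] [CStarAlgebra A]

/-- The sesquilinear map `(a, b) ↦ a* b`. -/
def starMul (A : Type u) [CStarAlgebra A] : A →ₗ⋆[ℂ] A →ₗ[ℂ] A :=
  LinearMap.mk₂'ₛₗ (starRingEnd ℂ) (RingHom.id ℂ) (fun a b => star a * b)
    (fun a a' b => by rw [star_add, add_mul]) (fun c a b => by
      rw [star_smul, smul_mul_assoc, starRingEnd_apply])
    (fun a b b' => mul_add _ _ _) (fun c a b => mul_smul_comm _ _ _)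

variable (H A) in
/-- The `A`-valued inner product on the algebraic tensor product:
`⟪h ⊗ a, k ⊗ b⟫ = ⟪h, k⟫ a* b`, conjugate-linear in the first variable. -/
def algInner : H ⊗[ℂ] A →ₗ⋆[ℂ] H ⊗[ℂ] A →ₗ[ℂ] A :=
  ((TensorProduct.lift (TensorProduct.mapBilinear (.id ℂ) H A ℂ A)).compr₂
    (TensorProduct.lid ℂ A).toLinearMap) ∘ₛₗ TensorProduct.map (innerₛₗ ℂ) (starMul A)

theorem algInner_tmul (h k : H) (a b : A) :
    algInner H A (h ⊗ₜ a) (k ⊗ₜ b) = ⟪h, k⟫_ℂ • (star a * b) := rfl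

theorem star_algInner (x y : H ⊗[ℂ] A) : star (algInner H A x y) = algInner H A y x := by
  induction x with
  | zero => simp
  | add x x' hx hx' => simp only [map_add, LinearMap.add_apply, star_add, hx, hx']
  | tmul h a =>
    induction y with
    | zero => simp
    | add y y' hy hy' => simp only [map_add, LinearMap.add_apply, star_add, hy, hy']
    | tmul k b =>
      rw [algInner_tmul, algInner_tmul, star_smul, star_mul, star_star, Complex.star_def,
        inner_conj_symm]

/-- For a representation `ρ` of `A` on `K`, the operator `K → H ⊗ K`, `k ↦ h ⊗ ρ(a) k`, attached
to `h ⊗ a`. -/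
def evalOp {K : Type u} [NormedAddCommGroup K] [InnerProductSpace ℂ K] [CompleteSpace K]
    (ρ : A →⋆ₐ[ℂ] (K →L[ℂ] K)) (k : K) : H ⊗[ℂ] A →ₗ[ℂ] HilbTensor H K :=
  HilbTensor.of ∘ₗ TensorProduct.map LinearMap.id
    ((ContinuousLinearMap.apply ℂ K k).toLinearMap ∘ₗ ρ.toAlgHom.toLinearMap)

theorem evalOp_tmul {K : Type u} [NormedAddCommGroup K] [InnerProductSpace ℂ K] [CompleteSpace K]
    (ρ : A →⋆ₐ[ℂ] (K →L[ℂ] K)) (k : K) (h : H) (a : A) :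
    evalOp ρ k (h ⊗ₜ a) = HilbTensor.of (h ⊗ₜ ρ a k) := rfl

theorem inner_evalOp {K : Type u} [NormedAddCommGroup K] [InnerProductSpace ℂ K] [CompleteSpace K]
    (ρ : A →⋆ₐ[ℂ] (K →L[ℂ] K)) (k k' : K) (x y : H ⊗[ℂ] A) :
    ⟪evalOp ρ k x, evalOp ρ k' y⟫_ℂ = ⟪k, ρ (algInner H A x y) k'⟫_ℂ := by
  induction x with
  | zero => simp
  | add x x' hx hx' =>
    simp only [map_add, LinearMap.add_apply, inner_add_left, inner_add_right, add_apply, hx, hx']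
  | tmul h a =>
    induction y with
    | zero => simp
    | add y y' hy hy' => simp only [map_add, inner_add_right, add_apply, hy, hy']
    | tmul h' b =>
      rw [evalOp_tmul, evalOp_tmul, HilbTensor.inner_of, TensorProduct.inner_tmul, algInner_tmul,
        map_smul, map_mul, map_star, smul_apply, inner_smul_right, mul_apply_eq_comp,
        ContinuousLinearMap.star_eq_adjoint, ContinuousLinearMap.adjoint_inner_right]

/-- The norm `‖x‖ = ‖⟪x, x⟫‖ ^ (1/2)`. -/
def modNorm (x : H ⊗[ℂ] A) : ℝ := √‖algInner H A x x‖

theorem modNorm_nonneg (x : H ⊗[ℂ] A) : 0 ≤ modNorm x := Real.sqrt_nonneg _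

theorem modNorm_neg (x : H ⊗[ℂ] A) : modNorm (-x) = modNorm x := by
  rw [modNorm, modNorm, map_neg, map_neg, LinearMap.neg_apply, neg_neg]

theorem modNorm_sq (x : H ⊗[ℂ] A) : modNorm x ^ 2 = ‖algInner H A x x‖ :=
  Real.sq_sqrt (norm_nonneg _)

theorem norm_evalOp_le {K : Type u} [NormedAddCommGroup K] [InnerProductSpace ℂ K]
    [CompleteSpace K] (ρ : A →⋆ₐ[ℂ] (K →L[ℂ] K)) (k : K) (x : H ⊗[ℂ] A) :
    ‖evalOp ρ k x‖ ≤ modNorm x * ‖k‖ := by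
  refine le_of_sq_le_sq ?_ (mul_nonneg (modNorm_nonneg x) (norm_nonneg k))
  have h := inner_self_eq_norm_sq_to_K (𝕜 := ℂ) (evalOp ρ k x)
  rw [inner_evalOp] at h
  have h2 : ‖evalOp ρ k x‖ ^ 2 = ‖⟪k, ρ (algInner H A x x) k⟫_ℂ‖ := by rw [h]; simp
  rw [h2, mul_pow, modNorm_sq]
  refine (norm_inner_le_norm _ _).trans ?_
  have h3 := (ContinuousLinearMap.le_opNorm (ρ (algInner H A x x)) k).trans
    (mul_le_mul_of_nonneg_right (NonUnitalStarAlgHom.norm_apply_le ρ _) (norm_nonneg k))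
  nlinarith [norm_nonneg k]

/-- A bound for an inner product from bounds in all representations. -/
theorem norm_algInner_le_of (x y : H ⊗[ℂ] A) (M N : ℝ) (hM : 0 ≤ M) (hN : 0 ≤ N)
    (hx : ∀ (p : Rep A) (k : p.H), ‖evalOp p.hom k x‖ ≤ M * ‖k‖)
    (hy : ∀ (p : Rep A) (k : p.H), ‖evalOp p.hom k y‖ ≤ N * ‖k‖) :
    ‖algInner H A x y‖ ≤ M * N := by
  obtain ⟨p, hp⟩ := exists_rep_norm (algInner H A x y)
  refine hp.trans (opNorm_le_of_inner _ _ (mul_nonneg hM hN) fun k k' => ?_)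
  rw [← inner_evalOp]
  refine (norm_inner_le_norm _ _).trans ((mul_le_mul (hx p k) (hy p k') (norm_nonneg _)
    (mul_nonneg hM (norm_nonneg _))).trans_eq ?_)
  ring

/-- The Cauchy-Schwarz inequality. -/
theorem norm_algInner_le (x y : H ⊗[ℂ] A) : ‖algInner H A x y‖ ≤ modNorm x * modNorm y :=
  norm_algInner_le_of x y _ _ (modNorm_nonneg x) (modNorm_nonneg y)
    (fun p k => norm_evalOp_le p.hom k x) (fun p k => norm_evalOp_le p.hom k y)

theorem modNorm_le_of (x : H ⊗[ℂ] A) (M : ℝ) (hM : 0 ≤ M)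
    (hx : ∀ (p : Rep A) (k : p.H), ‖evalOp p.hom k x‖ ≤ M * ‖k‖) : modNorm x ≤ M := by
  refine le_of_sq_le_sq ?_ hM
  rw [modNorm_sq, sq]
  exact norm_algInner_le_of x x M M hM hM hx hx

variable (H A) in
/-- The algebraic tensor product `H ⊗ A`, to be equipped with the Hilbert module norm. -/
def AlgMod : Type u := H ⊗[ℂ] A

instance : AddCommGroup (AlgMod H A) := inferInstanceAs (AddCommGroup (H ⊗[ℂ] A))
instance : Module ℂ (AlgMod H A) := inferInstanceAs (Module ℂ (H ⊗[ℂ] A))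

instance : SeminormedAddCommGroup (AlgMod H A) :=
  AddGroupSeminorm.toSeminormedAddCommGroup
    { toFun := fun x : AlgMod H A => modNorm (H := H) (A := A) x
      map_zero' := le_antisymm (modNorm_le_of _ _ le_rfl fun p k => by
        rw [show evalOp p.hom k (0 : AlgMod H A) = 0 from map_zero _, norm_zero, zero_mul])
        (modNorm_nonneg _)
      add_le' := fun x y => modNorm_le_of _ _ (add_nonneg (modNorm_nonneg _) (modNorm_nonneg _))
        fun p k => by
          rw [show evalOp p.hom k (x + y : AlgMod H A) = evalOp p.hom k x + evalOp p.hom k y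
            from map_add _ _ _, add_mul]
          exact (norm_add_le _ _).trans
            (add_le_add (norm_evalOp_le p.hom k x) (norm_evalOp_le p.hom k y))
      neg' := fun x => modNorm_neg (H := H) (A := A) x }

instance : NormedSpace ℂ (AlgMod H A) where
  norm_smul_le c x := modNorm_le_of _ _ (mul_nonneg (norm_nonneg _) (modNorm_nonneg _))
    fun p k => by
      rw [show evalOp p.hom k (c • x : AlgMod H A) = c • evalOp p.hom k x from map_smul _ _ _,
        norm_smul, mul_assoc]
      exact mul_le_mul_of_nonneg_left (norm_evalOp_le p.hom k x) (norm_nonneg _)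

variable (H A) in
/-- The Hilbert `A`-module `H ⊗ A`: the completion of the algebraic tensor product in the norm
`‖⟪x, x⟫‖ ^ (1/2)`. -/
def HilbMod : Type u := Completion (AlgMod H A)

namespace HilbMod

instance : NormedAddCommGroup (HilbMod H A) :=
  inferInstanceAs (NormedAddCommGroup (Completion (AlgMod H A)))
instance : NormedSpace ℂ (HilbMod H A) :=
  inferInstanceAs (NormedSpace ℂ (Completion (AlgMod H A)))
instance : CompleteSpace (HilbMod H A) :=
  inferInstanceAs (CompleteSpace (Completion (AlgMod H A)))

variable (H A) in
/-- The canonical map of the algebraic tensor product into the Hilbert module. -/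
def of : H ⊗[ℂ] A →ₗ[ℂ] HilbMod H A :=
  (Completion.toComplₗᵢ (𝕜 := ℂ) (E := AlgMod H A)).toLinearMap

/-- The elementary tensor `h ⊗ a`. -/
def tmul (h : H) (a : A) : HilbMod H A := of H A (h ⊗ₜ a)

theorem norm_of (x : H ⊗[ℂ] A) : ‖of H A x‖ = modNorm x :=
  Completion.norm_coe (E := AlgMod H A) x

theorem denseRange_of : DenseRange (of H A) := Completion.denseRange_coe (α := AlgMod H A)

theorem induction_of {p : HilbMod H A → Prop} (x : HilbMod H A)
    (hp : IsClosed {x | p x}) (h : ∀ t, p (of H A t)) : p x :=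
  Completion.induction_on (α := AlgMod H A) x hp h

/-- A linear map on the algebraic tensor product that is bounded for the Hilbert module norm extends
to the completion. -/
def liftL {E : Type*} [NormedAddCommGroup E] [NormedSpace ℂ E] [CompleteSpace E]
    {σ : ℂ →+* ℂ} [RingHomIsometric σ] (f : H ⊗[ℂ] A →ₛₗ[σ] E) (C : ℝ)
    (hf : ∀ t, ‖f t‖ ≤ C * modNorm t) :
    HilbMod H A →SL[σ] E :=
  ContinuousLinearMap.fromCompletion (LinearMap.mkContinuous (E := AlgMod H A) f C hf)

theorem liftL_of {E : Type*} [NormedAddCommGroup E] [NormedSpace ℂ E] [CompleteSpace E]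
    {σ : ℂ →+* ℂ} [RingHomIsometric σ] (f : H ⊗[ℂ] A →ₛₗ[σ] E) (C : ℝ)
    (hf : ∀ t, ‖f t‖ ≤ C * modNorm t) (t : H ⊗[ℂ] A) :
    liftL f C hf (of H A t) = f t :=
  ContinuousLinearMap.fromCompletion_apply_coe _ _

theorem norm_liftL_le {E : Type*} [NormedAddCommGroup E] [NormedSpace ℂ E] [CompleteSpace E]
    {σ : ℂ →+* ℂ} [RingHomIsometric σ] (f : H ⊗[ℂ] A →ₛₗ[σ] E) (C : ℝ) (hC : 0 ≤ C)
    (hf : ∀ t, ‖f t‖ ≤ C * modNorm t) : ‖liftL f C hf‖ ≤ C := by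
  refine ContinuousLinearMap.opNorm_le_bound _ hC fun x => ?_
  refine induction_of (p := fun x => ‖liftL f C hf x‖ ≤ C * ‖x‖) x
    (isClosed_le (by fun_prop) (by fun_prop)) fun t => ?_
  rw [liftL_of, norm_of]
  exact hf t

theorem ext_of {E : Type*} [NormedAddCommGroup E] [NormedSpace ℂ E]
    {σ : ℂ →+* ℂ} {f g : HilbMod H A →SL[σ] E} (h : ∀ t, f (of H A t) = g (of H A t)) : f = g :=
  ContinuousLinearMap.ext fun x => induction_of (p := fun x => f x = g x) x
    (isClosed_eq f.continuous g.continuous) h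

variable (H A) in
/-- The `A`-valued inner product of `H ⊗ A`, conjugate-linear in the first variable. -/
def inner : HilbMod H A →L⋆[ℂ] HilbMod H A →L[ℂ] A :=
  liftL
    { toFun := fun x => liftL (algInner H A x) (modNorm x) (norm_algInner_le x)
      map_add' := fun x y => ext_of fun t => by
        rw [add_apply, liftL_of, liftL_of, liftL_of, map_add, LinearMap.add_apply]
      map_smul' := fun c x => ext_of fun t => by
        rw [smul_apply, liftL_of, liftL_of, map_smulₛₗ, LinearMap.smul_apply] }
    1 (fun x => by
      rw [one_mul]; exact norm_liftL_le _ _ (modNorm_nonneg x) (norm_algInner_le x))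

theorem inner_of (x y : H ⊗[ℂ] A) : inner H A (of H A x) (of H A y) = algInner H A x y := by
  rw [inner, liftL_of]
  exact liftL_of _ _ (norm_algInner_le x) y

theorem norm_sq (x : HilbMod H A) : ‖x‖ ^ 2 = ‖inner H A x x‖ :=
  induction_of (p := fun x => ‖x‖ ^ 2 = ‖inner H A x x‖) x
    (isClosed_eq (by fun_prop) (by fun_prop)) fun t => by rw [inner_of, norm_of, modNorm_sq]

theorem algInner_mulRight (x y : H ⊗[ℂ] A) (a b : A) :
    algInner H A (TensorProduct.map LinearMap.id (LinearMap.mulRight ℂ a) x)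
      (TensorProduct.map LinearMap.id (LinearMap.mulRight ℂ b) y) =
      star a * algInner H A x y * b := by
  induction x with
  | zero => simp
  | add x x' hx hx' => simp only [map_add, LinearMap.add_apply, hx, hx', mul_add, add_mul]
  | tmul h c =>
    induction y with
    | zero => simp
    | add y y' hy hy' => simp only [map_add, hy, hy', mul_add, add_mul]
    | tmul k d =>
      simp only [TensorProduct.map_tmul, LinearMap.id_apply, LinearMap.mulRight_apply,
        algInner_tmul, star_mul, smul_mul_assoc, mul_smul_comm, mul_assoc]

theorem modNorm_mulRight_le (a : A) (x : H ⊗[ℂ] A) :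
    modNorm (TensorProduct.map LinearMap.id (LinearMap.mulRight ℂ a) x) ≤ ‖a‖ * modNorm x := by
  refine le_of_sq_le_sq ?_ (mul_nonneg (norm_nonneg a) (modNorm_nonneg x))
  rw [modNorm_sq, algInner_mulRight, mul_pow, modNorm_sq]
  refine (norm_mul_le _ _).trans ((mul_le_mul_of_nonneg_right (norm_mul_le _ _)
    (norm_nonneg _)).trans_eq ?_)
  rw [norm_star]; ring

/-- The right action of `A` on `H ⊗ A`: `(h ⊗ b) · a = h ⊗ b a`. -/
def mulRight (a : A) : HilbMod H A →L[ℂ] HilbMod H A :=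
  liftL (of H A ∘ₗ TensorProduct.map LinearMap.id (LinearMap.mulRight ℂ a)) ‖a‖ fun x =>
    (norm_of _).trans_le (modNorm_mulRight_le a x)

theorem mulRight_of (a : A) (x : H ⊗[ℂ] A) : mulRight a (of H A x) =
    of H A (TensorProduct.map LinearMap.id (LinearMap.mulRight ℂ a) x) :=
  liftL_of _ _ _ _

theorem mulRight_add (a b : A) (x : HilbMod H A) :
    mulRight (a + b) x = mulRight a x + mulRight b x := by
  refine induction_of (p := fun x => mulRight (a + b) x = mulRight a x + mulRight b x) x
    (isClosed_eq (by fun_prop) (by fun_prop)) fun t => ?_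
  rw [mulRight_of, mulRight_of, mulRight_of, ← map_add]
  congr 1
  induction t with
  | zero => simp
  | add s t hs ht => simp only [map_add, hs, ht]; abel
  | tmul h c =>
    simp only [TensorProduct.map_tmul, LinearMap.id_apply, LinearMap.mulRight_apply, mul_add,
      TensorProduct.tmul_add]

theorem mulRight_smul (c : ℂ) (a : A) (x : HilbMod H A) :
    mulRight (c • a) x = c • mulRight a x := by
  refine DFunLike.congr_fun
    (ext_of (f := mulRight (c • a)) (g := c • mulRight (H := H) a) fun t => ?_) x
  rw [smul_apply, mulRight_of, mulRight_of, ← map_smul]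
  congr 1
  induction t with
  | zero => simp
  | add s t hs ht => simp only [map_add, smul_add, hs, ht]
  | tmul h b =>
    simp only [TensorProduct.map_tmul, LinearMap.id_apply, LinearMap.mulRight_apply,
      mul_smul_comm, TensorProduct.tmul_smul]

theorem inner_mulRight (x y : HilbMod H A) (a b : A) :
    inner H A (mulRight a x) (mulRight b y) = star a * inner H A x y * b := by
  refine induction_of
    (p := fun x => inner H A (mulRight a x) (mulRight b y) = star a * inner H A x y * b) x
    (isClosed_eq (by fun_prop) (by fun_prop)) fun s => ?_
  refine induction_of (p := fun y => inner H A (mulRight a (of H A s)) (mulRight b y) =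
      star a * inner H A (of H A s) y * b) y
    (isClosed_eq (by fun_prop) (by fun_prop)) fun t => ?_
  rw [mulRight_of, mulRight_of, inner_of, inner_of, algInner_mulRight]

variable {B : Type u} [CStarAlgebra B]

theorem algInner_map (g : A →⋆ₐ[ℂ] B) (x y : H ⊗[ℂ] A) :
    algInner H B (TensorProduct.map LinearMap.id g.toAlgHom.toLinearMap x)
      (TensorProduct.map LinearMap.id g.toAlgHom.toLinearMap y) = g (algInner H A x y) := by
  induction x with
  | zero => simp
  | add x x' hx hx' => simp only [map_add, LinearMap.add_apply, hx, hx']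
  | tmul h c =>
    induction y with
    | zero => simp
    | add y y' hy hy' => simp only [map_add, hy, hy']
    | tmul k d =>
      rw [algInner_tmul, map_smul, map_mul, map_star]
      rfl

theorem modNorm_map_le (g : A →⋆ₐ[ℂ] B) (x : H ⊗[ℂ] A) :
    modNorm (TensorProduct.map LinearMap.id g.toAlgHom.toLinearMap x) ≤ 1 * modNorm x := by
  rw [one_mul]
  refine le_of_sq_le_sq ?_ (modNorm_nonneg x)
  rw [modNorm_sq, algInner_map, modNorm_sq]
  exact NonUnitalStarAlgHom.norm_apply_le g _

variable (H) in
/-- The map `id ⊗ g : H ⊗ A → H ⊗ B` induced by a `*`-homomorphism `g : A → B`. -/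
def map (g : A →⋆ₐ[ℂ] B) : HilbMod H A →L[ℂ] HilbMod H B :=
  liftL (of H B ∘ₗ TensorProduct.map LinearMap.id g.toAlgHom.toLinearMap) 1 fun x =>
    (norm_of _).trans_le (modNorm_map_le g x)

theorem map_of (g : A →⋆ₐ[ℂ] B) (x : H ⊗[ℂ] A) : map H g (of H A x) =
    of H B (TensorProduct.map LinearMap.id g.toAlgHom.toLinearMap x) :=
  liftL_of _ _ _ _

theorem inner_map (g : A →⋆ₐ[ℂ] B) (x y : HilbMod H A) :
    inner H B (map H g x) (map H g y) = g (inner H A x y) := by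
  have hg : Continuous g := 
    AddMonoidHomClass.continuous_of_bound g 1 fun a => by
      rw [one_mul]; exact NonUnitalStarAlgHom.norm_apply_le g a
  refine induction_of
    (p := fun x => inner H B (map H g x) (map H g y) = g (inner H A x y)) x
    (isClosed_eq (by fun_prop) (by fun_prop)) fun s => ?_
  refine induction_of (p := fun y => inner H B (map H g (of H A s)) (map H g y) =
      g (inner H A (of H A s) y)) y
    (isClosed_eq (by fun_prop) (by fun_prop)) fun t => ?_
  rw [map_of, map_of, inner_of, inner_of, algInner_map]

end HilbMod

/-! ### `B(H) ⊗ A` acts on `H ⊗ A` -/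

section act

variable (H A) in
/-- The action of the algebraic tensor product: `(S ⊗ a)(h ⊗ b) = S h ⊗ a b`. -/
def algAct : (H →L[ℂ] H) ⊗[ℂ] A →ₗ[ℂ] H ⊗[ℂ] A →ₗ[ℂ] H ⊗[ℂ] A :=
  TensorProduct.lift ((TensorProduct.mapBilinear (.id ℂ) H A H A).compl₁₂
    (ContinuousLinearMap.coeLM ℂ) (LinearMap.mul ℂ A))

theorem algAct_tmul (S : H →L[ℂ] H) (a : A) (h : H) (b : A) :
    algAct H A (S ⊗ₜ a) (h ⊗ₜ b) = S h ⊗ₜ (a * b) := rfl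

variable [CompleteSpace H]

theorem evalOp_algAct (p : Rep A) (k : p.H) (t : (H →L[ℂ] H) ⊗[ℂ] A) (x : H ⊗[ℂ] A) :
    evalOp p.hom k (algAct H A t x) =
      tensorOp (StarAlgHom.id ℂ (H →L[ℂ] H)) p.hom t (evalOp p.hom k x) := by
  induction t with
  | zero => simp
  | add s t hs ht => simp only [map_add, LinearMap.add_apply, add_apply, hs, ht]
  | tmul S a =>
    induction x with
    | zero => simp
    | add x y hx hy => simp only [map_add, hx, hy]
    | tmul h b =>
      rw [algAct_tmul, evalOp_tmul, evalOp_tmul, tensorOp_tmul, HilbTensor.op_of_tmul, map_mul]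
      rfl

theorem modNorm_algAct_le (t : (H →L[ℂ] H) ⊗[ℂ] A) (x : H ⊗[ℂ] A) :
    modNorm (algAct H A t x) ≤ minNorm t * modNorm x := by
  refine modNorm_le_of _ _ (mul_nonneg (minNorm_nonneg t) (modNorm_nonneg x)) fun p k => ?_
  rw [evalOp_algAct, mul_assoc]
  refine (ContinuousLinearMap.le_opNorm _ _).trans (mul_le_mul
    (le_minNorm ⟨H, StarAlgHom.id ℂ (H →L[ℂ] H)⟩ p t) (norm_evalOp_le p.hom k x)
    (norm_nonneg _) (minNorm_nonneg t))

/-- The operator on `H ⊗ A` given by an element of the algebraic tensor product. -/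
def actOf (t : (H →L[ℂ] H) ⊗[ℂ] A) : HilbMod H A →L[ℂ] HilbMod H A :=
  HilbMod.liftL (HilbMod.of H A ∘ₗ algAct H A t) (minNorm t) fun x =>
    (HilbMod.norm_of _).trans_le (modNorm_algAct_le t x)

theorem actOf_of (t : (H →L[ℂ] H) ⊗[ℂ] A) (x : H ⊗[ℂ] A) :
    actOf t (HilbMod.of H A x) = HilbMod.of H A (algAct H A t x) :=
  HilbMod.liftL_of _ _ _ _

variable (H A) in
/-- The canonical map `B(H) ⊗ A → L(H ⊗ A)`, with `(S ⊗ a)(h ⊗ b) = S h ⊗ a b`. -/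
def act : MinTensor (H →L[ℂ] H) A →L[ℂ] (HilbMod H A →L[ℂ] HilbMod H A) :=
  MinTensor.liftL
    { toFun := actOf
      map_add' := fun s t => HilbMod.ext_of fun x => by
        rw [add_apply, actOf_of, actOf_of, actOf_of, map_add, LinearMap.add_apply, map_add]
      map_smul' := fun c t => HilbMod.ext_of fun x => by
        rw [smul_apply, actOf_of, actOf_of, map_smul, LinearMap.smul_apply, map_smul]
        rfl }
    1 fun t => by
      rw [one_mul]
      exact HilbMod.norm_liftL_le _ _ (minNorm_nonneg t) _

theorem act_tmul (S : H →L[ℂ] H) (a : A) (h : H) (b : A) :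
    act H A (MinTensor.tmul S a) (HilbMod.tmul h b) = HilbMod.tmul (S h) (a * b) := by
  have h1 : act H A (MinTensor.tmul S a) = actOf (S ⊗ₜ a) := MinTensor.liftL_of _ _ _ _
  rw [h1]
  exact actOf_of _ _

end act

end HilbertModule

/-! ### Compact quantum groups and their actions -/

section Assoc

variable (A B C : Type u) [CStarAlgebra A] [CStarAlgebra B] [CStarAlgebra C]

/-- The map of the algebraic triple tensor product into `(A ⊗ B) ⊗ C`. -/
def leftTriple : (A ⊗[ℂ] B) ⊗[ℂ] C →ₗ[ℂ] MinTensor (MinTensor A B) C :=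
  (MinTensor.of (MinTensor A B) C).toAlgHom.toLinearMap ∘ₗ
    TensorProduct.map (MinTensor.of A B).toAlgHom.toLinearMap LinearMap.id

/-- The map of the algebraic triple tensor product into `A ⊗ (B ⊗ C)`. -/
def rightTriple : A ⊗[ℂ] (B ⊗[ℂ] C) →ₗ[ℂ] MinTensor A (MinTensor B C) :=
  (MinTensor.of A (MinTensor B C)).toAlgHom.toLinearMap ∘ₗ
    TensorProduct.map LinearMap.id (MinTensor.of B C).toAlgHom.toLinearMap

variable {A B C}

/-- `z ∈ (A ⊗ B) ⊗ C` and `w ∈ A ⊗ (B ⊗ C)` correspond to each other under the canonical isomorphism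
`(A ⊗ B) ⊗ C ≅ A ⊗ (B ⊗ C)`, that is, `(z, w)` belongs to the graph of this isomorphism. The
isomorphism is the continuous extension of `(a ⊗ b) ⊗ c ↦ a ⊗ (b ⊗ c)`, so its graph is the closure
of the graph of this algebraic map. -/
def SameTriple (z : MinTensor (MinTensor A B) C) (w : MinTensor A (MinTensor B C)) : Prop :=
  (z, w) ∈ closure (Set.range fun t : (A ⊗[ℂ] B) ⊗[ℂ] C =>
    (leftTriple A B C t, rightTriple A B C (TensorProduct.assoc ℂ A B C t)))

end Assoc

/-- A compact quantum group: a unital C*-algebra `Q` with a coassociative coproduct such that the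
linear spans of `Δ(Q)(Q ⊗ 1)` and `Δ(Q)(1 ⊗ Q)` are dense in `Q ⊗ Q`. -/
structure CompactQuantumGroup (Q : Type u) [CStarAlgebra Q] where
  Δ : Q →⋆ₐ[ℂ] MinTensor Q Q
  coassoc : ∀ a, SameTriple (MinTensor.map Δ (StarAlgHom.id ℂ Q) (Δ a))
    (MinTensor.map (StarAlgHom.id ℂ Q) Δ (Δ a))
  dense_left : Dense (Submodule.span ℂ
    {x : MinTensor Q Q | ∃ a b : Q, x = Δ a * MinTensor.tmul b 1} : Set (MinTensor Q Q))
  dense_right : Dense (Submodule.span ℂ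
    {x : MinTensor Q Q | ∃ a b : Q, x = Δ a * MinTensor.tmul 1 b} : Set (MinTensor Q Q))

variable {Q : Type u} [CStarAlgebra Q]

/-- An action of a compact quantum group on a unital C*-algebra `C`: a unital `*`-homomorphism
`α : C → C ⊗ Q` with `(α ⊗ id) α = (id ⊗ Δ) α` such that the linear span of `α(C)(1 ⊗ Q)` is dense
in `C ⊗ Q`. -/
structure Action (G : CompactQuantumGroup Q) (C : Type u) [CStarAlgebra C] where
  α : C →⋆ₐ[ℂ] MinTensor C Q
  coassoc : ∀ x, SameTriple (MinTensor.map α (StarAlgHom.id ℂ Q) (α x))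
    (MinTensor.map (StarAlgHom.id ℂ C) G.Δ (α x))
  dense : Dense (Submodule.span ℂ
    {x : MinTensor C Q | ∃ (c : C) (q : Q), x = α c * MinTensor.tmul 1 q} : Set (MinTensor C Q))

/-! ### Unitary representations -/

section UnitaryRep

variable {H : Type u} [NormedAddCommGroup H] [InnerProductSpace ℂ H]

/-- A unitary in the algebra `L(H ⊗ Q)` of adjointable operators on the Hilbert `Q`-module `H ⊗ Q`,
together with its adjoint. -/
structure ModUnitary (H Q : Type u) [NormedAddCommGroup H] [InnerProductSpace ℂ H]
    [CStarAlgebra Q] where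
  U : HilbMod H Q →L[ℂ] HilbMod H Q
  adj : HilbMod H Q →L[ℂ] HilbMod H Q
  inner_adj : ∀ x y, HilbMod.inner H Q (U x) y = HilbMod.inner H Q x (adj y)
  adj_comp : adj ∘L U = ContinuousLinearMap.id ℂ _
  comp_adj : U ∘L adj = ContinuousLinearMap.id ℂ _

/-- The linear map `V : H → H ⊗ Q`, `V ξ = U (ξ ⊗ 1)`. -/
def ModUnitary.V (u : ModUnitary H Q) : H →ₗ[ℂ] HilbMod H Q :=
  u.U.toLinearMap ∘ₗ HilbMod.of H Q ∘ₗ (TensorProduct.mk ℂ H Q).flip 1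

theorem ModUnitary.inner_V (u : ModUnitary H Q) (ξ η : H) :
    HilbMod.inner H Q (u.V ξ) (u.V η) = ⟪ξ, η⟫_ℂ • (1 : Q) := by
  have h : u.adj (u.V η) = HilbMod.of H Q (η ⊗ₜ 1) :=
    DFunLike.congr_fun u.adj_comp (HilbMod.of H Q (η ⊗ₜ 1))
  have h2 : HilbMod.inner H Q (u.V ξ) (u.V η) =
      HilbMod.inner H Q (HilbMod.of H Q (ξ ⊗ₜ 1)) (u.adj (u.V η)) := u.inner_adj _ _
  rw [h2, h, HilbMod.inner_of, algInner_tmul, star_one, one_mul]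

variable (Q) in
/-- The embedding `a ↦ a ⊗ 1` of the first leg. -/
def leg₁ : Q →⋆ₐ[ℂ] MinTensor Q Q where
  __ := (MinTensor.of Q Q).toAlgHom.comp Algebra.TensorProduct.includeLeft
  map_star' a := by
    have h : star (a ⊗ₜ[ℂ] (1 : Q)) = star a ⊗ₜ 1 := by simp
    exact (congrArg (MinTensor.of Q Q) h).symm.trans (map_star (MinTensor.of Q Q) _)

variable (Q) in
/-- The embedding `a ↦ 1 ⊗ a` of the second leg. -/
def leg₂ : Q →⋆ₐ[ℂ] MinTensor Q Q where
  __ := (MinTensor.of Q Q).toAlgHom.comp Algebra.TensorProduct.includeRight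
  map_star' a := by
    have h : star ((1 : Q) ⊗ₜ[ℂ] a) = 1 ⊗ₜ star a := by simp
    exact (congrArg (MinTensor.of Q Q) h).symm.trans (map_star (MinTensor.of Q Q) _)

/-- For `e ∈ H ⊗ Q` and `q ∈ Q` the element `e ⊗ q ∈ H ⊗ Q ⊗ Q`; so `(h ⊗ a) ⊗ q = h ⊗ (a ⊗ q)`. -/
def appendLeg (e : HilbMod H Q) (q : Q) : HilbMod H (MinTensor Q Q) :=
  HilbMod.mulRight (leg₂ Q q) (HilbMod.map H (leg₁ Q) e)

theorem appendLeg_tmul (h : H) (a q : Q) :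
    appendLeg (HilbMod.tmul h a) q = HilbMod.tmul h (MinTensor.tmul a q) := by
  have h1 : HilbMod.map H (leg₁ Q) (HilbMod.tmul h a) = HilbMod.of H _ (h ⊗ₜ leg₁ Q a) :=
    HilbMod.map_of _ _
  rw [appendLeg, h1, HilbMod.mulRight_of, TensorProduct.map_tmul, LinearMap.mulRight_apply]
  have h2 : leg₁ Q a * leg₂ Q q = MinTensor.tmul a q := by
    change MinTensor.of Q Q (a ⊗ₜ 1) * MinTensor.of Q Q (1 ⊗ₜ q) = MinTensor.of Q Q (a ⊗ₜ q)
    rw [← map_mul, Algebra.TensorProduct.tmul_mul_tmul, one_mul, mul_one]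
  rw [h2]
  rfl

/-- The algebraic map `h ⊗ q ↦ V h ⊗ q`. -/
def algTensorId (V : H →ₗ[ℂ] HilbMod H Q) : H ⊗[ℂ] Q →ₗ[ℂ] HilbMod H (MinTensor Q Q) :=
  TensorProduct.lift (LinearMap.mk₂ ℂ (fun h q => appendLeg (V h) q)
    (fun h h' q => by simp only [appendLeg, map_add])
    (fun c h q => by simp only [appendLeg, map_smul])
    (fun h q q' => by simp only [appendLeg, map_add, HilbMod.mulRight_add])
    (fun c h q => by simp only [appendLeg, map_smul, HilbMod.mulRight_smul]))

theorem inner_algTensorId (V : H →ₗ[ℂ] HilbMod H Q)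
    (hV : ∀ ξ η, HilbMod.inner H Q (V ξ) (V η) = ⟪ξ, η⟫_ℂ • (1 : Q)) (x y : H ⊗[ℂ] Q) :
    HilbMod.inner H (MinTensor Q Q) (algTensorId V x) (algTensorId V y) =
      leg₂ Q (algInner H Q x y) := by
  induction x with
  | zero => simp
  | add x x' hx hx' => simp only [map_add, add_apply, LinearMap.add_apply, hx, hx']
  | tmul h a =>
    induction y with
    | zero => simp
    | add y y' hy hy' => simp only [map_add, hy, hy']
    | tmul k b =>
      have h1 : ∀ (h : H) (a : Q), algTensorId V (h ⊗ₜ a) = appendLeg (V h) a := fun _ _ => rfl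
      rw [h1, h1, appendLeg, appendLeg, HilbMod.inner_mulRight, HilbMod.inner_map, hV,
        algInner_tmul]
      simp only [map_smul, map_mul, map_star, map_one, mul_smul_comm, smul_mul_assoc, mul_one]

/-- The map `V ⊗ id : H ⊗ Q → H ⊗ Q ⊗ Q`, `h ⊗ q ↦ V h ⊗ q`, for an isometry `V : H → H ⊗ Q`. -/
def tensorId (V : H →ₗ[ℂ] HilbMod H Q)
    (hV : ∀ ξ η, HilbMod.inner H Q (V ξ) (V η) = ⟪ξ, η⟫_ℂ • (1 : Q)) :
    HilbMod H Q →L[ℂ] HilbMod H (MinTensor Q Q) :=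
  HilbMod.liftL (algTensorId V) 1 fun x => by
    rw [one_mul]
    refine le_of_sq_le_sq ?_ (modNorm_nonneg x)
    rw [HilbMod.norm_sq, inner_algTensorId V hV, modNorm_sq]
    exact NonUnitalStarAlgHom.norm_apply_le (leg₂ Q) _

variable (H) in
/-- A unitary representation of a compact quantum group on a Hilbert space `H`: a unitary
`U ∈ L(H ⊗ Q)` such that `V ξ = U (ξ ⊗ 1)` satisfies `(V ⊗ id) V = (id ⊗ Δ) V`. -/
structure UnitaryRep (G : CompactQuantumGroup Q) extends ModUnitary H Q where
  rep : ∀ ξ, tensorId toModUnitary.V toModUnitary.inner_V (toModUnitary.V ξ) =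
    HilbMod.map H G.Δ (toModUnitary.V ξ)

end UnitaryRep

/-! ### The conditions on an action -/

section Conditions

variable {G : CompactQuantumGroup Q} {C : Type u} [CStarAlgebra C]

/-- A positive functional `φ` is invariant under the action: `(φ ⊗ id) (α x) = φ x 1`. -/
def Action.IsInvariant [PartialOrder C] [StarOrderedRing C] (act : Action G C) (φ : C →ₚ[ℂ] ℂ) :
    Prop :=
  ∀ x, sliceLeft φ (act.α x) = φ x • (1 : Q)

/-- A positive functional is faithful if `φ (x* x) = 0` only for `x = 0`. -/
def IsFaithful [PartialOrder C] (φ : C →ₚ[ℂ] ℂ) : Prop :=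
  ∀ x, φ (star x * x) = 0 → x = 0

/-- The action is implemented by a unitary representation: there are a unitary representation `U` on
a Hilbert space `H` and a faithful representation `π : C → B(H)` with
`U (π x ⊗ 1) U* = (π ⊗ id) (α x)` in `L(H ⊗ Q)`. -/
def Action.IsImplemented (a : Action G C) : Prop :=
  ∃ (H : Type u) (_ : NormedAddCommGroup H) (_ : InnerProductSpace ℂ H) (_ : CompleteSpace H)
    (u : UnitaryRep H G) (π : C →⋆ₐ[ℂ] (H →L[ℂ] H)), Function.Injective π ∧
    ∀ x, u.U ∘L act H Q (MinTensor.tmul (π x) 1) ∘L u.adj =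
      act H Q (MinTensor.map π (StarAlgHom.id ℂ Q) (a.α x))

variable [PartialOrder Q] [StarOrderedRing Q]

/-- `h` is the Haar state: a state with `(id ⊗ h) (Δ a) = h a 1 = (h ⊗ id) (Δ a)`. -/
structure CompactQuantumGroup.IsHaarState (G : CompactQuantumGroup Q) (h : Q →ₚ[ℂ] ℂ) : Prop where
  map_one : h 1 = 1
  right : ∀ a, sliceRight h (G.Δ a) = h a • (1 : Q)
  left : ∀ a, sliceLeft h (G.Δ a) = h a • (1 : Q)

/-- The C*-algebra `π_h(Q)` of operators on the GNS space of `h`. (The image of a `*`-homomorphism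
of C*-algebras is closed, so taking the closure does not enlarge it.) -/
def reducedAlgebra (h : Q →ₚ[ℂ] ℂ) : StarSubalgebra ℂ (h.GNS →L[ℂ] h.GNS) :=
  h.gnsStarAlgHom.range.topologicalClosure

instance (h : Q →ₚ[ℂ] ℂ) : IsClosed (reducedAlgebra h : Set (h.GNS →L[ℂ] h.GNS)) :=
  StarSubalgebra.isClosed_topologicalClosure _

/-- The GNS representation, as a `*`-homomorphism of `Q` onto its image. -/
def reducedHom (h : Q →ₚ[ℂ] ℂ) : Q →⋆ₐ[ℂ] reducedAlgebra h :=
  h.gnsStarAlgHom.codRestrict _ fun a =>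
    StarSubalgebra.le_topologicalClosure _ ⟨a, rfl⟩

/-- The map `(id ⊗ π_h) α : C → C ⊗ π_h(Q)`; it is the reduced action if `h` is the Haar state. -/
def Action.reduced (a : Action G C) (h : Q →ₚ[ℂ] ℂ) : C →⋆ₐ[ℂ] MinTensor C (reducedAlgebra h) :=
  (MinTensor.map (StarAlgHom.id ℂ C) (reducedHom h)).comp a.α

/-- The reduced action, formed with the Haar state `h` (which is unique), is injective. -/
def Action.ReducedInjective (a : Action G C) : Prop :=
  ∃ h : Q →ₚ[ℂ] ℂ, G.IsHaarState h ∧ Function.Injective (a.reduced h)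

end Conditions

end CQG

end

noncomputable section

namespace CQG

/-! The proof is the cycle (a) ⇒ (b) ⇒ (c) ⇒ (a).

(a) ⇒ (b): on the GNS space of the invariant functional `φ`, with cyclic vector Ω, put V(cΩ) =
α(c)(Ω ⊗ 1). Invariance says exactly that V preserves the `Q`-valued inner product, so V extends to
an isometry U of the Hilbert module. Density of α(C)(1 ⊗ Q) makes U onto, coassociativity of the
action gives the representation identity, multiplicativity of α gives covariance, and faithfulness
of `φ` gives injectivity of π (`Action.IsInvariant.isImplemented`).

(b) ⇒ (c): if the reduced action kills x, apply id ⊗ π_r to U(π(x)ξ ⊗ 1) = (π ⊗ id)(α x) U(ξ ⊗ 1).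
The right side vanishes, while the left side has inner square ‖π(x)ξ‖² 1, so π(x) = 0
(`map_eq_zero_of_covariant`).

(c) ⇒ (a): separability gives a faithful ψ on `C`, and (ψ ⊗ h)α is invariant. If it vanishes at x*x,
then by Cauchy–Schwarz every slice (ψ ⊗ id)((s ⊗ 1)α(x)) lies in the left kernel of `h`. That kernel
is the kernel of π_r, so the reduced action kills x by faithfulness of ψ, and injectivity concludes
(`Action.isFaithful_average`).

Two facts on the Haar state are proved on the way. Existence (`exists_isHaarState`): Cesàro means of
convolution powers show that every state is absorbed by some state; absorption of a sum of positive
functionals passes to each summand (`Absorbs.of_add`); compactness then gives one state absorbing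
everything. Ideal property (`apply_mul_mul_eq_zero`): if h(a*a) = 0 then h(qac) = 0 for all q, c,
obtained from the isometry b ⊗ c ↦ Δ(b)(1 ⊗ c) on the GNS space of h ⊗ h.

Slice maps are available only for positive functionals, so identities in tensor products are tested
by slicing with these, and coassociativity is used only after the two outer legs have been sliced
(`SameTriple.slice`). -/

/-- A `*`-homomorphism of C*-algebras, as a continuous linear map. -/
def homL {A B : Type*} [CStarAlgebra A] [CStarAlgebra B] (f : A →⋆ₐ[ℂ] B) : A →L[ℂ] B :=
  f.toAlgHom.toLinearMap.mkContinuous 1 fun a => by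
    rw [one_mul]; exact NonUnitalStarAlgHom.norm_apply_le f a

@[simp]
theorem homL_apply {A B : Type*} [CStarAlgebra A] [CStarAlgebra B] (f : A →⋆ₐ[ℂ] B) (a : A) :
    homL f a = f a := rfl

theorem continuous_starAlgHom {A B : Type*} [CStarAlgebra A] [CStarAlgebra B]
    (f : A →⋆ₐ[ℂ] B) : Continuous f := (homL f).continuous

/-- A positive functional, as a continuous linear map. -/
def funL {A : Type*} [CStarAlgebra A] [PartialOrder A] [StarOrderedRing A] (φ : A →ₚ[ℂ] ℂ) :
    A →L[ℂ] ℂ := ⟨φ.toLinearMap, map_continuous φ⟩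

@[simp]
theorem funL_apply {A : Type*} [CStarAlgebra A] [PartialOrder A] [StarOrderedRing A]
    (φ : A →ₚ[ℂ] ℂ) (a : A) : funL φ a = φ a := rfl

/-! ### Representations of the spatial tensor product and separation by functionals -/

section Separation

variable {A B H K : Type u} [CStarAlgebra A] [CStarAlgebra B]
  [NormedAddCommGroup H] [InnerProductSpace ℂ H] [CompleteSpace H]
  [NormedAddCommGroup K] [InnerProductSpace ℂ K] [CompleteSpace K]

/-- The underlying continuous linear map of `π ⊗ ρ`. -/
def MinTensor.repL (π : A →⋆ₐ[ℂ] (H →L[ℂ] H)) (ρ : B →⋆ₐ[ℂ] (K →L[ℂ] K)) :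
    MinTensor A B →L[ℂ] (HilbTensor H K →L[ℂ] HilbTensor H K) :=
  MinTensor.liftL (tensorOp π ρ).toAlgHom.toLinearMap 1 fun t => by
    rw [one_mul]; exact le_minNorm ⟨H, π⟩ ⟨K, ρ⟩ t

theorem MinTensor.repL_of (π : A →⋆ₐ[ℂ] (H →L[ℂ] H)) (ρ : B →⋆ₐ[ℂ] (K →L[ℂ] K))
    (t : A ⊗[ℂ] B) : MinTensor.repL π ρ (MinTensor.of A B t) = tensorOp π ρ t :=
  MinTensor.liftL_of _ _ _ t

/-- The representation `π ⊗ ρ` of the spatial tensor product. -/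
def MinTensor.rep (π : A →⋆ₐ[ℂ] (H →L[ℂ] H)) (ρ : B →⋆ₐ[ℂ] (K →L[ℂ] K)) :
    MinTensor A B →⋆ₐ[ℂ] (HilbTensor H K →L[ℂ] HilbTensor H K) where
  toFun := MinTensor.repL π ρ
  map_one' := by
    rw [← map_one (MinTensor.of A B), MinTensor.repL_of, map_one]
  map_mul' x y := by
    refine MinTensor.induction_of₂
      (p := fun x y => MinTensor.repL π ρ (x * y) = MinTensor.repL π ρ x * MinTensor.repL π ρ y)
      x y (isClosed_eq (by fun_prop) (by fun_prop)) fun s t => ?_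
    rw [← map_mul, MinTensor.repL_of, MinTensor.repL_of, MinTensor.repL_of, map_mul]
  map_zero' := map_zero _
  map_add' := map_add _
  commutes' c := by
    rw [Algebra.algebraMap_eq_smul_one, map_smul, Algebra.algebraMap_eq_smul_one,
      ← map_one (MinTensor.of A B), MinTensor.repL_of, map_one]
  map_star' x := by
    refine MinTensor.induction_of
      (p := fun x => MinTensor.repL π ρ (star x) = star (MinTensor.repL π ρ x)) x
      (isClosed_eq (by fun_prop) (by fun_prop)) fun t => ?_
    rw [← map_star, MinTensor.repL_of, MinTensor.repL_of, map_star]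

theorem MinTensor.rep_of (π : A →⋆ₐ[ℂ] (H →L[ℂ] H)) (ρ : B →⋆ₐ[ℂ] (K →L[ℂ] K))
    (t : A ⊗[ℂ] B) : MinTensor.rep π ρ (MinTensor.of A B t) = tensorOp π ρ t :=
  MinTensor.repL_of π ρ t

theorem MinTensor.continuous_rep (π : A →⋆ₐ[ℂ] (H →L[ℂ] H)) (ρ : B →⋆ₐ[ℂ] (K →L[ℂ] K)) :
    Continuous (MinTensor.rep π ρ) := (MinTensor.repL π ρ).continuous

theorem MinTensor.rep_tmul (π : A →⋆ₐ[ℂ] (H →L[ℂ] H)) (ρ : B →⋆ₐ[ℂ] (K →L[ℂ] K))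
    (a : A) (b : B) (x : H) (y : K) :
    MinTensor.rep π ρ (MinTensor.tmul a b) (HilbTensor.of (x ⊗ₜ y)) =
      HilbTensor.of (π a x ⊗ₜ ρ b y) := by
  rw [MinTensor.tmul, MinTensor.rep_of, tensorOp_tmul, HilbTensor.op_of_tmul]

/-- The representations `π ⊗ ρ` separate the points of the spatial tensor product. -/
theorem MinTensor.eq_zero_of_rep (X : MinTensor A B)
    (h : ∀ (p : Rep A) (q : Rep B), MinTensor.rep p.hom q.hom X = 0) : X = 0 := by
  rw [← norm_le_zero_iff]
  refine le_of_forall_pos_le_add fun ε hε => ?_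
  obtain ⟨t, ht⟩ := MinTensor.denseRange_of.exists_dist_lt X (half_pos hε)
  rw [dist_eq_norm] at ht
  have h1 : ‖MinTensor.of A B t‖ ≤ ε / 2 := by
    rw [MinTensor.norm_of]
    refine minNorm_le (half_pos hε).le fun p q => ?_
    have h2 : tensorOp p.hom q.hom t = - MinTensor.rep p.hom q.hom (X - MinTensor.of A B t) := by
      rw [map_sub, h p q, MinTensor.rep_of, zero_sub, neg_neg]
    rw [h2, norm_neg]
    exact (NonUnitalStarAlgHom.norm_apply_le (MinTensor.rep p.hom q.hom) _).trans ht.le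
  have h3 := norm_add_le (X - MinTensor.of A B t) (MinTensor.of A B t)
  rw [sub_add_cancel] at h3
  linarith

section VectorFunctional

variable [PartialOrder A] [StarOrderedRing A]

/-- The positive functional `a ↦ ⟪ξ, π a ξ⟫`. -/
def vectorFunctional (π : A →⋆ₐ[ℂ] (H →L[ℂ] H)) (ξ : H) : A →ₚ[ℂ] ℂ :=
  PositiveLinearMap.mk₀
    { toFun := fun a => ⟪ξ, π a ξ⟫_ℂ
      map_add' := fun a b => by rw [map_add, add_apply, inner_add_right]
      map_smul' := fun c a => by rw [map_smul, smul_apply, inner_smul_right]; rfl }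
    fun a ha => by
      obtain ⟨b, rfl⟩ := CStarAlgebra.nonneg_iff_eq_star_mul_self.1 ha
      change 0 ≤ ⟪ξ, π (star b * b) ξ⟫_ℂ
      rw [map_mul, map_star, mul_apply_eq_comp, ContinuousLinearMap.star_eq_adjoint,
        ContinuousLinearMap.adjoint_inner_right]
      rw [inner_self_eq_norm_sq_to_K, ← RCLike.ofReal_pow]
      exact RCLike.ofReal_nonneg.2 (sq_nonneg ‖π b ξ‖)

theorem vectorFunctional_apply (π : A →⋆ₐ[ℂ] (H →L[ℂ] H)) (ξ : H) (a : A) :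
    vectorFunctional π ξ a = ⟪ξ, π a ξ⟫_ℂ := rfl

/-- Positive functionals separate the points of a C*-algebra. -/
theorem eq_of_positive {a b : A} (h : ∀ φ : A →ₚ[ℂ] ℂ, φ a = φ b) : a = b := by
  rw [← sub_eq_zero]
  obtain ⟨p, hp⟩ := exists_rep_norm (a - b)
  have h1 : p.hom (a - b) = 0 := by
    have h2 : ((p.hom (a - b) : p.H →L[ℂ] p.H) : p.H →ₗ[ℂ] p.H) = 0 := by
      refine (inner_map_self_eq_zero ((p.hom (a - b) : p.H →L[ℂ] p.H) : p.H →ₗ[ℂ] p.H)).1 fun x => ?_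
      rw [← inner_conj_symm]
      have h3 : vectorFunctional p.hom x (a - b) = 0 := by rw [map_sub, h, sub_self]
      exact (congrArg _ h3).trans (map_zero _)
    ext x
    exact DFunLike.congr_fun h2 x
  rw [h1, norm_zero] at hp
  exact norm_le_zero_iff.1 hp

/-- Matrix coefficients with equal first-leg vectors see only a positive slice. This links slices to
the representations that define the spatial norm. -/
theorem inner_rep_tmul (π : A →⋆ₐ[ℂ] (H →L[ℂ] H)) (ρ : B →⋆ₐ[ℂ] (K →L[ℂ] K)) (x : H) (y y' : K)
    (X : MinTensor A B) :
    ⟪HilbTensor.of (x ⊗ₜ y), MinTensor.rep π ρ X (HilbTensor.of (x ⊗ₜ y'))⟫_ℂ =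
      ⟪y, ρ (sliceLeft (vectorFunctional π x) X) y'⟫_ℂ := by
  have h1 := MinTensor.continuous_rep π ρ
  have h2 := continuous_starAlgHom ρ
  refine MinTensor.induction_of (p := fun X =>
    ⟪HilbTensor.of (x ⊗ₜ y), MinTensor.rep π ρ X (HilbTensor.of (x ⊗ₜ y'))⟫_ℂ =
      ⟪y, ρ (sliceLeft (vectorFunctional π x) X) y'⟫_ℂ) X
    (isClosed_eq (by fun_prop) (by fun_prop)) fun t => ?_
  induction t with
  | zero => simp
  | add s t hs ht => simp only [map_add, add_apply, inner_add_right, hs, ht]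
  | tmul a b =>
    change ⟪_, MinTensor.rep π ρ (MinTensor.tmul a b) _⟫_ℂ =
      ⟪y, ρ (sliceLeft _ (MinTensor.tmul a b)) y'⟫_ℂ
    rw [MinTensor.rep_tmul, sliceLeft_tmul, HilbTensor.inner_of, TensorProduct.inner_tmul,
      map_smul, smul_apply, inner_smul_right, vectorFunctional_apply]

/-- Slices by positive functionals on the left leg separate points. -/
theorem eq_of_sliceLeft {X Y : MinTensor A B}
    (h : ∀ φ : A →ₚ[ℂ] ℂ, sliceLeft φ X = sliceLeft φ Y) : X = Y := by
  rw [← sub_eq_zero]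
  refine MinTensor.eq_zero_of_rep _ fun p q => HilbTensor.ext_of fun x y => ?_
  set T := MinTensor.rep p.hom q.hom (X - Y) with hT
  have h0 : ∀ (x : p.H) (y y' : q.H),
      ⟪HilbTensor.of (x ⊗ₜ y), T (HilbTensor.of (x ⊗ₜ y'))⟫_ℂ = 0 := fun x y y' => by
    rw [hT, inner_rep_tmul, map_sub, h, sub_self, map_zero, zero_apply, inner_zero_right]
  -- Polarization in the first leg. Since the diagonal values vanish, the vectors x + x' and x + i
  -- x' already suffice.
  have h1 : ∀ (x x' : p.H) (y y' : q.H),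
      ⟪HilbTensor.of (x ⊗ₜ y), T (HilbTensor.of (x' ⊗ₜ y'))⟫_ℂ = 0 := fun x x' y y' => by
    have e1 := h0 (x + x') y y'
    have e2 := h0 (x + Complex.I • x') y y'
    simp only [TensorProduct.add_tmul, ← TensorProduct.smul_tmul', map_add, map_smul,
      inner_add_left, inner_add_right, inner_smul_left, inner_smul_right, h0, add_zero, zero_add,
      mul_zero, Complex.conj_I] at e1 e2
    have e3 : (2 * Complex.I) * ⟪HilbTensor.of (x ⊗ₜ y), T (HilbTensor.of (x' ⊗ₜ y'))⟫_ℂ = 0 := by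
      linear_combination e2 + Complex.I * e1
    exact (mul_eq_zero.1 e3).resolve_left (by simp)
  refine ext_inner_left ℂ fun v => ?_
  rw [zero_apply, inner_zero_right]
  refine HilbTensor.induction_of (p := fun v => ⟪v, T (HilbTensor.of (x ⊗ₜ y))⟫_ℂ = 0) v
    (isClosed_eq (by fun_prop) (by fun_prop)) fun t => ?_
  induction t with
  | zero => simp
  | add s t hs ht => rw [map_add, inner_add_left, hs, ht, add_zero]
  | tmul a b => exact h1 a x b y

end VectorFunctional

end Separation

/-! ### Calculus of slice maps -/

section SliceCalculus

theorem MinTensor.tmul_mul_tmul {A B : Type u} [CStarAlgebra A] [CStarAlgebra B] (a a' : A)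
    (b b' : B) :
    MinTensor.tmul a b * MinTensor.tmul a' b' = MinTensor.tmul (a * a') (b * b') := by
  rw [MinTensor.tmul, MinTensor.tmul, ← map_mul, Algebra.TensorProduct.tmul_mul_tmul]; rfl

theorem MinTensor.star_tmul {A B : Type u} [CStarAlgebra A] [CStarAlgebra B] (a : A) (b : B) :
    star (MinTensor.tmul a b) = MinTensor.tmul (star a) (star b) := by
  rw [MinTensor.tmul, ← map_star, TensorProduct.star_tmul]; rfl

theorem MinTensor.one_def {A B : Type u} [CStarAlgebra A] [CStarAlgebra B] :
    (1 : MinTensor A B) = MinTensor.tmul 1 1 := by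
  rw [← map_one (MinTensor.of A B), Algebra.TensorProduct.one_def]; rfl

/-- Continuous linear maps on the spatial tensor product that agree on elementary tensors agree. -/
theorem MinTensor.ext_tmul {A B : Type u} [CStarAlgebra A] [CStarAlgebra B] {E : Type*}
    [NormedAddCommGroup E] [NormedSpace ℂ E]
    {f g : MinTensor A B →L[ℂ] E} (h : ∀ a b, f (MinTensor.tmul a b) = g (MinTensor.tmul a b)) :
    f = g := by
  ext X
  refine MinTensor.induction_of (p := fun X => f X = g X) X
    (isClosed_eq f.continuous g.continuous) fun t => ?_
  induction t with
  | zero => simp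
  | add s t hs ht => simp only [map_add, hs, ht]
  | tmul a b => exact h a b

theorem leg₂_apply {Q : Type u} [CStarAlgebra Q] (a : Q) : leg₂ Q a = MinTensor.tmul 1 a := rfl

variable {A B C A' B' : Type u} [CStarAlgebra A] [CStarAlgebra B] [CStarAlgebra C]
  [CStarAlgebra A'] [CStarAlgebra B']

section Left

variable [PartialOrder A] [StarOrderedRing A] (φ : A →ₚ[ℂ] ℂ)

theorem sliceLeft_map (g : B →⋆ₐ[ℂ] B') (X : MinTensor A B) :
    sliceLeft φ (MinTensor.map (StarAlgHom.id ℂ A) g X) = g (sliceLeft φ X) := by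
  refine DFunLike.congr_fun (MinTensor.ext_tmul (f := sliceLeft φ ∘L
    homL (MinTensor.map (StarAlgHom.id ℂ A) g)) (g := homL g ∘L sliceLeft φ) fun a b => ?_) X
  simp [MinTensor.map_tmul, sliceLeft_tmul]

theorem sliceLeft_mul_left (b : B) (X : MinTensor A B) :
    sliceLeft φ (MinTensor.tmul 1 b * X) = b * sliceLeft φ X := by
  refine DFunLike.congr_fun (MinTensor.ext_tmul (f := sliceLeft φ ∘L
    ContinuousLinearMap.mul ℂ _ (MinTensor.tmul 1 b))
    (g := ContinuousLinearMap.mul ℂ _ b ∘L sliceLeft φ) fun a c => ?_) X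
  simp [MinTensor.tmul_mul_tmul, sliceLeft_tmul]

theorem sliceLeft_mul_right (b : B) (X : MinTensor A B) :
    sliceLeft φ (X * MinTensor.tmul 1 b) = sliceLeft φ X * b := by
  refine DFunLike.congr_fun (MinTensor.ext_tmul (f := sliceLeft φ ∘L
    (ContinuousLinearMap.mul ℂ _).flip (MinTensor.tmul 1 b))
    (g := (ContinuousLinearMap.mul ℂ _).flip b ∘L sliceLeft φ) fun a c => ?_) X
  simp [MinTensor.tmul_mul_tmul, sliceLeft_tmul]

theorem sliceLeft_add (ψ : A →ₚ[ℂ] ℂ) (X : MinTensor A B) :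
    sliceLeft (φ + ψ) X = sliceLeft φ X + sliceLeft ψ X := by
  refine DFunLike.congr_fun (MinTensor.ext_tmul (f := sliceLeft (φ + ψ))
    (g := sliceLeft φ + sliceLeft ψ) fun a c => ?_) X
  simp [sliceLeft_tmul, add_smul]

end Left

section Right

variable [PartialOrder B] [StarOrderedRing B] (ψ : B →ₚ[ℂ] ℂ)

theorem sliceRight_map (f : A →⋆ₐ[ℂ] A') (X : MinTensor A B) :
    sliceRight ψ (MinTensor.map f (StarAlgHom.id ℂ B) X) = f (sliceRight ψ X) := by
  refine DFunLike.congr_fun (MinTensor.ext_tmul (f := sliceRight ψ ∘L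
    homL (MinTensor.map f (StarAlgHom.id ℂ B))) (g := homL f ∘L sliceRight ψ) fun a b => ?_) X
  simp [MinTensor.map_tmul, sliceRight_tmul]

theorem sliceRight_mul_left (a : A) (X : MinTensor A B) :
    sliceRight ψ (MinTensor.tmul a 1 * X) = a * sliceRight ψ X := by
  refine DFunLike.congr_fun (MinTensor.ext_tmul (f := sliceRight ψ ∘L
    ContinuousLinearMap.mul ℂ _ (MinTensor.tmul a 1))
    (g := ContinuousLinearMap.mul ℂ _ a ∘L sliceRight ψ) fun a c => ?_) X
  simp [MinTensor.tmul_mul_tmul, sliceRight_tmul]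

theorem sliceRight_mul_right (a : A) (X : MinTensor A B) :
    sliceRight ψ (X * MinTensor.tmul a 1) = sliceRight ψ X * a := by
  refine DFunLike.congr_fun (MinTensor.ext_tmul (f := sliceRight ψ ∘L
    (ContinuousLinearMap.mul ℂ _).flip (MinTensor.tmul a 1))
    (g := (ContinuousLinearMap.mul ℂ _).flip a ∘L sliceRight ψ) fun a c => ?_) X
  simp [MinTensor.tmul_mul_tmul, sliceRight_tmul]

theorem sliceRight_add (χ : B →ₚ[ℂ] ℂ) (X : MinTensor A B) :
    sliceRight (ψ + χ) X = sliceRight ψ X + sliceRight χ X := by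
  refine DFunLike.congr_fun (MinTensor.ext_tmul (f := sliceRight (ψ + χ))
    (g := sliceRight ψ + sliceRight χ) fun a c => ?_) X
  simp [sliceRight_tmul, add_smul]

end Right

variable [PartialOrder A] [StarOrderedRing A] [PartialOrder B] [StarOrderedRing B]

/-- `(φ ⊗ ψ) X` does not depend on the order of slicing. -/
theorem slice_comm (φ : A →ₚ[ℂ] ℂ) (ψ : B →ₚ[ℂ] ℂ) (X : MinTensor A B) :
    φ (sliceRight ψ X) = ψ (sliceLeft φ X) := by
  refine DFunLike.congr_fun (MinTensor.ext_tmul (f := funL φ ∘L sliceRight ψ)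
    (g := funL ψ ∘L sliceLeft φ) fun a b => ?_) X
  simp [sliceLeft_tmul, sliceRight_tmul, mul_comm]

/-- Slices by positive functionals on the right leg separate points. -/
theorem eq_of_sliceRight {X Y : MinTensor A B}
    (h : ∀ ψ : B →ₚ[ℂ] ℂ, sliceRight ψ X = sliceRight ψ Y) : X = Y :=
  eq_of_sliceLeft fun φ => eq_of_positive fun ψ => by
    rw [← slice_comm, ← slice_comm, h]

/-- The map `X ↦ (π_φ ⊗ π_ψ)(X) (Ω_φ ⊗ Ω_ψ)`. -/
def pairVec (φ : A →ₚ[ℂ] ℂ) (ψ : B →ₚ[ℂ] ℂ) : MinTensor A B →L[ℂ] HilbTensor φ.GNS ψ.GNS :=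
  (ContinuousLinearMap.apply ℂ _ (HilbTensor.of (cyclic φ ⊗ₜ[ℂ] cyclic ψ))) ∘L
    MinTensor.repL φ.gnsStarAlgHom ψ.gnsStarAlgHom

theorem pairVec_apply (φ : A →ₚ[ℂ] ℂ) (ψ : B →ₚ[ℂ] ℂ) (X : MinTensor A B) :
    pairVec φ ψ X = MinTensor.rep φ.gnsStarAlgHom ψ.gnsStarAlgHom X
      (HilbTensor.of (cyclic φ ⊗ₜ[ℂ] cyclic ψ)) := rfl

/-- The vector functional of Ω_φ ⊗ Ω_ψ is φ ⊗ ψ. Positivity of φ ⊗ ψ and Cauchy–Schwarz for it on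
the completed tensor product are thereby inherited from a Hilbert space. -/
theorem inner_pairVec (φ : A →ₚ[ℂ] ℂ) (ψ : B →ₚ[ℂ] ℂ) (X Y : MinTensor A B) :
    ⟪pairVec φ ψ X, pairVec φ ψ Y⟫_ℂ = φ (sliceRight ψ (star X * Y)) := by
  have h : ∀ Z, ⟪HilbTensor.of (cyclic φ ⊗ₜ[ℂ] cyclic ψ), pairVec φ ψ Z⟫_ℂ =
      φ (sliceRight ψ Z) := fun Z => by
    refine DFunLike.congr_fun (MinTensor.ext_tmul
      (f := innerSL ℂ (HilbTensor.of (cyclic φ ⊗ₜ[ℂ] cyclic ψ)) ∘L pairVec φ ψ)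
      (g := funL φ ∘L sliceRight ψ) fun a b => ?_) Z
    simp only [ContinuousLinearMap.comp_apply, innerSL_apply_apply, pairVec_apply,
      MinTensor.rep_tmul, HilbTensor.inner_of, TensorProduct.inner_tmul, inner_cyclic,
      sliceRight_tmul, funL_apply, map_smul, smul_eq_mul, mul_comm]
  rw [← h, pairVec_apply φ ψ (star X * Y), map_mul, map_star, mul_apply_eq_comp,
    ContinuousLinearMap.star_eq_adjoint, ContinuousLinearMap.adjoint_inner_right]
  rfl

theorem pairVec_eq_zero_iff (φ : A →ₚ[ℂ] ℂ) (ψ : B →ₚ[ℂ] ℂ) (X : MinTensor A B) :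
    pairVec φ ψ X = 0 ↔ φ (sliceRight ψ (star X * X)) = 0 := by
  rw [← inner_pairVec, inner_self_eq_zero]

/-- Cauchy–Schwarz for φ ⊗ ψ: X is a null vector, hence orthogonal to Y*. -/
theorem slice_star_mul_eq_zero {φ : A →ₚ[ℂ] ℂ} {ψ : B →ₚ[ℂ] ℂ} {X : MinTensor A B}
    (hX : φ (sliceRight ψ (star X * X)) = 0) (Y : MinTensor A B) :
    φ (sliceRight ψ (Y * X)) = 0 := by
  have h := inner_pairVec φ ψ (star Y) X
  rwa [star_star, (pairVec_eq_zero_iff φ ψ X).2 hX, inner_zero_right, eq_comm] at h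

end SliceCalculus

/-! ### Triple tensor products -/

section Triple

variable {A B C : Type u} [CStarAlgebra A] [CStarAlgebra B] [CStarAlgebra C]

theorem induction_threefold {p : (A ⊗[ℂ] B) ⊗[ℂ] C → Prop} (t : (A ⊗[ℂ] B) ⊗[ℂ] C) (h0 : p 0)
    (hadd : ∀ s t, p s → p t → p (s + t)) (h : ∀ a b c, p ((a ⊗ₜ b) ⊗ₜ c)) : p t := by
  induction t with
  | zero => exact h0
  | add s t hs ht => exact hadd s t hs ht
  | tmul s c =>
    induction s with
    | zero => rwa [TensorProduct.zero_tmul]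
    | add s t hs ht => rw [TensorProduct.add_tmul]; exact hadd _ _ hs ht
    | tmul a b => exact h a b c

theorem leftTriple_tmul (a : A) (b : B) (c : C) :
    leftTriple A B C ((a ⊗ₜ b) ⊗ₜ c) = MinTensor.tmul (MinTensor.tmul a b) c := rfl

theorem rightTriple_assoc_tmul (a : A) (b : B) (c : C) :
    rightTriple A B C (TensorProduct.assoc ℂ A B C ((a ⊗ₜ b) ⊗ₜ c)) =
      MinTensor.tmul a (MinTensor.tmul b c) := rfl

theorem leftTriple_mul (s t : (A ⊗[ℂ] B) ⊗[ℂ] C) :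
    leftTriple A B C (s * t) = leftTriple A B C s * leftTriple A B C t := by
  refine induction_threefold (p := fun s => leftTriple A B C (s * t) =
    leftTriple A B C s * leftTriple A B C t) s (by rw [zero_mul, map_zero, zero_mul])
    (fun s s' hs hs' => by rw [add_mul, map_add, hs, hs', map_add, add_mul]) fun a b c => ?_
  refine induction_threefold (p := fun t => leftTriple A B C ((a ⊗ₜ b) ⊗ₜ c * t) =
    leftTriple A B C ((a ⊗ₜ b) ⊗ₜ c) * leftTriple A B C t) t
    (by rw [mul_zero, map_zero, mul_zero])
    (fun s s' hs hs' => by rw [mul_add, map_add, hs, hs', map_add, mul_add]) fun a' b' c' => ?_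
  rw [Algebra.TensorProduct.tmul_mul_tmul, Algebra.TensorProduct.tmul_mul_tmul, leftTriple_tmul,
    leftTriple_tmul, leftTriple_tmul, MinTensor.tmul_mul_tmul, MinTensor.tmul_mul_tmul]

theorem rightTriple_assoc_mul (s t : (A ⊗[ℂ] B) ⊗[ℂ] C) :
    rightTriple A B C (TensorProduct.assoc ℂ A B C (s * t)) =
      rightTriple A B C (TensorProduct.assoc ℂ A B C s) *
        rightTriple A B C (TensorProduct.assoc ℂ A B C t) := by
  refine induction_threefold (p := fun s =>
    rightTriple A B C (TensorProduct.assoc ℂ A B C (s * t)) =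
      rightTriple A B C (TensorProduct.assoc ℂ A B C s) *
        rightTriple A B C (TensorProduct.assoc ℂ A B C t)) s
    (by rw [zero_mul, map_zero, map_zero, zero_mul])
    (fun s s' hs hs' => by simp only [add_mul, map_add, hs, hs']) fun a b c => ?_
  refine induction_threefold (p := fun t =>
    rightTriple A B C (TensorProduct.assoc ℂ A B C ((a ⊗ₜ b) ⊗ₜ c * t)) =
      rightTriple A B C (TensorProduct.assoc ℂ A B C ((a ⊗ₜ b) ⊗ₜ c)) *
        rightTriple A B C (TensorProduct.assoc ℂ A B C t)) t
    (by rw [mul_zero, map_zero, map_zero, mul_zero])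
    (fun s s' hs hs' => by simp only [mul_add, map_add, hs, hs']) fun a' b' c' => ?_
  rw [Algebra.TensorProduct.tmul_mul_tmul, Algebra.TensorProduct.tmul_mul_tmul,
    rightTriple_assoc_tmul, rightTriple_assoc_tmul, rightTriple_assoc_tmul,
    MinTensor.tmul_mul_tmul, MinTensor.tmul_mul_tmul]

/-- The algebraic associator is multiplicative and multiplication is continuous, so the closure of
its graph is closed under products. This allows a coassociativity relation to be multiplied by
elementary tensors before slicing. -/
theorem SameTriple.mul {z z' : MinTensor (MinTensor A B) C} {w w' : MinTensor A (MinTensor B C)}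
    (h : SameTriple z w) (h' : SameTriple z' w') : SameTriple (z * z') (w * w') := by
  have hc : Continuous (Function.uncurry fun p q : MinTensor (MinTensor A B) C ×
      MinTensor A (MinTensor B C) => (p.1 * q.1, p.2 * q.2)) := by
    unfold Function.uncurry
    fun_prop
  refine map_mem_closure₂ (x := (z, w)) (y := (z', w')) hc h h' ?_
  rintro _ ⟨s, rfl⟩ _ ⟨t, rfl⟩
  exact ⟨s * t, Prod.ext (leftTriple_mul s t) (rightTriple_assoc_mul s t)⟩

theorem sameTriple_tmul (a : A) (b : B) (c : C) :
    SameTriple (MinTensor.tmul (MinTensor.tmul a b) c)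
      (MinTensor.tmul a (MinTensor.tmul b c)) :=
  subset_closure ⟨(a ⊗ₜ b) ⊗ₜ c, rfl⟩

theorem leftTriple_one_tmul {Q : Type u} [CStarAlgebra Q] (t : Q ⊗[ℂ] Q) :
    leftTriple Q Q Q ((TensorProduct.assoc ℂ Q Q Q).symm (1 ⊗ₜ t)) =
      MinTensor.map (leg₂ Q) (StarAlgHom.id ℂ Q) (MinTensor.of Q Q t) := by
  induction t with
  | zero => rw [TensorProduct.tmul_zero, map_zero, map_zero, map_zero, map_zero]
  | add s t hs ht => rw [TensorProduct.tmul_add, map_add, map_add, hs, ht, map_add, map_add]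
  | tmul a b =>
    rw [MinTensor.map_of, TensorProduct.assoc_symm_tmul, leftTriple_tmul]
    rfl

theorem sameTriple_leg₂ {Q : Type u} [CStarAlgebra Q] (X : MinTensor Q Q) :
    SameTriple (MinTensor.map (leg₂ Q) (StarAlgHom.id ℂ Q) X) (MinTensor.tmul 1 X) := by
  let f : MinTensor Q Q →ₗ[ℂ] MinTensor Q (MinTensor Q Q) :=
    (MinTensor.of Q (MinTensor Q Q)).toAlgHom.toLinearMap ∘ₗ TensorProduct.mk ℂ _ _ 1
  have h2 : Continuous f := by
    refine AddMonoidHomClass.continuous_of_bound f ‖(1 : Q)‖ fun X => ?_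
    exact (MinTensor.norm_of _).trans_le (minNorm_tmul_le _ _)
  refine MinTensor.induction_of (p := fun X : MinTensor Q Q => SameTriple
    (MinTensor.map (leg₂ Q) (StarAlgHom.id ℂ Q) X) (f X)) X
    (isClosed_closure.preimage ((MinTensor.continuous_map _ _).prodMk h2)) fun t => ?_
  refine subset_closure ⟨(TensorProduct.assoc ℂ Q Q Q).symm (1 ⊗ₜ t), Prod.ext
    (leftTriple_one_tmul t) ?_⟩
  exact congrArg (rightTriple Q Q Q) (LinearEquiv.apply_symm_apply _ _)

/-- Slicing the two outer legs of corresponding triple tensors. -/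
theorem SameTriple.slice [PartialOrder A] [StarOrderedRing A] [PartialOrder C]
    [StarOrderedRing C] {z : MinTensor (MinTensor A B) C} {w : MinTensor A (MinTensor B C)}
    (h : SameTriple z w) (φ : A →ₚ[ℂ] ℂ) (χ : C →ₚ[ℂ] ℂ) :
    sliceLeft φ (sliceRight χ z) = sliceRight χ (sliceLeft φ w) := by
  have hc : IsClosed {p : MinTensor (MinTensor A B) C × MinTensor A (MinTensor B C) |
      sliceLeft φ (sliceRight χ p.1) = sliceRight χ (sliceLeft φ p.2)} :=
    isClosed_eq (by fun_prop) (by fun_prop)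
  refine closure_minimal ?_ hc h
  rintro _ ⟨t, rfl⟩
  refine induction_threefold (p := fun t => sliceLeft φ (sliceRight χ (leftTriple A B C t)) =
    sliceRight χ (sliceLeft φ (rightTriple A B C (TensorProduct.assoc ℂ A B C t)))) t
    (by simp only [map_zero]) (fun s t hs ht => by simp only [map_add, hs, ht]) fun a b c => ?_
  rw [leftTriple_tmul, rightTriple_assoc_tmul, sliceLeft_tmul, sliceRight_tmul, map_smul,
    map_smul, sliceLeft_tmul, sliceRight_tmul, smul_comm]

end Triple

/-! ### Convolution by functionals and the Haar state -/

section Convolution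

variable {Q : Type u} [CStarAlgebra Q]

theorem dense_span_star {E : Type*} [NormedRing E] [StarRing E] [CStarRing E] [NormedAlgebra ℂ E]
    [StarModule ℂ E] {S T : Set E} (hS : Dense (Submodule.span ℂ S : Set E))
    (h : ∀ x ∈ S, star x ∈ T) : Dense (Submodule.span ℂ T : Set E) := fun x => by
  rw [← star_star x]
  refine map_mem_closure continuous_star (hS (star x)) fun y hy => ?_
  induction hy using Submodule.span_induction with
  | mem y hy => exact Submodule.subset_span (h y hy)
  | zero => rw [star_zero]; exact zero_mem _
  | add y z _ _ hy hz => rw [star_add]; exact add_mem hy hz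
  | smul c y _ hy => rw [star_smul]; exact Submodule.smul_mem _ _ hy

/-- Continuous linear maps that agree on a set with dense span agree. -/
theorem ext_of_dense_span {E F : Type*} [NormedAddCommGroup E] [NormedSpace ℂ E]
    [NormedAddCommGroup F] [NormedSpace ℂ F] {S : Set E}
    (hS : Dense (Submodule.span ℂ S : Set E)) {f g : E →L[ℂ] F} (h : ∀ x ∈ S, f x = g x) : f = g :=
  ContinuousLinearMap.ext fun x => congrFun (Continuous.ext_on hS f.continuous g.continuous
    (fun _ hy => LinearMap.eqOn_span (f := f.toLinearMap) (g := g.toLinearMap) h hy)) x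

namespace CompactQuantumGroup

variable (G : CompactQuantumGroup Q) {F : Type*} [NormedAddCommGroup F] [NormedSpace ℂ F]

/-- The adjoint form of the density axiom. The free factor has to stand on the left, because
Cauchy–Schwarz produces information on slices of products (c ⊗ 1)Δ(a). -/
theorem ext_left {f g : MinTensor Q Q →L[ℂ] F}
    (h : ∀ c a, f (MinTensor.tmul c 1 * G.Δ a) = g (MinTensor.tmul c 1 * G.Δ a)) : f = g := by
  refine ext_of_dense_span (S := {x | ∃ c a, x = MinTensor.tmul c 1 * G.Δ a})
    (dense_span_star G.dense_left ?_) ?_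
  · rintro _ ⟨a, b, rfl⟩
    exact ⟨star b, star a, by rw [star_mul, MinTensor.star_tmul, star_one, map_star]⟩
  · rintro _ ⟨c, a, rfl⟩
    exact h c a

theorem ext_right {f g : MinTensor Q Q →L[ℂ] F}
    (h : ∀ c a, f (MinTensor.tmul 1 c * G.Δ a) = g (MinTensor.tmul 1 c * G.Δ a)) : f = g := by
  refine ext_of_dense_span (S := {x | ∃ c a, x = MinTensor.tmul 1 c * G.Δ a})
    (dense_span_star G.dense_right ?_) ?_
  · rintro _ ⟨a, b, rfl⟩
    exact ⟨star b, star a, by rw [star_mul, MinTensor.star_tmul, star_one, map_star]⟩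
  · rintro _ ⟨c, a, rfl⟩
    exact h c a

theorem ext_right' {f g : MinTensor Q Q →L[ℂ] F}
    (h : ∀ a c, f (G.Δ a * MinTensor.tmul 1 c) = g (G.Δ a * MinTensor.tmul 1 c)) : f = g := by
  refine ext_of_dense_span G.dense_right ?_
  rintro _ ⟨a, c, rfl⟩
  exact h a c

variable [PartialOrder Q] [StarOrderedRing Q]

/-- The operator `(id ⊗ ω) Δ`. -/
def convR (ω : Q →ₚ[ℂ] ℂ) : Q →L[ℂ] Q := sliceRight ω ∘L homL G.Δ

/-- The operator `(ω ⊗ id) Δ`. -/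
def convL (ω : Q →ₚ[ℂ] ℂ) : Q →L[ℂ] Q := sliceLeft ω ∘L homL G.Δ

theorem convR_apply (ω : Q →ₚ[ℂ] ℂ) (a : Q) : G.convR ω a = sliceRight ω (G.Δ a) := rfl

theorem convL_apply (ω : Q →ₚ[ℂ] ℂ) (a : Q) : G.convL ω a = sliceLeft ω (G.Δ a) := rfl

/-- Both sides are the convolution (φ ⊗ χ)Δ(a). Statements about operators (id ⊗ χ)Δ are turned into
statements about (φ ⊗ id)Δ in this way. -/
theorem apply_convR (φ χ : Q →ₚ[ℂ] ℂ) (a : Q) : φ (G.convR χ a) = χ (G.convL φ a) :=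
  slice_comm φ χ _

/-- Coassociativity: both sides slice the outer legs of the twofold coproduct of `a`. -/
theorem convL_convR (φ χ : Q →ₚ[ℂ] ℂ) (a : Q) :
    G.convL φ (G.convR χ a) = G.convR χ (G.convL φ a) := by
  have h := (G.coassoc a).slice φ χ
  rwa [sliceRight_map, sliceLeft_map] at h

/-- Both sides are (φ ⊗ ρ ⊗ χ)((c ⊗ 1 ⊗ 1) Δ²(a)), where Δ² is the twofold coproduct. -/
theorem apply_mul_convR_convR (φ ρ χ : Q →ₚ[ℂ] ℂ) (c a : Q) :
    φ (c * G.convR ρ (G.convR χ a)) =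
      ρ (G.convR χ (sliceLeft φ (MinTensor.tmul c 1 * G.Δ a))) := by
  have h := ((sameTriple_tmul c (1 : Q) (1 : Q)).mul (G.coassoc a)).slice φ χ
  have h2 : (MinTensor.tmul c (MinTensor.tmul 1 1) : MinTensor Q (MinTensor Q Q)) =
      MinTensor.map (StarAlgHom.id ℂ Q) G.Δ (MinTensor.tmul c 1) := by
    rw [MinTensor.map_tmul, map_one, MinTensor.one_def]; rfl
  rw [h2, ← map_mul, sliceLeft_map, sliceRight_mul_left, sliceRight_map] at h
  rw [convR_apply, ← sliceRight_mul_left, slice_comm]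
  exact congrArg ρ h

/-- Both sides are (χ ⊗ ρ ⊗ φ)((1 ⊗ 1 ⊗ c) Δ²(a)). -/
theorem apply_mul_convL_convL (φ ρ χ : Q →ₚ[ℂ] ℂ) (c a : Q) :
    φ (c * G.convL ρ (G.convL χ a)) =
      ρ (G.convL χ (sliceRight φ (MinTensor.tmul 1 c * G.Δ a))) := by
  have h := ((sameTriple_tmul (1 : Q) (1 : Q) c).mul (G.coassoc a)).slice χ φ
  have h2 : (MinTensor.tmul (MinTensor.tmul 1 1) c : MinTensor (MinTensor Q Q) Q) =
      MinTensor.map G.Δ (StarAlgHom.id ℂ Q) (MinTensor.tmul 1 c) := by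
    rw [MinTensor.map_tmul, map_one, MinTensor.one_def]; rfl
  rw [h2, ← map_mul, sliceRight_map, sliceLeft_mul_left, sliceLeft_map] at h
  rw [convL_apply, ← sliceLeft_mul_left, ← slice_comm]
  exact congrArg ρ h.symm

end CompactQuantumGroup

theorem sliceLeft_star {A B : Type u} [CStarAlgebra A] [CStarAlgebra B] [PartialOrder A]
    [StarOrderedRing A] (φ : A →ₚ[ℂ] ℂ) (X : MinTensor A B) :
    sliceLeft φ (star X) = star (sliceLeft φ X) := by
  refine MinTensor.induction_of (p := fun X => sliceLeft φ (star X) = star (sliceLeft φ X)) X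
    (isClosed_eq (by fun_prop) (by fun_prop)) fun t => ?_
  induction t with
  | zero => simp
  | add s t hs ht => simp only [map_add, star_add, hs, ht]
  | tmul a b =>
    change sliceLeft φ (star (MinTensor.tmul a b)) = star (sliceLeft φ (MinTensor.tmul a b))
    rw [MinTensor.star_tmul, sliceLeft_tmul, sliceLeft_tmul, star_smul, map_star]

theorem sliceRight_star {A B : Type u} [CStarAlgebra A] [CStarAlgebra B] [PartialOrder B]
    [StarOrderedRing B] (ψ : B →ₚ[ℂ] ℂ) (X : MinTensor A B) :
    sliceRight ψ (star X) = star (sliceRight ψ X) := by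
  refine MinTensor.induction_of (p := fun X => sliceRight ψ (star X) = star (sliceRight ψ X)) X
    (isClosed_eq (by fun_prop) (by fun_prop)) fun t => ?_
  induction t with
  | zero => simp
  | add s t hs ht => simp only [map_add, star_add, hs, ht]
  | tmul a b =>
    change sliceRight ψ (star (MinTensor.tmul a b)) = star (sliceRight ψ (MinTensor.tmul a b))
    rw [MinTensor.star_tmul, sliceRight_tmul, sliceRight_tmul, star_smul, map_star]

theorem slice_star_mul_self_nonneg {A B : Type u} [CStarAlgebra A] [CStarAlgebra B]
    [PartialOrder A] [StarOrderedRing A] [PartialOrder B] [StarOrderedRing B] (φ : A →ₚ[ℂ] ℂ)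
    (ψ : B →ₚ[ℂ] ℂ) (X : MinTensor A B) : 0 ≤ φ (sliceRight ψ (star X * X)) := by
  rw [← inner_pairVec, inner_self_eq_norm_sq_to_K, ← RCLike.ofReal_pow]
  exact RCLike.ofReal_nonneg.2 (sq_nonneg _)

theorem star_apply_one {A : Type u} [CStarAlgebra A] [PartialOrder A] [StarOrderedRing A]
    (φ : A →ₚ[ℂ] ℂ) : star (φ 1) = φ 1 := by
  rw [← map_star, star_one]

/-! ### Absorption under convolution passes to dominated functionals -/

section Domination

variable (G : CompactQuantumGroup Q) [PartialOrder Q] [StarOrderedRing Q]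

/-- `h` absorbs `ω` under convolution on both sides. -/
structure CompactQuantumGroup.Absorbs (h ω : Q →ₚ[ℂ] ℂ) : Prop where
  right : ∀ a, h (G.convR ω a) = ω 1 * h a
  left : ∀ a, h (G.convL ω a) = ω 1 * h a

variable {G}

/-- A state that absorbs `ρ + σ` absorbs `ρ`. -/
theorem CompactQuantumGroup.Absorbs.of_add {h ρ σ : Q →ₚ[ℂ] ℂ} (h1 : h 1 = 1)
    (H : G.Absorbs h (ρ + σ)) : G.Absorbs h ρ := by
  set ω := ρ + σ with hω
  constructor
  · have key : ∀ a, G.convL ω (G.convL h a) = ω 1 • G.convL h a := fun a =>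
      eq_of_positive fun φ => by
        rw [← G.apply_convR, ← G.convL_convR, ← G.apply_convR, H.right, G.apply_convR, map_smul,
          smul_eq_mul]
    -- For b = (h ⊗ id)Δ(a), the element D = Δ(b) − 1 ⊗ b measures the failure of b to be fixed. It
    -- is null for ω ⊗ h, hence for the dominated functional ρ ⊗ h.
    have hD : ∀ a c, h (c * G.convL ρ (G.convL h a)) = ρ 1 * h (c * G.convL h a) := fun a c => by
      set b := G.convL h a with hb
      set D := G.Δ b - MinTensor.tmul 1 b with hD
      have e1 : star D * D = G.Δ (star b * b) - G.Δ (star b) * MinTensor.tmul 1 b -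
          MinTensor.tmul 1 (star b) * G.Δ b + MinTensor.tmul 1 (star b * b) := by
        have e2 : (MinTensor.tmul 1 (star b * b) : MinTensor Q Q) =
          MinTensor.tmul 1 (star b) * MinTensor.tmul 1 b := by
            rw [MinTensor.tmul_mul_tmul, one_mul]
        rw [e2, hD, star_sub, MinTensor.star_tmul, star_one, ← map_star, map_mul]
        noncomm_ring
      -- Each of the four terms of D*D contributes ω(1)h(b*b), with signs +, −, −, +: the outer ones
      -- by absorption and h ∘ slice of an elementary tensor, the mixed ones by `key`.
      have e3 : h (sliceLeft ω (star D * D)) = 0 := by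
        rw [e1, map_add, map_sub, map_sub, sliceLeft_mul_left, sliceLeft_mul_right, map_star,
          sliceLeft_star, ← G.convL_apply, ← G.convL_apply, key a, sliceLeft_tmul, star_smul,
          star_apply_one, mul_smul_comm, smul_mul_assoc, map_add, map_sub, map_sub, H.left,
          map_smul, smul_eq_mul]
        ring
      rw [hω, sliceLeft_add, map_add, ← slice_comm, ← slice_comm] at e3
      -- A sum of two nonnegative numbers is zero, so the ρ part vanishes alone. This is where
      -- domination is used.
      have e4 := (add_eq_zero_iff_of_nonneg (slice_star_mul_self_nonneg ρ h D)
        (slice_star_mul_self_nonneg σ h D)).1 e3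
      have e5 := slice_star_mul_eq_zero e4.1 (MinTensor.tmul 1 c)
      rw [slice_comm, sliceLeft_mul_left, hD, map_sub, sliceLeft_tmul, mul_sub, map_sub,
        mul_smul_comm, map_smul, sub_eq_zero, smul_eq_mul] at e5
      exact e5
    -- By coassociativity `hD` is the required identity at y = (id ⊗ h)((1 ⊗ c)Δ(a)). Such y come
    -- from a dense span, so the identity holds at every slice, in particular at (id ⊗ h)(a ⊗ 1) =
    -- a.
    have e6 : (funL h ∘L G.convR ρ) ∘L sliceRight h = (ρ 1 • funL h) ∘L sliceRight h := by
      refine G.ext_right fun c a => ?_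
      have e7 := G.apply_mul_convL_convL h ρ h c a
      rw [hD] at e7
      simp only [ContinuousLinearMap.comp_apply, funL_apply, smul_apply, smul_eq_mul]
      rw [G.apply_convR, ← e7, slice_comm, sliceLeft_mul_left, G.convL_apply]
    intro a
    have e8 := DFunLike.congr_fun e6 (MinTensor.tmul a 1)
    simpa [sliceRight_tmul, h1] using e8
  -- The mirror image, with b = (id ⊗ h)Δ(a) and D = Δ(b) − b ⊗ 1.
  · have key : ∀ a, G.convR ω (G.convR h a) = ω 1 • G.convR h a := fun a =>
      eq_of_positive fun φ => by
        rw [G.apply_convR, G.convL_convR, G.apply_convR, H.left, ← G.apply_convR, map_smul,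
          smul_eq_mul]
    have hD : ∀ a c, h (c * G.convR ρ (G.convR h a)) = ρ 1 * h (c * G.convR h a) := fun a c => by
      set b := G.convR h a with hb
      set D := G.Δ b - MinTensor.tmul b 1 with hD
      have e1 : star D * D = G.Δ (star b * b) - G.Δ (star b) * MinTensor.tmul b 1 -
          MinTensor.tmul (star b) 1 * G.Δ b + MinTensor.tmul (star b * b) 1 := by
        have e2 : (MinTensor.tmul (star b * b) 1 : MinTensor Q Q) =
          MinTensor.tmul (star b) 1 * MinTensor.tmul b 1 := by
            rw [MinTensor.tmul_mul_tmul, one_mul]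
        rw [e2, hD, star_sub, MinTensor.star_tmul, star_one, ← map_star, map_mul]
        noncomm_ring
      have e3 : h (sliceRight ω (star D * D)) = 0 := by
        rw [e1, map_add, map_sub, map_sub, sliceRight_mul_left, sliceRight_mul_right, map_star,
          sliceRight_star, ← G.convR_apply, ← G.convR_apply, key a, sliceRight_tmul, star_smul,
          star_apply_one, mul_smul_comm, smul_mul_assoc, map_add, map_sub, map_sub, H.right,
          map_smul, smul_eq_mul]
        ring
      rw [hω, sliceRight_add, map_add] at e3
      have e4 := (add_eq_zero_iff_of_nonneg (slice_star_mul_self_nonneg h ρ D)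
        (slice_star_mul_self_nonneg h σ D)).1 e3
      have e5 := slice_star_mul_eq_zero e4.1 (MinTensor.tmul c 1)
      rw [sliceRight_mul_left, hD, map_sub, sliceRight_tmul, mul_sub, map_sub,
        mul_smul_comm, map_smul, sub_eq_zero, smul_eq_mul] at e5
      exact e5
    have e6 : (funL h ∘L G.convL ρ) ∘L sliceLeft h = (ρ 1 • funL h) ∘L sliceLeft h := by
      refine G.ext_left fun c a => ?_
      have e7 := G.apply_mul_convR_convR h ρ h c a
      rw [hD] at e7
      simp only [ContinuousLinearMap.comp_apply, funL_apply, smul_apply, smul_eq_mul]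
      rw [← G.apply_convR, ← e7, ← slice_comm, sliceRight_mul_left, G.convR_apply]
    intro a
    have e8 := DFunLike.congr_fun e6 (MinTensor.tmul 1 a)
    simpa [sliceLeft_tmul, h1] using e8

end Domination

end Convolution

/-! ### Existence of the Haar state by Cesàro means and compactness -/

section HaarState

open Filter Topology

variable {Q : Type u} [CStarAlgebra Q]

theorem norm_apply_le_cyclic [PartialOrder Q] [StarOrderedRing Q] (φ : Q →ₚ[ℂ] ℂ) (a : Q) :
    ‖φ a‖ ≤ ‖cyclic φ‖ ^ 2 * ‖a‖ := by
  rw [← inner_cyclic]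
  refine (norm_inner_le_norm _ _).trans ?_
  have h1 := (φ.gnsStarAlgHom a).le_opNorm (cyclic φ)
  have h2 := NonUnitalStarAlgHom.norm_apply_le φ.gnsStarAlgHom a
  have h3 := h1.trans (mul_le_mul_of_nonneg_right h2 (norm_nonneg (cyclic φ)))
  nlinarith [norm_nonneg (cyclic φ)]

theorem norm_sliceRight_le {A : Type u} [CStarAlgebra A] [PartialOrder Q] [StarOrderedRing Q]
    (φ : Q →ₚ[ℂ] ℂ) (X : MinTensor A Q) : ‖sliceRight φ X‖ ≤ ‖cyclic φ‖ ^ 2 * ‖X‖ := by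
  refine MinTensor.induction_of (p := fun X => ‖sliceRight φ X‖ ≤ ‖cyclic φ‖ ^ 2 * ‖X‖) X
    (isClosed_le (by fun_prop) (by fun_prop)) fun t => ?_
  rw [MinTensor.norm_of]
  exact (congrArg norm (MinTensor.liftL_of _ _ (norm_algSliceRight_le φ) t)).trans_le
    (norm_algSliceRight_le φ t)

theorem norm_cyclic_of_state [PartialOrder Q] [StarOrderedRing Q] {φ : Q →ₚ[ℂ] ℂ} (h : φ 1 = 1) :
    ‖cyclic φ‖ ^ 2 = 1 := by
  exact_mod_cast (norm_cyclic_sq φ).trans h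

variable (Q) in
/-- The set of states, as a subset of the weak dual. -/
def stateSet : Set (WeakDual ℂ Q) :=
  WeakDual.toStrongDual ⁻¹' Metric.closedBall (0 : StrongDual ℂ Q) 1 ∩ {g | g 1 = 1}

/-- Banach–Alaoglu: states are cut out of the dual unit ball by the weak-* closed condition g(1) =
1. -/
theorem isCompact_stateSet : IsCompact (stateSet Q) :=
  (WeakDual.isCompact_closedBall (0 : StrongDual ℂ Q) 1).inter_right
    (isClosed_eq (WeakDual.eval_continuous 1) continuous_const)

theorem mem_stateSet {g : WeakDual ℂ Q} :
    g ∈ stateSet Q ↔ (∀ a, ‖g a‖ ≤ ‖a‖) ∧ g 1 = 1 := by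
  rw [stateSet, Set.mem_inter_iff, Set.mem_preimage, mem_closedBall_zero_iff]
  refine and_congr ⟨fun h a => ?_, fun h => ?_⟩ Iff.rfl
  · exact (ContinuousLinearMap.le_of_opNorm_le _ h a).trans_eq (one_mul _)
  · exact ContinuousLinearMap.opNorm_le_bound _ zero_le_one fun a => (h a).trans_eq (one_mul _).symm

/-- A state as a positive functional. -/
def ofState [PartialOrder Q] [StarOrderedRing Q] (g : WeakDual ℂ Q) (hg : g ∈ stateSet Q) :
    Q →ₚ[ℂ] ℂ :=
  PositiveLinearMap.mk₀ (WeakDual.toStrongDual g).toLinearMap fun a ha =>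
    nonneg_of_norm_le_one (WeakDual.toStrongDual g) (mem_closedBall_zero_iff.1 hg.1) hg.2 a ha

theorem ofState_apply [PartialOrder Q] [StarOrderedRing Q] (g : WeakDual ℂ Q)
    (hg : g ∈ stateSet Q) (a : Q) : ofState g hg a = g a := rfl

/-- A state for which `a` is far from zero. -/
theorem exists_state [PartialOrder Q] [StarOrderedRing Q] (a : Q) (ha : a ≠ 0) :
    ∃ φ : Q →ₚ[ℂ] ℂ, φ 1 = 1 ∧ ‖a‖ ^ 2 / 2 ≤ ‖φ (star a * a)‖ := by
  obtain ⟨p, hp⟩ := exists_rep_norm a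
  have ha0 : 0 < ‖a‖ := norm_pos_iff.2 ha
  -- The norm of the operator need not be attained at a unit vector; the factor √(1/2) leaves room
  -- and squares to the 1/2 in the statement.
  have hs : √(1 / 2) < 1 := by
    rw [Real.sqrt_lt' one_pos]; norm_num
  have h1 : √(1 / 2) * ‖a‖ < ‖p.hom a‖ := by nlinarith
  obtain ⟨x, hx1, hx2⟩ : ∃ x, ‖x‖ = 1 ∧ √(1 / 2) * ‖a‖ ≤ ‖p.hom a x‖ := by
    by_contra! hcon
    refine h1.not_ge (ContinuousLinearMap.opNorm_le_bound _ (by positivity) fun x => ?_)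
    rcases eq_or_ne x 0 with rfl | hx
    · simp
    · have hx0 : 0 < ‖x‖ := norm_pos_iff.2 hx
      have h2 := hcon ((‖x‖⁻¹ : ℂ) • x) (by
        rw [norm_smul, norm_inv, Complex.norm_real, norm_norm, inv_mul_cancel₀ hx0.ne'])
      rw [map_smul, norm_smul, norm_inv, Complex.norm_real, norm_norm, inv_mul_lt_iff₀ hx0] at h2
      linarith
  refine ⟨vectorFunctional p.hom x, ?_, ?_⟩
  · rw [vectorFunctional_apply, map_one, one_apply_eq_self, inner_self_eq_norm_sq_to_K, hx1]
    simp
  · rw [vectorFunctional_apply, map_mul, map_star, mul_apply_eq_comp,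
      ContinuousLinearMap.star_eq_adjoint, ContinuousLinearMap.adjoint_inner_right,
      inner_self_eq_norm_sq_to_K, norm_pow, RCLike.norm_ofReal, abs_norm]
    have h3 := pow_le_pow_left₀ (by positivity) hx2 2
    rw [mul_pow, Real.sq_sqrt (by norm_num)] at h3
    linarith

variable [PartialOrder Q] [StarOrderedRing Q] (G : CompactQuantumGroup Q)

namespace CompactQuantumGroup

theorem convR_one (ω : Q →ₚ[ℂ] ℂ) : G.convR ω 1 = ω 1 • 1 := by
  rw [convR_apply, map_one, MinTensor.one_def, sliceRight_tmul]

theorem norm_convR_le (ω : Q →ₚ[ℂ] ℂ) (a : Q) : ‖G.convR ω a‖ ≤ ‖cyclic ω‖ ^ 2 * ‖a‖ :=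
  (norm_sliceRight_le ω _).trans (mul_le_mul_of_nonneg_left
    (NonUnitalStarAlgHom.norm_apply_le G.Δ a) (by positivity))

/-- A state absorbs some state: Cesàro means of the convolution powers. -/
theorem exists_absorbs_state (ω : Q →ₚ[ℂ] ℂ) (hω : ω 1 = 1) :
    ∃ (g : WeakDual ℂ Q) (hg : g ∈ stateSet Q), G.Absorbs (ofState g hg) ω := by
  have hT : ∀ (k : ℕ) (a : Q), ‖(G.convR ω)^[k] a‖ ≤ ‖a‖ := by
    intro k
    induction k with
    | zero => exact fun a => le_rfl
    | succ k ih =>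
      intro a
      rw [Function.iterate_succ_apply]
      refine (ih _).trans ?_
      simpa [norm_cyclic_of_state hω] using G.norm_convR_le ω a
  have hT1 : ∀ k : ℕ, (G.convR ω)^[k] 1 = 1 := fun k =>
    Function.iterate_fixed (by rw [G.convR_one, hω, one_smul]) k
  -- Left and right convolution by ω commute and agree after applying ω, so the powers of ω do not
  -- distinguish the two sides. Left absorption will follow from right absorption.
  have hTL : ∀ (k : ℕ) (a : Q), ω ((G.convR ω)^[k] (G.convL ω a)) =
      ω ((G.convR ω)^[k] (G.convR ω a)) := fun k a => by
    rw [(Function.Commute.iterate_left (f := G.convR ω) (g := G.convL ω)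
      (fun b => (G.convL_convR ω ω b).symm) k).eq, ← G.apply_convR,
      ← Function.iterate_succ_apply' (G.convR ω), Function.iterate_succ_apply]
  -- The functional ω ∘ T^k, T being right convolution by ω, is the convolution power of exponent k
  -- + 1; `f n` is the mean of the first n + 1 powers.
  let f : ℕ → WeakDual ℂ Q := fun n => StrongDual.toWeakDual
    (((n : ℂ) + 1)⁻¹ • ∑ k ∈ Finset.range (n + 1), funL ω ∘L (G.convR ω) ^ k)
  have hf : ∀ n a, f n a = ((n : ℂ) + 1)⁻¹ * ∑ k ∈ Finset.range (n + 1),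
      ω ((G.convR ω)^[k] a) := fun n a => by
    change (((n : ℂ) + 1)⁻¹ • ∑ k ∈ Finset.range (n + 1), funL ω ∘L (G.convR ω) ^ k) a = _
    simp only [smul_apply, sum_apply, ContinuousLinearMap.comp_apply,
      funL_apply, smul_eq_mul, FunLike.coe_pow_eq_iterate]
  have hn : ∀ n : ℕ, ‖((n : ℂ) + 1)⁻¹‖ = ((n : ℝ) + 1)⁻¹ := fun n => by
    rw [norm_inv, ← Nat.cast_succ, Complex.norm_natCast, Nat.cast_succ]
  have hωn : ∀ a, ‖ω a‖ ≤ ‖a‖ := fun a => by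
    simpa [norm_cyclic_of_state hω] using norm_apply_le_cyclic ω a
  have hfS : ∀ n, f n ∈ stateSet Q := fun n => by
    have hn0 : (n : ℂ) + 1 ≠ 0 := Nat.cast_add_one_ne_zero n
    refine mem_stateSet.2 ⟨fun a => ?_, ?_⟩
    · rw [hf, norm_mul, hn, inv_mul_le_iff₀ (by positivity)]
      refine (norm_sum_le _ _).trans ((Finset.sum_le_sum fun k _ =>
        (hωn _).trans (hT k a)).trans_eq ?_)
      simp
    · rw [hf]
      simp [hT1, hω, hn0]
  -- The weak-* compact state space need not be metrizable, hence an ultrafilter limit and not a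
  -- subsequence.
  obtain ⟨g, hgS, hg⟩ := isCompact_stateSet.ultrafilter_le_nhds ((hyperfilter ℕ).map f)
    (le_principal_iff.2 (mem_map.2 (univ_mem' hfS)))
  have hlim : ∀ a, Tendsto (fun n => f n a) (hyperfilter ℕ) (𝓝 (g a)) := fun a =>
    ((WeakDual.eval_continuous a).tendsto g).comp hg
  have hR : ∀ a, g (G.convR ω a) = g a := fun a => by
    refine tendsto_nhds_unique (hlim _) ?_
    -- The difference of the two means telescopes to two terms divided by n + 1.
    have h1 : Tendsto (fun n : ℕ => f n (G.convR ω a) - f n a) atTop (𝓝 0) := by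
      refine squeeze_zero_norm (a := fun n : ℕ => (2 * ‖a‖) * ((n : ℝ) + 1)⁻¹) (fun n => ?_) ?_
      · have h2 : f n (G.convR ω a) - f n a = ((n : ℂ) + 1)⁻¹ *
            (ω ((G.convR ω)^[n + 1] a) - ω a) := by
          rw [hf, hf, ← mul_sub, ← Finset.sum_sub_distrib]
          simp only [← Function.iterate_succ_apply]
          rw [Finset.sum_range_sub (fun k => ω ((G.convR ω)^[k] a))]
          rfl
        rw [h2, norm_mul, hn, mul_comm]
        refine mul_le_mul_of_nonneg_right ((norm_sub_le _ _).trans ?_) (by positivity)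
        linarith [(hωn _).trans (hT (n + 1) a), hωn a]
      · have h3 := tendsto_one_div_add_atTop_nhds_zero_nat (𝕜 := ℝ)
        simpa using h3.const_mul (2 * ‖a‖)
    have h2 := (h1.mono_left Nat.hyperfilter_le_atTop).add (hlim a)
    simpa using h2
  have hL : ∀ a, g (G.convL ω a) = g a := fun a => by
    rw [← hR a]
    refine tendsto_nhds_unique (hlim _) ((hlim _).congr fun n => ?_)
    rw [hf, hf]
    simp only [hTL]
  exact ⟨g, hgS, fun a => by rw [ofState_apply, ofState_apply, hR, hω, one_mul],
    fun a => by rw [ofState_apply, ofState_apply, hL, hω, one_mul]⟩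

/-- The set of states absorbing `ω`. -/
def absorbing (ω : Q →ₚ[ℂ] ℂ) : Set (WeakDual ℂ Q) :=
  stateSet Q ∩ ((⋂ a, {g | g (G.convR ω a) = ω 1 * g a}) ∩ ⋂ a, {g | g (G.convL ω a) = ω 1 * g a})

theorem mem_absorbing {ω : Q →ₚ[ℂ] ℂ} {g : WeakDual ℂ Q} :
    g ∈ G.absorbing ω ↔ ∃ hg : g ∈ stateSet Q, G.Absorbs (ofState g hg) ω := by
  simp only [absorbing, Set.mem_inter_iff, Set.mem_iInter]
  exact ⟨fun h => ⟨h.1, h.2.1, h.2.2⟩, fun ⟨h1, h2⟩ => ⟨h1, h2.right, h2.left⟩⟩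

theorem isClosed_absorbing (ω : Q →ₚ[ℂ] ℂ) : IsClosed (G.absorbing ω) :=
  isCompact_stateSet.isClosed.inter
    ((isClosed_iInter fun _ => isClosed_eq (WeakDual.eval_continuous _)
      (continuous_const.mul (WeakDual.eval_continuous _))).inter
    (isClosed_iInter fun _ => isClosed_eq (WeakDual.eval_continuous _)
      (continuous_const.mul (WeakDual.eval_continuous _))))

theorem isCompact_absorbing (ω : Q →ₚ[ℂ] ℂ) : IsCompact (G.absorbing ω) :=
  isCompact_stateSet.of_isClosed_subset (G.isClosed_absorbing ω) Set.inter_subset_left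

/-- Adding functionals shrinks the absorbing set; with ρ + σ as a common bound for ρ and σ, the
family of absorbing sets is directed. -/
theorem absorbing_add_subset (ρ σ : Q →ₚ[ℂ] ℂ) : G.absorbing (ρ + σ) ⊆ G.absorbing ρ :=
  fun g hg => by
    obtain ⟨h1, h2⟩ := G.mem_absorbing.1 hg
    exact G.mem_absorbing.2 ⟨h1, h2.of_add h1.2⟩

/-- The functional ω may have any value at 1, even 0. Adding a state makes that value positive, so ω
+ s can be normalized to a state, and the Cesàro construction applies; absorption of ω + s passes to
ω. -/
theorem absorbing_nonempty [Nontrivial Q] (ω : Q →ₚ[ℂ] ℂ) : (G.absorbing ω).Nonempty := by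
  obtain ⟨s, hs, -⟩ := exists_state (1 : Q) one_ne_zero
  have h0 : 0 ≤ ω 1 := ω.map_nonneg zero_le_one
  have hpos : 0 < (ω + s) 1 := by
    rw [PositiveLinearMap.add_apply, hs]
    exact add_pos_of_nonneg_of_pos h0 one_pos
  set c := (ω + s) 1 with hc
  let ω' : Q →ₚ[ℂ] ℂ := PositiveLinearMap.mk₀ (c⁻¹ • (ω + s).toLinearMap) fun a ha =>
    mul_nonneg (inv_nonneg.2 hpos.le) ((ω + s).map_nonneg ha)
  have hω' : ∀ a, (ω + s) a = c * ω' a := fun a => by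
    change _ = c * (c⁻¹ * (ω + s) a)
    rw [mul_inv_cancel_left₀ hpos.ne']
  have h1 : ω' 1 = 1 := inv_mul_cancel₀ hpos.ne'
  have hconvR : ∀ a, G.convR (ω + s) a = c • G.convR ω' a := fun a =>
    eq_of_positive fun φ => by rw [map_smul, apply_convR, apply_convR, hω', smul_eq_mul]
  have hconvL : ∀ a, G.convL (ω + s) a = c • G.convL ω' a := fun a =>
    eq_of_positive fun φ => by rw [map_smul, ← apply_convR, ← apply_convR, hω', smul_eq_mul]
  obtain ⟨g, hg, hg2⟩ := G.exists_absorbs_state ω' h1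
  refine ⟨g, G.absorbing_add_subset ω s (G.mem_absorbing.2 ⟨hg, fun a => ?_, fun a => ?_⟩)⟩
  · rw [hconvR, map_smul, hg2.right, h1, one_mul, smul_eq_mul]
  · rw [hconvL, map_smul, hg2.left, h1, one_mul, smul_eq_mul]

/-- Every compact quantum group has a Haar state. -/
theorem exists_isHaarState [Nontrivial Q] : ∃ h : Q →ₚ[ℂ] ℂ, G.IsHaarState h := by
  obtain ⟨g, hg⟩ := IsCompact.nonempty_iInter_of_directed_nonempty_isCompact_isClosed G.absorbing
    (fun ρ σ => ⟨ρ + σ, G.absorbing_add_subset ρ σ,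
      by rw [add_comm]; exact G.absorbing_add_subset σ ρ⟩)
    G.absorbing_nonempty G.isCompact_absorbing G.isClosed_absorbing
  have h1 := fun ω => G.mem_absorbing.1 (Set.mem_iInter.1 hg ω)
  -- The index 0 is arbitrary: only membership of `g` in the state space is extracted.
  obtain ⟨hS, -⟩ := h1 0
  have hA : ∀ ω, G.Absorbs (ofState g hS) ω := fun ω => (h1 ω).2
  refine ⟨ofState g hS, hS.2, fun a => eq_of_positive fun φ => ?_,
    fun a => eq_of_positive fun φ => ?_⟩
  · rw [← convR_apply, G.apply_convR, (hA φ).left, map_smul, smul_eq_mul, mul_comm]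
  · rw [← convL_apply, ← G.apply_convR, (hA φ).right, map_smul, smul_eq_mul, mul_comm]

end CompactQuantumGroup

end HaarState

/-! ### The left kernel of the Haar state is a two-sided ideal -/

section HaarKernel

variable {Q : Type u} [CStarAlgebra Q]

theorem gns_apply_coe [PartialOrder Q] [StarOrderedRing Q] (φ : Q →ₚ[ℂ] ℂ) (a b : Q) :
    φ.gnsStarAlgHom a (φ.toPreGNS b : UniformSpace.Completion φ.PreGNS) =
      (φ.toPreGNS (a * b) : UniformSpace.Completion φ.PreGNS) :=
  φ.gnsNonUnitalStarAlgHom_apply_coe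

theorem gns_apply_cyclic [PartialOrder Q] [StarOrderedRing Q] (φ : Q →ₚ[ℂ] ℂ) (a : Q) :
    φ.gnsStarAlgHom a (cyclic φ) = (φ.toPreGNS a : UniformSpace.Completion φ.PreGNS) := by
  rw [cyclic, gns_apply_coe, mul_one]

theorem inner_gns_cyclic [PartialOrder Q] [StarOrderedRing Q] (φ : Q →ₚ[ℂ] ℂ) (a b : Q) :
    ⟪φ.gnsStarAlgHom a (cyclic φ), φ.gnsStarAlgHom b (cyclic φ)⟫_ℂ = φ (star a * b) := by
  rw [← inner_cyclic φ (star a * b), map_mul, map_star, mul_apply_eq_comp,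
    ContinuousLinearMap.star_eq_adjoint, ContinuousLinearMap.adjoint_inner_right]

/-- The vectors `π_φ(a) Ω` are dense in the GNS space. -/
theorem gns_induction [PartialOrder Q] [StarOrderedRing Q] {φ : Q →ₚ[ℂ] ℂ} {p : φ.GNS → Prop}
    (x : φ.GNS) (hp : IsClosed {x | p x}) (h : ∀ a, p (φ.gnsStarAlgHom a (cyclic φ))) : p x :=
  UniformSpace.Completion.induction_on x hp fun a => by
    have h1 := h (φ.ofPreGNS a)
    rwa [gns_apply_cyclic] at h1

/-- The hypothesis says that the operator kills all vectors cΩ, and these are dense. -/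
theorem gns_eq_zero [PartialOrder Q] [StarOrderedRing Q] {φ : Q →ₚ[ℂ] ℂ} {a : Q}
    (h : ∀ c, φ (star (a * c) * (a * c)) = 0) : φ.gnsStarAlgHom a = 0 := by
  ext x
  refine gns_induction (p := fun x => φ.gnsStarAlgHom a x = (0 : φ.GNS →L[ℂ] φ.GNS) x) x
    (isClosed_eq (by fun_prop) (by fun_prop)) fun c => ?_
  rw [← mul_apply_eq_comp, ← map_mul, zero_apply, ← inner_self_eq_zero (𝕜 := ℂ),
    inner_gns_cyclic, h]

namespace CompactQuantumGroup

/-- The algebraic map `b ⊗ c ↦ Δ(b) (1 ⊗ c)`. -/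
def mulUnitary (G : CompactQuantumGroup Q) : Q ⊗[ℂ] Q →ₗ[ℂ] MinTensor Q Q :=
  LinearMap.mul' ℂ (MinTensor Q Q) ∘ₗ
    TensorProduct.map G.Δ.toAlgHom.toLinearMap (leg₂ Q).toAlgHom.toLinearMap

theorem mulUnitary_tmul (G : CompactQuantumGroup Q) (b c : Q) :
    G.mulUnitary (b ⊗ₜ c) = G.Δ b * MinTensor.tmul 1 c := rfl

variable [PartialOrder Q] [StarOrderedRing Q] {G : CompactQuantumGroup Q} {h : Q →ₚ[ℂ] ℂ}

/-- Left invariance turns (h ⊗ h)((1 ⊗ c*)Δ(b*b')(1 ⊗ c')) into h(b*b')h(c*c'). Thus b ⊗ c ↦ Δ(b)(1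
⊗ c) is isometric for h ⊗ h, as the multiplicative unitary is. -/
theorem inner_pairVec_mulUnitary (hh : G.IsHaarState h) (s t : Q ⊗[ℂ] Q) :
    ⟪pairVec h h (G.mulUnitary s), pairVec h h (G.mulUnitary t)⟫_ℂ =
      ⟪pairVec h h (MinTensor.of Q Q s), pairVec h h (MinTensor.of Q Q t)⟫_ℂ := by
  induction s with
  | zero => simp only [map_zero, inner_zero_left]
  | add s s' hs hs' => simp only [map_add, inner_add_left, hs, hs']
  | tmul b c =>
    induction t with
    | zero => simp only [map_zero, inner_zero_right]
    | add t t' ht ht' => simp only [map_add, inner_add_right, ht, ht']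
    | tmul b' c' =>
      change _ = ⟪pairVec h h (MinTensor.tmul b c), pairVec h h (MinTensor.tmul b' c')⟫_ℂ
      rw [mulUnitary_tmul, mulUnitary_tmul, inner_pairVec, inner_pairVec, MinTensor.star_tmul,
        MinTensor.tmul_mul_tmul, slice_comm, slice_comm, sliceLeft_tmul, star_mul,
        MinTensor.star_tmul, star_one, ← map_star, mul_assoc, ← mul_assoc (G.Δ _), ← map_mul,
        sliceLeft_mul_left, sliceLeft_mul_right, hh.left, smul_mul_assoc, one_mul,
        mul_smul_comm]

/-- The continuous map `X ↦ (id ⊗ id ⊗ h)((Δ ⊗ id)(X) (1 ⊗ Δ(d)))`. -/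
def sliceMulΔ (G : CompactQuantumGroup Q) (h : Q →ₚ[ℂ] ℂ) (d : Q) :
    MinTensor Q Q →L[ℂ] MinTensor Q Q :=
  sliceRight h ∘L (ContinuousLinearMap.mul ℂ _).flip
    (MinTensor.map (leg₂ Q) (StarAlgHom.id ℂ Q) (G.Δ d)) ∘L
    homL (MinTensor.map G.Δ (StarAlgHom.id ℂ Q))

theorem sliceMulΔ_apply (d : Q) (X : MinTensor Q Q) :
    G.sliceMulΔ h d X = sliceRight h (MinTensor.map G.Δ (StarAlgHom.id ℂ Q) X *
      MinTensor.map (leg₂ Q) (StarAlgHom.id ℂ Q) (G.Δ d)) := rfl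

theorem sliceMulΔ_tmul (d b c : Q) :
    G.sliceMulΔ h d (MinTensor.tmul b c) =
      G.Δ b * leg₂ Q (sliceRight h (MinTensor.tmul 1 c * G.Δ d)) := by
  have h1 : MinTensor.map G.Δ (StarAlgHom.id ℂ Q) (MinTensor.tmul b c) =
      MinTensor.tmul (G.Δ b) 1 *
        MinTensor.map (leg₂ Q) (StarAlgHom.id ℂ Q) (MinTensor.tmul 1 c) := by
    rw [MinTensor.map_tmul, MinTensor.map_tmul, map_one, MinTensor.tmul_mul_tmul, mul_one,
      one_mul]
  rw [sliceMulΔ_apply, h1, mul_assoc, ← map_mul, sliceRight_mul_left, sliceRight_map]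

/-- By coassociativity (Δ ⊗ id)Δ(b)·(1 ⊗ Δ(d)) corresponds to (id ⊗ Δ)(Δ(b)(1 ⊗ d)). Right
invariance collapses the last two legs to a scalar, leaving an element of the first leg only. -/
theorem sliceMulΔ_Δ (hh : G.IsHaarState h) (d b : Q) :
    G.sliceMulΔ h d (G.Δ b) =
      MinTensor.tmul (sliceRight h (G.Δ b * MinTensor.tmul 1 d)) 1 := by
  have h1 : SameTriple (MinTensor.map (leg₂ Q) (StarAlgHom.id ℂ Q) (G.Δ d))
      (MinTensor.map (StarAlgHom.id ℂ Q) G.Δ (MinTensor.tmul 1 d)) := by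
    rw [MinTensor.map_tmul]
    exact sameTriple_leg₂ (G.Δ d)
  have h2 := (G.coassoc b).mul h1
  rw [← map_mul] at h2
  refine eq_of_sliceLeft fun φ => ?_
  have h3 := h2.slice φ h
  rw [sliceLeft_map, hh.right, ← slice_comm] at h3
  rw [sliceMulΔ_apply, sliceLeft_tmul]
  exact h3

/-- If `h (a* a) = 0` for the Haar state `h`, then `h (q a c) = 0` for all `q` and `c`. -/
theorem IsHaarState.apply_mul_mul_eq_zero (hh : G.IsHaarState h) {a : Q}
    (ha : h (star a * a) = 0) (q c : Q) : h (q * a * c) = 0 := by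
  -- The aim is h(qac) = 0 with q moved to one argument of an inner product. The value below is
  -- bounded by the h ⊗ h length of Δ(a)(x ⊗ 1), which is zero since it involves only h(a*a).
  have key : ∀ s d b, h (sliceLeft h (MinTensor.tmul (q * a) 1 * G.Δ b) *
      sliceLeft h (MinTensor.tmul s 1 * G.Δ d)) = 0 := fun s d b => by
    set e := sliceLeft h (MinTensor.tmul s 1 * G.Δ d) with he
    let r : Q →ₗ[ℂ] Q :=
      { toFun := fun c => sliceRight h (MinTensor.tmul 1 c * G.Δ d)
        map_add' := fun c c' => by
          rw [← leg₂_apply, map_add, add_mul, map_add]; rfl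
        map_smul' := fun z c => by
          rw [← leg₂_apply, map_smul, smul_mul_assoc, map_smul]; rfl }
    let w : Q ⊗[ℂ] Q →ₗ[ℂ] Q ⊗[ℂ] Q := TensorProduct.map (LinearMap.mulLeft ℂ a) r
    -- The map `w` multiplies the first leg by `a` and applies `r` to the second; under the isometry
    -- left multiplication by `a` becomes left multiplication by Δ(a).
    have h1 : ∀ t, G.mulUnitary (w t) = G.Δ a * G.sliceMulΔ h d (MinTensor.of Q Q t) := fun t => by
      induction t with
      | zero => simp only [map_zero, mul_zero]
      | add s t hs ht => simp only [map_add, mul_add, hs, ht]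
      | tmul b c =>
        change G.Δ (a * b) * MinTensor.tmul 1 (r c) =
          G.Δ a * G.sliceMulΔ h d (MinTensor.tmul b c)
        rw [sliceMulΔ_tmul, map_mul, mul_assoc]
        rfl
    have h2 : ∀ t, ⟪pairVec h h (MinTensor.tmul (star q) (star s)),
        pairVec h h (MinTensor.of Q Q (w t))⟫_ℂ =
        h (sliceLeft h (MinTensor.tmul (q * a) 1 * MinTensor.of Q Q t) * e) := fun t => by
      induction t with
      | zero => simp only [map_zero, mul_zero, zero_mul, inner_zero_right]
      | add s t hs ht => simp only [map_add, mul_add, add_mul, inner_add_right, hs, ht]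
      | tmul b c =>
        change ⟪_, pairVec h h (MinTensor.tmul (a * b) (r c))⟫_ℂ =
          h (sliceLeft h (MinTensor.tmul (q * a) 1 * MinTensor.tmul b c) * e)
        -- Both are (h ⊗ h)((s ⊗ c)Δ(d)), sliced in the two possible orders.
        have h3 : h (s * r c) = h (c * e) := by
          change h (s * sliceRight h (MinTensor.tmul 1 c * G.Δ d)) = _
          rw [← sliceRight_mul_left, slice_comm, he, ← sliceLeft_mul_left, ← mul_assoc,
            ← mul_assoc, MinTensor.tmul_mul_tmul, MinTensor.tmul_mul_tmul, one_mul, one_mul,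
            mul_one, mul_one]
        rw [inner_pairVec, MinTensor.star_tmul, star_star, star_star, MinTensor.tmul_mul_tmul,
          MinTensor.tmul_mul_tmul, slice_comm, sliceLeft_tmul, sliceLeft_tmul, map_smul, h3,
          one_mul, smul_mul_assoc, map_smul, mul_assoc]
    set M := ‖pairVec h h (MinTensor.tmul (star q) (star s))‖ with hM
    -- Cauchy–Schwarz together with the isometry, for algebraic X. In this form both sides are
    -- continuous in X, although `r` and `w` are defined only on algebraic tensors; so X = Δ(b)
    -- becomes admissible.
    have h4 : ∀ X, ‖h (sliceLeft h (MinTensor.tmul (q * a) 1 * X) * e)‖ ≤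
        M * ‖pairVec h h (G.Δ a * G.sliceMulΔ h d X)‖ := fun X => by
      have hc : Continuous h := map_continuous h
      refine MinTensor.induction_of (p := fun X =>
        ‖h (sliceLeft h (MinTensor.tmul (q * a) 1 * X) * e)‖ ≤
        M * ‖pairVec h h (G.Δ a * G.sliceMulΔ h d X)‖) X
        (isClosed_le (by fun_prop) (by fun_prop)) fun t => ?_
      have h5 : ‖pairVec h h (MinTensor.of Q Q (w t))‖ =
          ‖pairVec h h (G.mulUnitary (w t))‖ := by
        rw [@norm_eq_sqrt_re_inner ℂ, @norm_eq_sqrt_re_inner ℂ, inner_pairVec_mulUnitary hh]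
      rw [← h1, ← h2, ← h5]
      exact norm_inner_le_norm _ _
    have h6 := h4 (G.Δ b)
    set x := sliceRight h (G.Δ b * MinTensor.tmul 1 d) with hx
    -- Right invariance gives (h ⊗ h)((x* ⊗ 1)Δ(a*a)(x ⊗ 1)) = h(a*a)h(x*x).
    have h7 : pairVec h h (G.Δ a * MinTensor.tmul x 1) = 0 := by
      rw [pairVec_eq_zero_iff, star_mul, MinTensor.star_tmul, star_one, ← map_star G.Δ, mul_assoc,
        ← mul_assoc (G.Δ _), ← map_mul, sliceRight_mul_left, sliceRight_mul_right, hh.right, ha,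
        zero_smul, zero_mul, mul_zero, map_zero]
    rwa [sliceMulΔ_Δ hh, h7, norm_zero, mul_zero, norm_le_zero_iff] at h6
  -- Density removes the special form of the right factor: (h ⊗ id)(1 ⊗ e) = e because h(1) = 1.
  have key2 : ∀ b e, h (sliceLeft h (MinTensor.tmul (q * a) 1 * G.Δ b) * e) = 0 := fun b e => by
    have h1 : (funL h ∘L ContinuousLinearMap.mul ℂ Q (sliceLeft h
        (MinTensor.tmul (q * a) 1 * G.Δ b))) ∘L sliceLeft h = 0 :=
      G.ext_left fun s d => key s d b
    have h2 := DFunLike.congr_fun h1 (MinTensor.tmul 1 e)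
    simpa [sliceLeft_tmul, hh.map_one] using h2
  -- The other density axiom: (h ⊗ h)((qa ⊗ 1)Y) vanishes on the span of Δ(b)(1 ⊗ e), hence at Y = c
  -- ⊗ 1, where it is h(qac).
  have h1 : funL h ∘L sliceRight h ∘L ContinuousLinearMap.mul ℂ _ (MinTensor.tmul (q * a) 1) = 0 :=
    G.ext_right' fun b e => by
      change h (sliceRight h (MinTensor.tmul (q * a) 1 * (G.Δ b * MinTensor.tmul 1 e))) = 0
      rw [slice_comm, ← mul_assoc, sliceLeft_mul_right, key2]
  have h2 := DFunLike.congr_fun h1 (MinTensor.tmul c 1)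
  simpa [MinTensor.tmul_mul_tmul, sliceRight_tmul, hh.map_one] using h2

/-- The Haar state is faithful on the reduced algebra. -/
theorem IsHaarState.reducedHom_eq_zero (hh : G.IsHaarState h) {a : Q}
    (ha : h (star a * a) = 0) : reducedHom h a = 0 :=
  Subtype.ext <| gns_eq_zero fun c => by
    rw [← mul_assoc]
    exact hh.apply_mul_mul_eq_zero ha _ _

end CompactQuantumGroup

end HaarKernel

/-! ### Faithful functionals -/

section Faithful

/-- A separable C*-algebra has a faithful positive functional. -/
theorem exists_isFaithful (C : Type u) [CStarAlgebra C] [PartialOrder C] [StarOrderedRing C]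
    [TopologicalSpace.SeparableSpace C] : ∃ ψ : C →ₚ[ℂ] ℂ, IsFaithful ψ := by
  let x := TopologicalSpace.denseSeq C
  -- Where the dense sequence hits 0 there is nothing to detect, and φ = 0 serves; this also covers
  -- the zero algebra, which has no states.
  have hex : ∀ n, ∃ φ : C →ₚ[ℂ] ℂ, ‖cyclic φ‖ ^ 2 ≤ 1 ∧
      ‖x n‖ ^ 2 / 2 ≤ ‖φ (star (x n) * x n)‖ := fun n => by
    by_cases hx : x n = 0
    · refine ⟨0, ?_, ?_⟩
      · have h0 := norm_cyclic_sq (0 : C →ₚ[ℂ] ℂ)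
        rw [PositiveLinearMap.zero_apply] at h0
        rw [Complex.ofReal_eq_zero.1 h0]
        exact zero_le_one
      · rw [hx]; simp
    · obtain ⟨φ, h1, h2⟩ := exists_state (x n) hx
      exact ⟨φ, (norm_cyclic_of_state h1).le, h2⟩
  choose φ hφ1 hφ2 using hex
  let f : ℕ → C →L[ℂ] ℂ := fun n => ((1 / 2 : ℝ) ^ n : ℂ) • funL (φ n)
  have hf : Summable f := by
    refine Summable.of_norm_bounded (g := fun n : ℕ => (1 / 2 : ℝ) ^ n) summable_geometric_two
      fun n => ?_
    rw [norm_smul, norm_pow, Complex.norm_real, Real.norm_of_nonneg (by norm_num)]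
    refine mul_le_of_le_one_right (by positivity) ?_
    refine ContinuousLinearMap.opNorm_le_bound _ zero_le_one fun a => ?_
    exact (norm_apply_le_cyclic (φ n) a).trans
      (mul_le_mul_of_nonneg_right (hφ1 n) (norm_nonneg a))
  have hsum : ∀ a, HasSum (fun n => ((1 / 2 : ℝ) ^ n : ℂ) * φ n a) ((∑' n, f n) a) := fun a =>
    hf.hasSum.mapL (ContinuousLinearMap.apply ℂ ℂ a)
  have hnn : ∀ a : C, 0 ≤ a → ∀ n, 0 ≤ ((1 / 2 : ℝ) ^ n : ℂ) * φ n a := fun a ha n =>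
    mul_nonneg (by rw [← Complex.ofReal_pow]; exact Complex.zero_le_real.2 (by positivity))
      ((φ n).map_nonneg ha)
  refine ⟨PositiveLinearMap.mk₀ (∑' n, f n).toLinearMap fun a ha => (hsum a).nonneg (hnn a ha),
    fun y hy => ?_⟩
  have h0 : (∑' n, f n) (star y * y) = 0 := hy
  have h1 := hsum (star y * y)
  rw [h0, hasSum_zero_iff_of_nonneg (hnn _ (star_mul_self_nonneg y))] at h1
  have h2 : ∀ n, φ n (star y * y) = 0 := fun n =>
    (mul_eq_zero.1 (congrFun h1 n)).resolve_left (pow_ne_zero _ (by norm_num))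
  by_contra hne
  have hy0 : 0 < ‖y‖ := norm_pos_iff.2 hne
  -- Within ‖y‖/4 of y one has ‖x n‖ ≥ 3‖y‖/4, so φ n is at least 9‖y‖²/32 at x_n* x_n. As y is null
  -- for φ n, that value is also at most ‖x n − y‖² < ‖y‖²/16, a contradiction.
  obtain ⟨n, hn⟩ := (TopologicalSpace.denseRange_denseSeq C).exists_dist_lt y
    (show 0 < ‖y‖ / 4 by positivity)
  change dist y (x n) < _ at hn
  rw [dist_comm, dist_eq_norm] at hn
  have h3 : (φ n).gnsStarAlgHom y (cyclic (φ n)) = 0 := by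
    rw [← inner_self_eq_zero (𝕜 := ℂ), inner_gns_cyclic, h2]
  have h4 : ‖φ n (star (x n) * x n)‖ ≤ ‖x n - y‖ ^ 2 := by
    rw [← inner_gns_cyclic, inner_self_eq_norm_sq_to_K, norm_pow, RCLike.norm_ofReal, abs_norm]
    have h5 : (φ n).gnsStarAlgHom (x n) (cyclic (φ n)) =
        (φ n).gnsStarAlgHom (x n - y) (cyclic (φ n)) := by
      rw [map_sub, sub_apply, h3, sub_zero]
    have h6 := ((φ n).gnsStarAlgHom (x n - y)).le_of_opNorm_le
      (NonUnitalStarAlgHom.norm_apply_le (φ n).gnsStarAlgHom (x n - y)) (cyclic (φ n))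
    rw [h5]
    refine (pow_le_pow_left₀ (norm_nonneg _) h6 2).trans ?_
    rw [mul_pow]
    exact mul_le_of_le_one_right (by positivity) (hφ1 n)
  have h7 := hφ2 n
  have h8 : ‖y‖ ≤ ‖x n‖ + ‖x n - y‖ := by
    rw [← norm_neg (x n - y), neg_sub, add_comm]
    simpa using norm_add_le (y - x n) (x n)
  nlinarith [norm_nonneg (x n - y)]

variable {Q C : Type u} [CStarAlgebra Q] [PartialOrder Q] [StarOrderedRing Q] [CStarAlgebra C]
  [PartialOrder C] [StarOrderedRing C] {G : CompactQuantumGroup Q}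

/-- The functional `(ψ ⊗ h) α` on `C`. -/
def Action.average (act : Action G C) (ψ : C →ₚ[ℂ] ℂ) (h : Q →ₚ[ℂ] ℂ) : C →ₚ[ℂ] ℂ :=
  PositiveLinearMap.mk₀ (funL ψ ∘L sliceRight h ∘L homL act.α).toLinearMap fun x hx => by
    obtain ⟨y, rfl⟩ := CStarAlgebra.nonneg_iff_eq_star_mul_self.1 hx
    change 0 ≤ ψ (sliceRight h (act.α (star y * y)))
    rw [map_mul, map_star]
    exact slice_star_mul_self_nonneg ψ h _

theorem Action.average_apply (act : Action G C) (ψ : C →ₚ[ℂ] ℂ) (h : Q →ₚ[ℂ] ℂ) (x : C) :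
    act.average ψ h x = ψ (sliceRight h (act.α x)) := rfl

/-- Tested against τ, coassociativity of the action turns the claim into left invariance of `h` at
(ψ ⊗ id)α(x). -/
theorem Action.isInvariant_average (act : Action G C) (ψ : C →ₚ[ℂ] ℂ) {h : Q →ₚ[ℂ] ℂ}
    (hh : G.IsHaarState h) : act.IsInvariant (act.average ψ h) := fun x =>
  eq_of_positive fun τ => by
    have h1 := (act.coassoc x).slice ψ τ
    rw [sliceRight_map, sliceLeft_map] at h1
    rw [← slice_comm, act.average_apply, slice_comm, h1, slice_comm, hh.left, map_smul, map_smul,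
      act.average_apply, slice_comm]

/-- If the reduced action is injective, averaging over the Haar state preserves faithfulness. -/
theorem Action.isFaithful_average (act : Action G C) {ψ : C →ₚ[ℂ] ℂ} (hψ : IsFaithful ψ)
    {h : Q →ₚ[ℂ] ℂ} (hh : G.IsHaarState h) (hinj : Function.Injective (act.reduced h)) :
    IsFaithful (act.average ψ h) := fun x hx => by
  rw [act.average_apply, map_mul, map_star] at hx
  let _ := CStarAlgebra.spectralOrder (reducedAlgebra h)
  have _ := CStarAlgebra.spectralOrderedRing (reducedAlgebra h)
  -- For a = (ψ ⊗ id)((s ⊗ 1)α(x)), h(a*a) is (ψ ⊗ h)(Yα(x)) for some Y, which vanishes by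
  -- Cauchy–Schwarz. As the left kernel of `h` is the kernel of π_r, the slice of the reduced action
  -- vanishes.
  have h1 : ∀ s, sliceLeft ψ (MinTensor.tmul s 1 * act.reduced h x) = 0 := fun s => by
    have h2 : MinTensor.tmul s 1 * act.reduced h x = MinTensor.map (StarAlgHom.id ℂ C)
        (reducedHom h) (MinTensor.tmul s 1 * act.α x) := by
      rw [map_mul, MinTensor.map_tmul, map_one]; rfl
    rw [h2, sliceLeft_map]
    refine hh.reducedHom_eq_zero ?_
    rw [← sliceLeft_mul_left, ← mul_assoc, ← slice_comm]
    exact slice_star_mul_eq_zero hx _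
  refine hinj ?_
  rw [map_zero]
  refine eq_of_sliceRight fun τ => ?_
  rw [map_zero]
  -- For z = (id ⊗ τ)α_r(x), taking s = z* in `h1` yields ψ(z*z) = 0.
  refine hψ _ ?_
  rw [← sliceRight_mul_left, slice_comm, h1, map_zero]

end Faithful

/-! ### Implemented actions have injective reductions -/

section Implemented

variable {H A B : Type u} [NormedAddCommGroup H] [InnerProductSpace ℂ H] [CStarAlgebra A]
  [CStarAlgebra B]

theorem HilbMod.ext_tmul {E : Type*} [NormedAddCommGroup E] [NormedSpace ℂ E]
    {f g : HilbMod H A →L[ℂ] E} (h : ∀ x a, f (HilbMod.tmul x a) = g (HilbMod.tmul x a)) :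
    f = g :=
  HilbMod.ext_of fun t => by
    induction t with
    | zero => simp only [map_zero]
    | add s t hs ht => simp only [map_add, hs, ht]
    | tmul x a => exact h x a

theorem HilbMod.map_tmul (g : A →⋆ₐ[ℂ] B) (x : H) (a : A) :
    HilbMod.map H g (HilbMod.tmul x a) = HilbMod.tmul x (g a) := HilbMod.map_of g _

theorem HilbMod.inner_tmul (x y : H) (a b : A) :
    HilbMod.inner H A (HilbMod.tmul x a) (HilbMod.tmul y b) = ⟪x, y⟫_ℂ • (star a * b) :=
  HilbMod.inner_of _ _

theorem map_act [CompleteSpace H] (g : A →⋆ₐ[ℂ] B) (T : MinTensor (H →L[ℂ] H) A)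
    (ζ : HilbMod H A) :
    HilbMod.map H g (act H A T ζ) =
      act H B (MinTensor.map (StarAlgHom.id ℂ _) g T) (HilbMod.map H g ζ) := by
  have h : (ContinuousLinearMap.compL ℂ _ _ _ (HilbMod.map H g)) ∘L act H A =
      ((ContinuousLinearMap.compL ℂ _ _ _).flip (HilbMod.map H g)) ∘L act H B ∘L
        homL (MinTensor.map (StarAlgHom.id ℂ _) g) :=
    MinTensor.ext_tmul fun S a => HilbMod.ext_tmul fun x b => by
      change HilbMod.map H g (act H A (MinTensor.tmul S a) (HilbMod.tmul x b)) =
        act H B (MinTensor.map (StarAlgHom.id ℂ _) g (MinTensor.tmul S a))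
          (HilbMod.map H g (HilbMod.tmul x b))
      rw [act_tmul, HilbMod.map_tmul, HilbMod.map_tmul, MinTensor.map_tmul, act_tmul, map_mul]
      rfl
  exact DFunLike.congr_fun (DFunLike.congr_fun h T) ζ

theorem MinTensor.map_map_comm {A' B' : Type u} [CStarAlgebra A'] [CStarAlgebra B']
    (f : A →⋆ₐ[ℂ] A') (g : B →⋆ₐ[ℂ] B') (X : MinTensor A B) :
    MinTensor.map (StarAlgHom.id ℂ A') g (MinTensor.map f (StarAlgHom.id ℂ B) X) =
      MinTensor.map f (StarAlgHom.id ℂ B') (MinTensor.map (StarAlgHom.id ℂ A) g X) := by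
  refine DFunLike.congr_fun (MinTensor.ext_tmul
    (f := homL (MinTensor.map (StarAlgHom.id ℂ A') g) ∘L
      homL (MinTensor.map f (StarAlgHom.id ℂ B)))
    (g := homL (MinTensor.map f (StarAlgHom.id ℂ B')) ∘L
      homL (MinTensor.map (StarAlgHom.id ℂ A) g)) fun a b => ?_) X
  simp [MinTensor.map_tmul]

/-- The vector U(Sξ ⊗ 1) = T U(ξ ⊗ 1) is killed by id ⊗ g. Its inner square is ‖Sξ‖² 1, which the
unital map g sends to ‖Sξ‖² 1, so Sξ = 0. -/
theorem map_eq_zero_of_covariant [CompleteSpace H] (u : ModUnitary H A) (S : H →L[ℂ] H)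
    (T : MinTensor (H →L[ℂ] H) A) (hu : u.U ∘L act H A (MinTensor.tmul S 1) ∘L u.adj = act H A T)
    (g : A →⋆ₐ[ℂ] B) (hT : MinTensor.map (StarAlgHom.id ℂ _) g T = 0) (hne : (1 : B) ≠ 0) :
    S = 0 := by
  ext ξ
  have hU : ∀ ζ, u.adj (u.U ζ) = ζ := fun ζ => DFunLike.congr_fun u.adj_comp ζ
  have e1 : u.U (act H A (MinTensor.tmul S 1) (u.adj (u.U (HilbMod.tmul ξ 1)))) =
      act H A T (u.U (HilbMod.tmul ξ 1)) := DFunLike.congr_fun hu (u.U (HilbMod.tmul ξ 1))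
  rw [hU, act_tmul, one_mul] at e1
  have e2 := map_act g T (u.U (HilbMod.tmul ξ 1))
  rw [hT, map_zero, zero_apply, ← e1] at e2
  have e3 := HilbMod.inner_map g (u.U (HilbMod.tmul (S ξ) 1)) (u.U (HilbMod.tmul (S ξ) 1))
  rw [e2, map_zero, u.inner_adj, hU, HilbMod.inner_tmul, star_one, one_mul, map_smul,
    map_one] at e3
  exact inner_self_eq_zero.1 ((smul_eq_zero.1 e3.symm).resolve_right hne)

theorem reducedAlgebra_one_ne_zero [PartialOrder A] [StarOrderedRing A] {h : A →ₚ[ℂ] ℂ}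
    (h1 : h 1 = 1) : (1 : reducedAlgebra h) ≠ 0 := fun h0 => by
  have h2 := inner_cyclic h 1
  have h3 : h.gnsStarAlgHom 1 = 0 := (map_one _).trans (congrArg Subtype.val h0)
  rw [h3, zero_apply, inner_zero_right, h1] at h2
  exact zero_ne_one h2

theorem Action.IsImplemented.injective_reduced {Q C : Type u} [CStarAlgebra Q] [PartialOrder Q]
    [StarOrderedRing Q] [CStarAlgebra C] {G : CompactQuantumGroup Q} {α : Action G C}
    (hα : α.IsImplemented) {h : Q →ₚ[ℂ] ℂ} (h1 : h 1 = 1) :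
    Function.Injective (α.reduced h) := by
  obtain ⟨H, _, _, _, u, π, hπ, hu⟩ := hα
  rw [injective_iff_map_eq_zero]
  intro x hx
  refine (injective_iff_map_eq_zero π).1 hπ x ?_
  refine map_eq_zero_of_covariant u.toModUnitary (π x) _ (hu x) (reducedHom h) ?_
    (reducedAlgebra_one_ne_zero h1)
  have hx' : MinTensor.map (StarAlgHom.id ℂ C) (reducedHom h) (α.α x) = 0 := hx
  rw [MinTensor.map_map_comm, hx', map_zero]

end Implemented

/-! ### Unitaries from isometries `H → H ⊗ Q` -/

section IsometryExtension

variable {H A : Type u} [NormedAddCommGroup H] [InnerProductSpace ℂ H] [CStarAlgebra A]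

theorem HilbMod.mulRight_tmul (x : H) (a b : A) :
    HilbMod.mulRight b (HilbMod.tmul x a) = HilbMod.tmul x (a * b) := HilbMod.mulRight_of _ _

theorem HilbMod.mulRight_one (x : HilbMod H A) : HilbMod.mulRight 1 x = x := by
  refine DFunLike.congr_fun (HilbMod.ext_tmul (f := HilbMod.mulRight (H := H) (1 : A))
    (g := ContinuousLinearMap.id ℂ _) fun x a => ?_) x
  rw [HilbMod.mulRight_tmul, mul_one]; rfl

/-- Vectors of a Hilbert module with the same inner products against all `κ ⊗ 1` are equal. -/
theorem HilbMod.eq_of_inner {ζ ζ' : HilbMod H A}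
    (h : ∀ κ : H, HilbMod.inner H A (HilbMod.tmul κ 1) ζ =
      HilbMod.inner H A (HilbMod.tmul κ 1) ζ') : ζ = ζ' := by
  have h1 : ∀ t, HilbMod.inner H A (HilbMod.of H A t) (ζ - ζ') = 0 := fun t => by
    induction t with
    | zero => rw [map_zero, map_zero, zero_apply]
    | add s t hs ht => rw [map_add, map_add, add_apply, hs, ht, add_zero]
    | tmul κ a =>
      have h2 : HilbMod.of H A (κ ⊗ₜ a) = HilbMod.mulRight a (HilbMod.tmul κ 1) := by
        rw [HilbMod.mulRight_tmul, one_mul]; rfl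
      have h3 := HilbMod.inner_mulRight (HilbMod.tmul κ (1 : A)) (ζ - ζ') a 1
      rw [HilbMod.mulRight_one, map_sub (HilbMod.inner H A (HilbMod.tmul κ 1)), h, sub_self,
        mul_zero, zero_mul] at h3
      rw [h2, h3]
  have h2 : HilbMod.inner H A (ζ - ζ') (ζ - ζ') = 0 :=
    HilbMod.induction_of (p := fun x => HilbMod.inner H A x (ζ - ζ') = 0) (ζ - ζ')
      (isClosed_eq (by fun_prop) (by fun_prop)) h1
  have h3 := HilbMod.norm_sq (ζ - ζ')
  rw [h2, norm_zero] at h3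
  exact sub_eq_zero.1 (norm_eq_zero.1 (pow_eq_zero_iff two_ne_zero |>.1 h3))

variable (V : H →L[ℂ] HilbMod H A)

/-- The algebraic map `h ⊗ a ↦ (V h) a`. -/
def extendAlg : H ⊗[ℂ] A →ₗ[ℂ] HilbMod H A :=
  TensorProduct.lift (LinearMap.mk₂ ℂ (fun h a => HilbMod.mulRight a (V h))
    (fun h h' a => by rw [map_add, map_add])
    (fun c h a => by rw [map_smul, map_smul])
    (fun h a a' => HilbMod.mulRight_add _ _ _)
    (fun c h a => HilbMod.mulRight_smul _ _ _))

theorem extendAlg_tmul (h : H) (a : A) :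
    extendAlg V (h ⊗ₜ a) = HilbMod.mulRight a (V h) := rfl

variable {V}

theorem inner_extendAlg
    (hV : ∀ ξ η, HilbMod.inner H A (V ξ) (V η) = ⟪ξ, η⟫_ℂ • (1 : A)) (s t : H ⊗[ℂ] A) :
    HilbMod.inner H A (extendAlg V s) (extendAlg V t) = algInner H A s t := by
  induction s with
  | zero => rw [map_zero, map_zero, map_zero, zero_apply, LinearMap.zero_apply]
  | add s s' hs hs' =>
    rw [map_add, map_add, map_add, add_apply, LinearMap.add_apply, hs, hs']
  | tmul h a =>
    induction t with
    | zero => simp only [map_zero]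
    | add t t' ht ht' => simp only [map_add, ht, ht']
    | tmul k b =>
      rw [extendAlg_tmul, extendAlg_tmul, HilbMod.inner_mulRight, hV, algInner_tmul,
        mul_smul_comm, mul_one, smul_mul_assoc]

variable (hV : ∀ ξ η, HilbMod.inner H A (V ξ) (V η) = ⟪ξ, η⟫_ℂ • (1 : A))

/-- The continuous extension `h ⊗ a ↦ (V h) a` of an isometry `V`. -/
def extendL : HilbMod H A →L[ℂ] HilbMod H A :=
  HilbMod.liftL (extendAlg V) 1 fun t => by
    rw [one_mul]
    refine le_of_sq_le_sq ?_ (modNorm_nonneg t)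
    rw [HilbMod.norm_sq, inner_extendAlg hV, modNorm_sq]

theorem extendL_of (t : H ⊗[ℂ] A) : extendL hV (HilbMod.of H A t) = extendAlg V t :=
  HilbMod.liftL_of _ _ _ t

theorem extendL_tmul (h : H) (a : A) :
    extendL hV (HilbMod.tmul h a) = HilbMod.mulRight a (V h) := extendL_of hV _

theorem inner_extendL (x y : HilbMod H A) :
    HilbMod.inner H A (extendL hV x) (extendL hV y) = HilbMod.inner H A x y := by
  refine HilbMod.induction_of (p := fun x =>
    HilbMod.inner H A (extendL hV x) (extendL hV y) = HilbMod.inner H A x y) x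
    (isClosed_eq (by fun_prop) (by fun_prop)) fun s => ?_
  refine HilbMod.induction_of (p := fun y => HilbMod.inner H A (extendL hV (HilbMod.of H A s))
    (extendL hV y) = HilbMod.inner H A (HilbMod.of H A s) y) y
    (isClosed_eq (by fun_prop) (by fun_prop)) fun t => ?_
  rw [extendL_of, extendL_of, inner_extendAlg hV, HilbMod.inner_of]

theorem norm_extendL (x : HilbMod H A) : ‖extendL hV x‖ = ‖x‖ := by
  rw [← sq_eq_sq₀ (norm_nonneg _) (norm_nonneg _), HilbMod.norm_sq, HilbMod.norm_sq,
    inner_extendL]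

/-- The extension of an isometry, as a linear isometric equivalence if its range is dense. -/
def extendEquiv (hd : DenseRange (extendL hV)) : HilbMod H A ≃ₗᵢ[ℂ] HilbMod H A :=
  LinearIsometryEquiv.ofSurjective
    { toLinearMap := (extendL hV).toLinearMap, norm_map' := norm_extendL hV } <| by
    -- The range of an isometry of a complete space is closed, so a dense range is everything.
    have hi : Isometry (extendL hV) :=
      AddMonoidHomClass.isometry_of_norm (extendL hV) (norm_extendL hV)
    exact Set.range_eq_univ.1 (hi.isClosedEmbedding.isClosed_range.closure_eq.symm.trans
      hd.closure_range)

/-- The unitary extending an isometry. -/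
def extendUnitary (hd : DenseRange (extendL hV)) : ModUnitary H A where
  U := extendL hV
  adj := (extendEquiv hV hd).symm.toContinuousLinearEquiv.toContinuousLinearMap
  inner_adj x y := by
    have h : y = extendL hV ((extendEquiv hV hd).symm y) :=
      ((extendEquiv hV hd).apply_symm_apply y).symm
    conv_lhs => rw [h, inner_extendL]
    rfl
  adj_comp := ContinuousLinearMap.ext fun x => (extendEquiv hV hd).symm_apply_apply x
  comp_adj := ContinuousLinearMap.ext fun x => (extendEquiv hV hd).apply_symm_apply x

theorem extendUnitary_V (hd : DenseRange (extendL hV)) (ξ : H) :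
    (extendUnitary hV hd).V ξ = V ξ := by
  refine (extendL_tmul hV ξ 1).trans ?_
  rw [HilbMod.mulRight_one]

end IsometryExtension

/-! ### The GNS representation of an invariant functional -/

section GNSTensor

variable {C A B : Type u} [CStarAlgebra C] [PartialOrder C] [StarOrderedRing C] [CStarAlgebra A]
  [CStarAlgebra B] (φ : C →ₚ[ℂ] ℂ)

variable (A) in
/-- The map `C ⊗ A → L²(C, φ) ⊗ A`, `c ⊗ a ↦ π_φ(c) Ω ⊗ a`. -/
def gnsTensor : MinTensor C A →L[ℂ] HilbMod φ.GNS A :=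
  (ContinuousLinearMap.apply ℂ _ (HilbMod.tmul (cyclic φ) (1 : A))) ∘L act φ.GNS A ∘L
    homL (MinTensor.map φ.gnsStarAlgHom (StarAlgHom.id ℂ A))

theorem gnsTensor_tmul (c : C) (a : A) :
    gnsTensor A φ (MinTensor.tmul c a) = HilbMod.tmul (φ.gnsStarAlgHom c (cyclic φ)) a := by
  change act φ.GNS A (MinTensor.map φ.gnsStarAlgHom (StarAlgHom.id ℂ A) (MinTensor.tmul c a))
    (HilbMod.tmul (cyclic φ) (1 : A)) = _
  rw [MinTensor.map_tmul, act_tmul, mul_one]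
  rfl

theorem inner_gnsTensor (X Y : MinTensor C A) :
    HilbMod.inner φ.GNS A (gnsTensor A φ X) (gnsTensor A φ Y) = sliceLeft φ (star X * Y) := by
  refine MinTensor.induction_of (p := fun X => HilbMod.inner φ.GNS A (gnsTensor A φ X)
    (gnsTensor A φ Y) = sliceLeft φ (star X * Y)) X
    (isClosed_eq (by fun_prop) (by fun_prop)) fun s => ?_
  induction s with
  | zero => simp only [map_zero, star_zero, zero_mul, zero_apply]
  | add s s' hs hs' => simp only [map_add, star_add, add_mul, add_apply, hs, hs']
  | tmul c a =>
    change HilbMod.inner φ.GNS A (gnsTensor A φ (MinTensor.tmul c a)) (gnsTensor A φ Y) =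
      sliceLeft φ (star (MinTensor.tmul c a) * Y)
    refine DFunLike.congr_fun (MinTensor.ext_tmul
      (f := HilbMod.inner φ.GNS A (gnsTensor A φ (MinTensor.tmul c a)) ∘L gnsTensor A φ)
      (g := sliceLeft φ ∘L ContinuousLinearMap.mul ℂ _ (star (MinTensor.tmul c a)))
      fun c' a' => ?_) Y
    change HilbMod.inner φ.GNS A (gnsTensor A φ (MinTensor.tmul c a))
      (gnsTensor A φ (MinTensor.tmul c' a')) =
      sliceLeft φ (star (MinTensor.tmul c a) * MinTensor.tmul c' a')
    rw [gnsTensor_tmul, gnsTensor_tmul, HilbMod.inner_tmul, inner_gns_cyclic,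
      MinTensor.star_tmul, MinTensor.tmul_mul_tmul, sliceLeft_tmul]

theorem mulRight_gnsTensor (a : A) (X : MinTensor C A) :
    HilbMod.mulRight a (gnsTensor A φ X) = gnsTensor A φ (X * MinTensor.tmul 1 a) := by
  refine DFunLike.congr_fun (MinTensor.ext_tmul (f := HilbMod.mulRight a ∘L gnsTensor A φ)
    (g := gnsTensor A φ ∘L (ContinuousLinearMap.mul ℂ _).flip (MinTensor.tmul 1 a))
    fun c b => ?_) X
  change HilbMod.mulRight a (gnsTensor A φ (MinTensor.tmul c b)) =
    gnsTensor A φ (MinTensor.tmul c b * MinTensor.tmul 1 a)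
  rw [gnsTensor_tmul, HilbMod.mulRight_tmul, MinTensor.tmul_mul_tmul, gnsTensor_tmul, mul_one]

/-- The operators (π_φ ⊗ id)(Y) act by left multiplication, so covariance reduces to
multiplicativity of α. -/
theorem act_gnsTensor (Y X : MinTensor C A) :
    act φ.GNS A (MinTensor.map φ.gnsStarAlgHom (StarAlgHom.id ℂ A) Y) (gnsTensor A φ X) =
      gnsTensor A φ (Y * X) := by
  refine DFunLike.congr_fun (MinTensor.ext_tmul
    (f := (ContinuousLinearMap.apply ℂ _ (gnsTensor A φ X)) ∘L act φ.GNS A ∘L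
      homL (MinTensor.map φ.gnsStarAlgHom (StarAlgHom.id ℂ A)))
    (g := gnsTensor A φ ∘L (ContinuousLinearMap.mul ℂ _).flip X) fun c a => ?_) Y
  change act φ.GNS A (MinTensor.map φ.gnsStarAlgHom (StarAlgHom.id ℂ A) (MinTensor.tmul c a))
    (gnsTensor A φ X) = gnsTensor A φ (MinTensor.tmul c a * X)
  refine DFunLike.congr_fun (MinTensor.ext_tmul
    (f := act φ.GNS A (MinTensor.map φ.gnsStarAlgHom (StarAlgHom.id ℂ A)
      (MinTensor.tmul c a)) ∘L gnsTensor A φ)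
    (g := gnsTensor A φ ∘L ContinuousLinearMap.mul ℂ _ (MinTensor.tmul c a)) fun c' b => ?_) X
  change act φ.GNS A (MinTensor.map φ.gnsStarAlgHom (StarAlgHom.id ℂ A) (MinTensor.tmul c a))
    (gnsTensor A φ (MinTensor.tmul c' b)) =
      gnsTensor A φ (MinTensor.tmul c a * MinTensor.tmul c' b)
  rw [gnsTensor_tmul, MinTensor.map_tmul, act_tmul, MinTensor.tmul_mul_tmul, gnsTensor_tmul,
    map_mul]
  rfl

end GNSTensor

/-! ### Density of the vectors cΩ ⊗ a in the GNS Hilbert module -/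

section GNSDensity

variable {C A B : Type u} [CStarAlgebra C] [PartialOrder C] [StarOrderedRing C] [CStarAlgebra A]
  [CStarAlgebra B] {φ : C →ₚ[ℂ] ℂ}

theorem HilbMod.continuous_tmul {H : Type u} [NormedAddCommGroup H] [InnerProductSpace ℂ H]
    (a : A) : Continuous fun x : H => HilbMod.tmul x a := by
  refine AddMonoidHomClass.continuous_of_bound
    (HilbMod.of H A ∘ₗ (TensorProduct.mk ℂ H A).flip a) ‖a‖ fun x => ?_
  change ‖HilbMod.tmul x a‖ ≤ _
  refine le_of_sq_le_sq ?_ (by positivity)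
  rw [HilbMod.norm_sq, HilbMod.inner_tmul, norm_smul, CStarRing.norm_star_mul_self,
    inner_self_eq_norm_sq_to_K, norm_pow, RCLike.norm_ofReal, abs_norm]
  exact le_of_eq (by ring)

theorem ext_gns {E : Type*} [NormedAddCommGroup E] [NormedSpace ℂ E]
    {f g : HilbMod φ.GNS A →L[ℂ] E}
    (h : ∀ c a, f (HilbMod.tmul (φ.gnsStarAlgHom c (cyclic φ)) a) =
      g (HilbMod.tmul (φ.gnsStarAlgHom c (cyclic φ)) a)) : f = g :=
  HilbMod.ext_tmul fun x a => gns_induction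
    (p := fun x => f (HilbMod.tmul x a) = g (HilbMod.tmul x a)) x
    (isClosed_eq (f.continuous.comp (HilbMod.continuous_tmul a))
      (g.continuous.comp (HilbMod.continuous_tmul a))) fun c => h c a

theorem eq_of_inner_gns {ζ ζ' : HilbMod φ.GNS A}
    (h : ∀ c, HilbMod.inner φ.GNS A (HilbMod.tmul (φ.gnsStarAlgHom c (cyclic φ)) 1) ζ =
      HilbMod.inner φ.GNS A (HilbMod.tmul (φ.gnsStarAlgHom c (cyclic φ)) 1) ζ') : ζ = ζ' :=
  HilbMod.eq_of_inner fun κ => by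
    have h1 := HilbMod.continuous_tmul (H := φ.GNS) (1 : A)
    exact gns_induction (p := fun κ => HilbMod.inner φ.GNS A (HilbMod.tmul κ 1) ζ =
      HilbMod.inner φ.GNS A (HilbMod.tmul κ 1) ζ') κ
      (isClosed_eq (by fun_prop) (by fun_prop)) h

theorem dense_of_gnsTensor {S : Submodule ℂ (HilbMod φ.GNS A)}
    (hS : ∀ X, gnsTensor A φ X ∈ S.topologicalClosure) : Dense (S : Set (HilbMod φ.GNS A)) := by
  have h1 : ∀ (x : φ.GNS) (a : A), HilbMod.tmul x a ∈ S.topologicalClosure := fun x a =>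
    gns_induction (p := fun x => HilbMod.tmul x a ∈ S.topologicalClosure) x
      (S.isClosed_topologicalClosure.preimage (HilbMod.continuous_tmul a)) fun c => by
        rw [← gnsTensor_tmul]; exact hS _
  intro ζ
  refine HilbMod.induction_of (p := fun ζ => ζ ∈ S.topologicalClosure) ζ
    S.isClosed_topologicalClosure fun t => ?_
  induction t with
  | zero => rw [map_zero]; exact zero_mem _
  | add s t hs ht => rw [map_add]; exact add_mem hs ht
  | tmul x a => exact h1 x a

end GNSDensity

/-! ### The unitary representation implementing the action -/

section Implementation

variable {Q C : Type u} [CStarAlgebra Q] [CStarAlgebra C] [PartialOrder C] [StarOrderedRing C]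
  {G : CompactQuantumGroup Q}

theorem inner_appendLeg {H : Type u} [NormedAddCommGroup H] [InnerProductSpace ℂ H] (κ : H)
    (e : HilbMod H Q) (q : Q) :
    HilbMod.inner H (MinTensor Q Q) (HilbMod.tmul κ 1) (appendLeg e q) =
      MinTensor.tmul (HilbMod.inner H Q (HilbMod.tmul κ 1) e) q := by
  have h1 : (HilbMod.tmul κ 1 : HilbMod H (MinTensor Q Q)) =
      HilbMod.mulRight 1 (HilbMod.map H (leg₁ Q) (HilbMod.tmul κ 1)) := by
    rw [HilbMod.mulRight_one, HilbMod.map_tmul, map_one]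
  rw [h1, appendLeg, HilbMod.inner_mulRight, HilbMod.inner_map, star_one, one_mul]
  change MinTensor.tmul _ 1 * MinTensor.tmul 1 q = _
  rw [MinTensor.tmul_mul_tmul, one_mul, mul_one]

theorem tensorId_tmul {H : Type u} [NormedAddCommGroup H] [InnerProductSpace ℂ H]
    (V : H →ₗ[ℂ] HilbMod H Q)
    (hV : ∀ ξ η, HilbMod.inner H Q (V ξ) (V η) = ⟪ξ, η⟫_ℂ • (1 : Q)) (x : H) (q : Q) :
    tensorId V hV (HilbMod.tmul x q) = appendLeg (V x) q :=
  HilbMod.liftL_of (algTensorId V) 1 _ (x ⊗ₜ q)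

namespace Action.IsInvariant

variable {α : Action G C} {φ : C →ₚ[ℂ] ℂ}

/-- The inner product is (φ ⊗ id)α(c*c'); invariance of φ makes it a scalar multiple of 1. -/
theorem inner_gnsTensor (hφ : α.IsInvariant φ) (c c' : C) :
    HilbMod.inner φ.GNS Q (gnsTensor Q φ (α.α c)) (gnsTensor Q φ (α.α c')) =
      φ (star c * c') • (1 : Q) := by
  rw [CQG.inner_gnsTensor, ← map_star, ← map_mul, hφ]

variable [Nontrivial Q]

/-- The isometry `π_φ(c) Ω ↦ (π_φ ⊗ id)(α c)(Ω ⊗ 1)`. -/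
def isometry (hφ : α.IsInvariant φ) : φ.GNS →L[ℂ] HilbMod φ.GNS Q :=
  ContinuousLinearMap.fromCompletion (LinearMap.mkContinuous
    ((gnsTensor Q φ).toLinearMap ∘ₗ α.α.toAlgHom.toLinearMap ∘ₗ φ.ofPreGNS.toLinearMap) 1
    fun x => by
      change ‖gnsTensor Q φ (α.α (φ.ofPreGNS x))‖ ≤ 1 * ‖x‖
      refine le_of_sq_le_sq ?_ (by positivity)
      rw [HilbMod.norm_sq, hφ.inner_gnsTensor, norm_smul, norm_one, mul_one, one_mul,
        ← φ.preGNS_norm_sq, norm_pow, Complex.norm_real, norm_norm])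

theorem isometry_apply (hφ : α.IsInvariant φ) (c : C) :
    hφ.isometry (φ.gnsStarAlgHom c (cyclic φ)) = gnsTensor Q φ (α.α c) := by
  rw [gns_apply_cyclic]
  exact ContinuousLinearMap.fromCompletion_apply_coe _ _

theorem inner_isometry (hφ : α.IsInvariant φ) (ξ η : φ.GNS) :
    HilbMod.inner φ.GNS Q (hφ.isometry ξ) (hφ.isometry η) = ⟪ξ, η⟫_ℂ • (1 : Q) := by
  refine gns_induction (p := fun ξ => HilbMod.inner φ.GNS Q (hφ.isometry ξ) (hφ.isometry η) =
    ⟪ξ, η⟫_ℂ • (1 : Q)) ξ (isClosed_eq (by fun_prop) (by fun_prop)) fun c => ?_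
  refine gns_induction (p := fun η => HilbMod.inner φ.GNS Q
    (hφ.isometry (φ.gnsStarAlgHom c (cyclic φ))) (hφ.isometry η) =
    ⟪φ.gnsStarAlgHom c (cyclic φ), η⟫_ℂ • (1 : Q)) η
    (isClosed_eq (by fun_prop) (by fun_prop)) fun c' => ?_
  rw [isometry_apply, isometry_apply, hφ.inner_gnsTensor, inner_gns_cyclic]

/-- The extension sends cΩ ⊗ q to α(c)(Ω ⊗ q), the image of α(c)(1 ⊗ q); by the density axiom of the
action these elements span a dense subspace of `MinTensor C Q`. -/
theorem denseRange_extendL (hφ : α.IsInvariant φ) : DenseRange (extendL hφ.inner_isometry) := by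
  let S := (extendL hφ.inner_isometry).toLinearMap.range
  have h1 : S.topologicalClosure.comap (gnsTensor Q φ).toLinearMap = ⊤ := by
    refine top_unique fun X _ => ?_
    have hc : IsClosed ((S.topologicalClosure.comap (gnsTensor Q φ).toLinearMap :
        Submodule ℂ (MinTensor C Q)) : Set (MinTensor C Q)) :=
      S.isClosed_topologicalClosure.preimage (gnsTensor Q φ).continuous
    refine closure_minimal (SetLike.coe_subset_coe.2 (Submodule.span_le.2 ?_)) hc (α.dense X)
    rintro _ ⟨c, q, rfl⟩
    refine S.le_topologicalClosure ⟨HilbMod.tmul (φ.gnsStarAlgHom c (cyclic φ)) q, ?_⟩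
    change extendL hφ.inner_isometry _ = gnsTensor Q φ _
    rw [extendL_tmul, isometry_apply, mulRight_gnsTensor]
  exact dense_of_gnsTensor (S := S) fun X => by
    have h2 : X ∈ S.topologicalClosure.comap (gnsTensor Q φ).toLinearMap := by
      rw [h1]; trivial
    exact h2

/-- Slicing the last leg commutes with V on the first, so (V ⊗ id) is expressed through α applied to
a slice. This is the form in which coassociativity is available. -/
theorem sliceRight_inner_tensorId [PartialOrder Q] [StarOrderedRing Q] (hφ : α.IsInvariant φ)
    (V : φ.GNS →ₗ[ℂ] HilbMod φ.GNS Q)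
    (hV : ∀ ξ η, HilbMod.inner φ.GNS Q (V ξ) (V η) = ⟪ξ, η⟫_ℂ • (1 : Q))
    (hVi : ∀ ξ, V ξ = hφ.isometry ξ) (τ : Q →ₚ[ℂ] ℂ) (κ : φ.GNS) (X : MinTensor C Q) :
    sliceRight τ (HilbMod.inner φ.GNS _ (HilbMod.tmul κ 1)
      (tensorId V hV (gnsTensor Q φ X))) =
    HilbMod.inner φ.GNS Q (HilbMod.tmul κ 1) (gnsTensor Q φ (α.α (sliceRight τ X))) := by
  refine DFunLike.congr_fun (MinTensor.ext_tmul
    (f := sliceRight τ ∘L HilbMod.inner φ.GNS _ (HilbMod.tmul κ 1) ∘L tensorId V hV ∘L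
      gnsTensor Q φ)
    (g := HilbMod.inner φ.GNS Q (HilbMod.tmul κ 1) ∘L gnsTensor Q φ ∘L homL α.α ∘L sliceRight τ)
    fun c q => ?_) X
  change sliceRight τ (HilbMod.inner φ.GNS _ (HilbMod.tmul κ 1)
      (tensorId V hV (gnsTensor Q φ (MinTensor.tmul c q)))) =
    HilbMod.inner φ.GNS Q (HilbMod.tmul κ 1)
      (gnsTensor Q φ (α.α (sliceRight τ (MinTensor.tmul c q))))
  rw [gnsTensor_tmul, tensorId_tmul, inner_appendLeg, sliceRight_tmul, sliceRight_tmul, map_smul,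
    map_smul, map_smul, hVi, isometry_apply]

/-- Tested against c'Ω ⊗ 1 and sliced by τ, the two sides are those of coassociativity multiplied by
c'* ⊗ 1 ⊗ 1 and sliced by φ and τ in the outer legs. -/
theorem tensorId_gnsTensor [PartialOrder Q] [StarOrderedRing Q] (hφ : α.IsInvariant φ)
    (V : φ.GNS →ₗ[ℂ] HilbMod φ.GNS Q)
    (hV : ∀ ξ η, HilbMod.inner φ.GNS Q (V ξ) (V η) = ⟪ξ, η⟫_ℂ • (1 : Q))
    (hVi : ∀ ξ, V ξ = hφ.isometry ξ) (c : C) :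
    tensorId V hV (gnsTensor Q φ (α.α c)) = HilbMod.map φ.GNS G.Δ (gnsTensor Q φ (α.α c)) := by
  refine eq_of_inner_gns fun c' => eq_of_sliceRight fun τ => ?_
  rw [hφ.sliceRight_inner_tensorId V hV hVi]
  have h1 : (HilbMod.tmul (φ.gnsStarAlgHom c' (cyclic φ)) 1 : HilbMod φ.GNS (MinTensor Q Q)) =
      HilbMod.map φ.GNS G.Δ (HilbMod.tmul (φ.gnsStarAlgHom c' (cyclic φ)) 1) := by
    rw [HilbMod.map_tmul, map_one]
  rw [h1, HilbMod.inner_map, ← gnsTensor_tmul, CQG.inner_gnsTensor, CQG.inner_gnsTensor,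
    MinTensor.star_tmul, star_one]
  have h2 := ((sameTriple_tmul (star c') (1 : Q) (1 : Q)).mul (α.coassoc c)).slice φ τ
  have h3 : (MinTensor.tmul (star c') (MinTensor.tmul 1 1) : MinTensor C (MinTensor Q Q)) =
      MinTensor.map (StarAlgHom.id ℂ C) G.Δ (MinTensor.tmul (star c') 1) := by
    rw [MinTensor.map_tmul, map_one, MinTensor.one_def]; rfl
  rw [h3, ← map_mul, sliceLeft_map, sliceRight_mul_left, sliceRight_map] at h2
  exact h2

/-- The unitary representation on the GNS space of an invariant functional. -/
def unitaryRep [PartialOrder Q] [StarOrderedRing Q] (hφ : α.IsInvariant φ) :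
    UnitaryRep φ.GNS G where
  toModUnitary := extendUnitary hφ.inner_isometry hφ.denseRange_extendL
  rep ξ := by
    set u := extendUnitary hφ.inner_isometry hφ.denseRange_extendL with hu
    have hVi : ∀ ξ, u.V ξ = hφ.isometry ξ := extendUnitary_V _ _
    rw [hVi]
    refine gns_induction (p := fun ξ => tensorId u.V u.inner_V (hφ.isometry ξ) =
      HilbMod.map φ.GNS G.Δ (hφ.isometry ξ)) ξ
      (isClosed_eq (by fun_prop) (by fun_prop)) fun c => ?_
    rw [isometry_apply]
    exact hφ.tensorId_gnsTensor u.V u.inner_V hVi c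

/-- On cΩ ⊗ a this is α(xc)(1 ⊗ a) = α(x)·α(c)(1 ⊗ a), applied to Ω ⊗ 1. -/
theorem extendL_comp_act (hφ : α.IsInvariant φ) (x : C) :
    extendL hφ.inner_isometry ∘L act φ.GNS Q (MinTensor.tmul (φ.gnsStarAlgHom x) 1) =
      act φ.GNS Q (MinTensor.map φ.gnsStarAlgHom (StarAlgHom.id ℂ Q) (α.α x)) ∘L
        extendL hφ.inner_isometry := by
  refine ext_gns fun c a => ?_
  rw [ContinuousLinearMap.comp_apply, ContinuousLinearMap.comp_apply, act_tmul, one_mul,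
    ← mul_apply_eq_comp, ← map_mul, extendL_tmul, extendL_tmul, isometry_apply, isometry_apply,
    mulRight_gnsTensor, mulRight_gnsTensor, act_gnsTensor, map_mul α.α, mul_assoc]

/-- An action with a faithful invariant positive functional is implemented by a unitary
representation. -/
theorem isImplemented [PartialOrder Q] [StarOrderedRing Q] (hφ : α.IsInvariant φ)
    (hf : IsFaithful φ) : α.IsImplemented := by
  refine ⟨φ.GNS, inferInstance, inferInstance, inferInstance, hφ.unitaryRep, φ.gnsStarAlgHom,
    (injective_iff_map_eq_zero _).2 fun x hx => hf x ?_, fun x => ?_⟩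
  · rw [← inner_gns_cyclic, hx, zero_apply, inner_zero_left]
  · have h1 := hφ.extendL_comp_act x
    rw [← ContinuousLinearMap.comp_assoc]
    change (extendL hφ.inner_isometry ∘L _) ∘L hφ.unitaryRep.adj = _
    rw [h1, ContinuousLinearMap.comp_assoc]
    have h2 : extendL hφ.inner_isometry ∘L hφ.unitaryRep.adj = ContinuousLinearMap.id ℂ _ :=
      hφ.unitaryRep.comp_adj
    rw [h2, ContinuousLinearMap.comp_id]

end Action.IsInvariant

end Implementation

end CQG

end

theorem mainTheorem4 {C Q : Type u} [CStarAlgebra C] [PartialOrder C] [StarOrderedRing C]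
    [TopologicalSpace.SeparableSpace C] [CStarAlgebra Q] [PartialOrder Q] [StarOrderedRing Q]
    [Nontrivial Q] (G : CQG.CompactQuantumGroup Q) (α : CQG.Action G C) :
    List.TFAE [
      ∃ φ : C →ₚ[ℂ] ℂ, CQG.IsFaithful φ ∧ α.IsInvariant φ,
      α.IsImplemented,
      α.ReducedInjective] := by
  tfae_have 1 → 2 := fun ⟨_, hf, hφ⟩ => hφ.isImplemented hf
  -- Condition (c) contains the existence of the Haar state, which is therefore constructed here.
  tfae_have 2 → 3 := fun hα => by
    obtain ⟨h, hh⟩ := G.exists_isHaarState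
    exact ⟨h, hh, hα.injective_reduced hh.map_one⟩
  tfae_have 3 → 1 := fun ⟨h, hh, hinj⟩ => by
    obtain ⟨ψ, hψ⟩ := CQG.exists_isFaithful C
    exact ⟨α.average ψ h, α.isFaithful_average hψ hh hinj, α.isInvariant_average ψ hh⟩
  tfae_finish
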